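/- Let $\Omega\subset\mathbb{R}^3$ be a bounded open set and let $\kappa$ be a real number. Meshes. A cuboid is a box $E=\prod_{i=1}^3[a_i,b_i]$ with $a_i<b_i$, and $F_E(\hat x)=a+DF_E\,\hat x$, $DF_E=\operatorname{diag}(b_i-a_i)$, maps the reference cube $\hat E=[0,1]^3$ onto $E$. A conforming cuboid partition of $\Omega$ is a finite set $\mathcal{T}$ of cuboids with pairwise disjoint interiors such that $\Omega$ is the interior of $\bigcup_{E\in\mathcal{T}}E$ and any two different elements are disjoint or meet exactly in a common face, edge or vertex. It is $\kappa$-shape-regular if $\operatorname{diam}E\le\kappa\min_i(b_i-a_i)$ for all $E\in\mathcal{T}$. A conforming cuboid partition $\mathcal{T}_h$ of $\Omega$ satisfies (A2) with macroelement mesh $\mathcal{M}_h$ if $\mathcal{M}_h$ is also a conforming cuboid partition of $\Omega$, every element of $\mathcal{T}_h$ lies in some $M\in\mathcal{M}_h$, and for every $M\in\mathcal{M}_h$ the elements of $\mathcal{T}_h$ contained in $M$ are the cells of a $k_1\times k_2\times k_3$ tensor-product grid of $M$, where $k_1,k_2,k_3\in\{2,3\}$ may depend on $M$. Spaces. Write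 $\|\cdot\|$ for the norm of $L^2(\Omega,\mathbb{R}^3)$, $\|\varphi\|_1=(\|\varphi\|^2+\sum_{j}\|\partial_j\varphi\|^2)^{1/2}$ for the norm of $H^1(\Omega,\mathbb{R}^3)$, and $\|v\|_{\operatorname{curl}}=(\|v\|^2+\|\operatorname{curl}v\|^2)^{1/2}$ for the norm of $H(\operatorname{curl};\Omega)=\{v\in L^2(\Omega,\mathbb{R}^3):\operatorname{curl}v\in L^2(\Omega,\mathbb{R}^3)\}$; all derivatives are weak. Let $\tilde\Theta(\hat E)=\mathcal{P}_{0,1,1}\times\mathcal{P}_{1,0,1}\times\mathcal{P}_{1,1,0}$, where $\mathcal{P}_{k,l,m}$ is the space of polynomials in $\hat x_1,\hat x_2,\hat x_3$ of degree at most $k$, $l$, $m$ in the respective variable. The lowest-order Nédélec space is $$\tilde\Theta_h=\{\theta\in H(\operatorname{curl};\Omega):\ \forall E\in\mathcal{T}_h\ \exists\,\hat\theta\in\tilde\Theta(\hat E)\ \text{ with }\ \theta|_E=DF_E^{-T}\,\hat\theta\circ F_E^{-1}\}.$$ Claim. There is a constant $C>0$, depending only on $\Omega$ and $\kappa$, such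 that for every $\kappa$-shape-regular conforming cuboid partition $\mathcal{T}_h$ of $\Omega$ that satisfies (A2) with a macroelement mesh $\mathcal{M}_h$ there is a linear operator $\Pi:H^1(\Omega,\mathbb{R}^3)\to\tilde\Theta_h$ such that for all $\varphi\in H^1(\Omega,\mathbb{R}^3)$ $$\int_M\operatorname{curl}(\Pi\varphi)\cdot p_0\,dx=\int_M\operatorname{curl}\varphi\cdot p_0\,dx\quad\forall M\in\mathcal{M}_h,\ \forall p_0\in\mathbb{R}^3,\qquad\text{and}\qquad\|\Pi\varphi\|_{\operatorname{curl}}\le C\,\|\varphi\|_1 .$$ -/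

import Mathlib

open MeasureTheory Set
open scoped ContDiff Matrix

noncomputable section

namespace NedelecMacro

/-- Euclidean three-space. -/
abbrev E3 : Type := EuclideanSpace ℝ (Fin 3)

/-- `L²(Ω, ℝ³)`, with the norm `(∫_Ω |v|²)^{1/2}`. -/
abbrev L2 (Ω : Set E3) : Type := Lp E3 2 ((volume : Measure E3).restrict Ω)

/-! ### Weak derivatives and the spaces `H¹(Ω, ℝ³)` and `H(curl; Ω)` -/

/-- Smooth real functions with compact support contained in `Ω`. -/
structure IsTest (Ω : Set E3) (η : E3 → ℝ) : Prop where
  smooth : ContDiff ℝ ∞ η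
  compact : HasCompactSupport η
  supp : tsupport η ⊆ Ω

/-- The classical partial derivative `∂_j η`. -/
def pderiv (j : Fin 3) (η : E3 → ℝ) (x : E3) : ℝ :=
  fderiv ℝ η x (EuclideanSpace.single j 1)

/-- `G j` is the weak partial derivative `∂_j u` on `Ω`, for `j = 0, 1, 2`. -/
def IsWeakGrad (Ω : Set E3) (u : L2 Ω) (G : Fin 3 → L2 Ω) : Prop :=
  ∀ η : E3 → ℝ, IsTest Ω η → ∀ i j : Fin 3,
    ∫ x in Ω, u x i * pderiv j η x = -∫ x in Ω, G j x i * η x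

/-- `c` is the weak curl of `v` on `Ω`: `c_i = ∂_{i+1} v_{i+2} - ∂_{i+2} v_{i+1}`, with indices
modulo three, in the sense of distributions. -/
def IsWeakCurl (Ω : Set E3) (v c : L2 Ω) : Prop :=
  ∀ η : E3 → ℝ, IsTest Ω η → ∀ i : Fin 3,
    ∫ x in Ω, (v x (i + 2) * pderiv (i + 1) η x - v x (i + 1) * pderiv (i + 2) η x)
      = -∫ x in Ω, c x i * η x

theorem IsTest.continuous_pderiv {Ω : Set E3} {η : E3 → ℝ} (h : IsTest Ω η) (j : Fin 3) :
    Continuous (pderiv j η) :=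
  (h.smooth.continuous_fderiv (by simp)).clm_apply continuous_const

theorem IsTest.hasCompactSupport_pderiv {Ω : Set E3} {η : E3 → ℝ} (h : IsTest Ω η) (j : Fin 3) :
    HasCompactSupport (pderiv j η) := by
  have := h.compact.fderiv (𝕜 := ℝ)
  exact this.comp_left (g := fun L : E3 →L[ℝ] ℝ => L (EuclideanSpace.single j 1)) (by simp)

theorem integrable_coord_mul {Ω : Set E3} (u : L2 Ω) {ψ : E3 → ℝ} (hc : Continuous ψ)
    (hs : HasCompactSupport ψ) (i : Fin 3) :
    Integrable (fun x => u x i * ψ x) ((volume : Measure E3).restrict Ω) := by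
  have h1 : MemLp (fun x => u x i) 2 ((volume : Measure E3).restrict Ω) :=
    (EuclideanSpace.proj i : E3 →L[ℝ] ℝ).comp_memLp' (Lp.memLp u)
  have h2 : MemLp ψ 2 ((volume : Measure E3).restrict Ω) :=
    (hc.memLp_of_hasCompactSupport hs).restrict Ω
  exact h1.integrable_mul h2

theorem integral_coord_add {Ω : Set E3} (u v : L2 Ω) {ψ : E3 → ℝ} (hc : Continuous ψ)
    (hs : HasCompactSupport ψ) (i : Fin 3) :
    ∫ x in Ω, (u + v : L2 Ω) x i * ψ x = (∫ x in Ω, u x i * ψ x) + ∫ x in Ω, v x i * ψ x := by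
  rw [← integral_add (integrable_coord_mul u hc hs i) (integrable_coord_mul v hc hs i)]
  refine integral_congr_ae ?_
  filter_upwards [Lp.coeFn_add u v] with x hx
  rw [hx]
  simp [add_mul]

theorem integral_coord_smul {Ω : Set E3} (a : ℝ) (u : L2 Ω) (ψ : E3 → ℝ) (i : Fin 3) :
    ∫ x in Ω, (a • u : L2 Ω) x i * ψ x = a * ∫ x in Ω, u x i * ψ x := by
  rw [← integral_const_mul]
  refine integral_congr_ae ?_
  filter_upwards [Lp.coeFn_smul a u] with x hx
  rw [hx]
  simp [mul_assoc]

theorem isWeakCurl_iff {Ω : Set E3} {v c : L2 Ω} :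
    IsWeakCurl Ω v c ↔ ∀ η : E3 → ℝ, IsTest Ω η → ∀ i : Fin 3,
      (∫ x in Ω, v x (i + 2) * pderiv (i + 1) η x) - (∫ x in Ω, v x (i + 1) * pderiv (i + 2) η x)
        = -∫ x in Ω, c x i * η x := by
  refine forall₃_congr fun η h i => ?_
  rw [integral_sub (integrable_coord_mul v (h.continuous_pderiv _) (h.hasCompactSupport_pderiv _) _)
    (integrable_coord_mul v (h.continuous_pderiv _) (h.hasCompactSupport_pderiv _) _)]

/-- The Sobolev space `H¹(Ω, ℝ³)`. A field `φ` is stored together with its weak partial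
derivatives, as the pair `(φ, (∂₀φ, ∂₁φ, ∂₂φ))`; on an open set they are determined by `φ`. -/
def H1 (Ω : Set E3) : Submodule ℝ (L2 Ω × (Fin 3 → L2 Ω)) where
  carrier := {w | IsWeakGrad Ω w.1 w.2}
  zero_mem' := by
    intro η h i j
    have e : ∀ ψ : E3 → ℝ, ∫ x in Ω, (0 : L2 Ω) x i * ψ x = 0 := by
      intro ψ
      have := integral_coord_smul (0 : ℝ) (0 : L2 Ω) ψ i
      simpa only [zero_smul, zero_mul] using this
    simp only [Prod.fst_zero, Prod.snd_zero, Pi.zero_apply]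
    rw [e, e, neg_zero]
  add_mem' := by
    intro w z hw hz η h i j
    simp only [Prod.fst_add, Prod.snd_add, Pi.add_apply]
    rw [integral_coord_add _ _ (h.continuous_pderiv j) (h.hasCompactSupport_pderiv j),
      integral_coord_add _ _ h.smooth.continuous h.compact, hw η h i j, hz η h i j]
    ring
  smul_mem' := by
    intro a w hw η h i j
    simp only [Prod.smul_fst, Prod.smul_snd, Pi.smul_apply]
    rw [integral_coord_smul, integral_coord_smul, hw η h i j]
    ring

/-- The space `H(curl; Ω)`. A field `v` is stored together with its weak curl, as the pair
`(v, curl v)`; on an open set `curl v` is determined by `v`. -/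
def Hcurl (Ω : Set E3) : Submodule ℝ (L2 Ω × L2 Ω) where
  carrier := {w | IsWeakCurl Ω w.1 w.2}
  zero_mem' := by
    refine isWeakCurl_iff.2 fun η h i => ?_
    have e : ∀ (ψ : E3 → ℝ) (k : Fin 3), ∫ x in Ω, (0 : L2 Ω) x k * ψ x = 0 := by
      intro ψ k
      have := integral_coord_smul (0 : ℝ) (0 : L2 Ω) ψ k
      simpa only [zero_smul, zero_mul] using this
    simp only [Prod.fst_zero, Prod.snd_zero]
    rw [e, e, e, neg_zero, sub_zero]
  add_mem' := by
    intro w z hw hz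
    refine isWeakCurl_iff.2 fun η h i => ?_
    have h1 := isWeakCurl_iff.1 hw η h i
    have h2 := isWeakCurl_iff.1 hz η h i
    simp only [Prod.fst_add, Prod.snd_add]
    rw [integral_coord_add _ _ (h.continuous_pderiv _) (h.hasCompactSupport_pderiv _),
      integral_coord_add _ _ (h.continuous_pderiv _) (h.hasCompactSupport_pderiv _),
      integral_coord_add _ _ h.smooth.continuous h.compact]
    linarith
  smul_mem' := by
    intro a w hw
    refine isWeakCurl_iff.2 fun η h i => ?_
    have h1 := isWeakCurl_iff.1 hw η h i
    simp only [Prod.smul_fst, Prod.smul_snd]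
    rw [integral_coord_smul, integral_coord_smul, integral_coord_smul, ← mul_sub, h1]
    ring

/-- The norm `‖φ‖₁ = (‖φ‖² + ∑_j ‖∂_j φ‖²)^{1/2}` of `H¹(Ω, ℝ³)`. -/
def h1Norm {Ω : Set E3} (φ : H1 Ω) : ℝ :=
  Real.sqrt (‖φ.1.1‖ ^ 2 + ∑ j : Fin 3, ‖φ.1.2 j‖ ^ 2)

/-- The curl of `φ ∈ H¹(Ω, ℝ³)`, from its weak partial derivatives:
`(curl φ)_i = ∂_{i+1} φ_{i+2} - ∂_{i+2} φ_{i+1}`, with indices modulo three. -/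
def h1Curl {Ω : Set E3} (φ : H1 Ω) (x : E3) : E3 :=
  WithLp.toLp 2 fun i : Fin 3 => φ.1.2 (i + 1) x (i + 2) - φ.1.2 (i + 2) x (i + 1)

/-- The norm `‖v‖_curl = (‖v‖² + ‖curl v‖²)^{1/2}` of the pair `(v, curl v)`. -/
def curlNorm {Ω : Set E3} (w : L2 Ω × L2 Ω) : ℝ :=
  Real.sqrt (‖w.1‖ ^ 2 + ‖w.2‖ ^ 2)

/-! ### Cuboid meshes -/

/-- A nondegenerate cuboid `∏ᵢ [loᵢ, hiᵢ]` with edges in the three coordinate directions. -/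
@[ext] structure Cuboid where
  lo : Fin 3 → ℝ
  hi : Fin 3 → ℝ
  lt : ∀ i, lo i < hi i

namespace Cuboid

/-- The cuboid as a closed set. -/
def closedBox (E : Cuboid) : Set E3 := {x | ∀ i, E.lo i ≤ x i ∧ x i ≤ E.hi i}

/-- The interior of the cuboid. -/
def openBox (E : Cuboid) : Set E3 := {x | ∀ i, E.lo i < x i ∧ x i < E.hi i}

/-- The closed faces of all dimensions (vertices, edges, two-dimensional faces, and the cuboid
itself): in direction `i`, the `i`-th coordinate is fixed at `loᵢ` if `σ i = -1`, at `hiᵢ` if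
`σ i = 1`, and free if `σ i = 0`. -/
def face (E : Cuboid) (σ : Fin 3 → SignType) : Set E3 :=
  {x ∈ E.closedBox | ∀ i, (σ i = -1 → x i = E.lo i) ∧ (σ i = 1 → x i = E.hi i)}

/-- The Jacobian matrix `DF` of the map `F(x̂) = lo + DF x̂` of `[0,1]³` onto the cuboid. -/
def DF (E : Cuboid) : Matrix (Fin 3) (Fin 3) ℝ := Matrix.diagonal fun i => E.hi i - E.lo i

/-- The inverse map `F⁻¹` from the cuboid onto the reference cube `[0,1]³`. -/
def invF (E : Cuboid) (x : E3) : Fin 3 → ℝ := E.DF⁻¹ *ᵥ fun i => x i - E.lo i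

/-- The covariant transformation `θ = DF^{-T} (θ̂ ∘ F⁻¹)` of a polynomial field `θ̂`. -/
def covariant (E : Cuboid) (θ : Fin 3 → MvPolynomial (Fin 3) ℝ) (x : E3) : E3 :=
  WithLp.toLp 2 ((E.DF⁻¹)ᵀ *ᵥ fun i => MvPolynomial.eval (E.invF x) (θ i))

end Cuboid

/-- `T` is a conforming cuboid partition of `Ω`: the elements do not overlap, they fill `Ω` up to
its boundary, and two different elements are disjoint or meet in a common face, edge or vertex. -/
structure IsMesh (Ω : Set E3) (T : Finset Cuboid) : Prop where
  fills : interior (⋃ E ∈ T, E.closedBox) = Ω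
  nonoverlapping : ∀ E ∈ T, ∀ E' ∈ T, E ≠ E' → Disjoint E.openBox E'.openBox
  conforming : ∀ E ∈ T, ∀ E' ∈ T, E ≠ E' → (E.closedBox ∩ E'.closedBox).Nonempty →
    ∃ σ σ' : Fin 3 → SignType,
      E.closedBox ∩ E'.closedBox = E.face σ ∧ E.closedBox ∩ E'.closedBox = E'.face σ'

/-- Shape regularity with constant `κ`: `h_E = diam E ≤ κ ρ_E`, where `ρ_E`, the diameter of the
largest ball in `E`, is the shortest edge length. -/
def IsShapeRegular (κ : ℝ) (T : Finset Cuboid) : Prop :=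
  ∀ E ∈ T, ∀ i, Metric.diam E.closedBox ≤ κ * (E.hi i - E.lo i)

/-- The elements of `T` contained in `M` form a `k₁ × k₂ × k₃` grid that subdivides `M`, with every
`kᵢ ∈ {2, 3}`; `g i 0 < ⋯ < g i (k i)` are the grid points in direction `i`. -/
def IsMacroelement (T : Finset Cuboid) (M : Cuboid) : Prop :=
  ∃ (k : Fin 3 → ℕ) (g : Fin 3 → ℕ → ℝ),
    (∀ i, k i = 2 ∨ k i = 3) ∧ (∀ i, ∀ n < k i, g i n < g i (n + 1)) ∧
    (∀ i, g i 0 = M.lo i) ∧ (∀ i, g i (k i) = M.hi i) ∧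
    ∀ E : Cuboid, (E ∈ T ∧ E.closedBox ⊆ M.closedBox) ↔
      ∃ m : Fin 3 → ℕ, ∀ i, m i < k i ∧ E.lo i = g i (m i) ∧ E.hi i = g i (m i + 1)

/-- `𝓜` is a conforming mesh of macroelements into which the elements of `T` are agglomerated. -/
structure IsMacroMesh (Ω : Set E3) (T 𝓜 : Finset Cuboid) : Prop where
  mesh : IsMesh Ω 𝓜
  macroelement : ∀ M ∈ 𝓜, IsMacroelement T M
  agglomerates : ∀ E ∈ T, ∃ M ∈ 𝓜, E.closedBox ⊆ M.closedBox

/-! ### The lowest-order Nédélec space -/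

/-- The reference space `P_{0,1,1} × P_{1,0,1} × P_{1,1,0}`: component `i` has degree zero in
variable `i` and degree at most one in each of the other two variables. -/
def refNedelec : Submodule ℝ (Fin 3 → MvPolynomial (Fin 3) ℝ) where
  carrier := {θ | ∀ i j, (θ i).degreeOf j ≤ if j = i then 0 else 1}
  zero_mem' := by intro i j; simp
  add_mem' := by
    intro a b ha hb i j
    exact (MvPolynomial.degreeOf_add_le j (a i) (b i)).trans (max_le (ha i j) (hb i j))
  smul_mem' := by
    intro c a ha i j
    refine le_trans ?_ (ha i j)
    simp only [Pi.smul_apply, MvPolynomial.smul_eq_C_mul]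
    exact MvPolynomial.degreeOf_C_mul_le _ _ _

theorem Cuboid.covariant_add (E : Cuboid) (θ ζ : Fin 3 → MvPolynomial (Fin 3) ℝ) (x : E3) :
    E.covariant (θ + ζ) x = E.covariant θ x + E.covariant ζ x := by
  unfold Cuboid.covariant
  rw [← WithLp.toLp_add, ← Matrix.mulVec_add]
  congr 2
  ext i
  simp

theorem Cuboid.covariant_smul (E : Cuboid) (a : ℝ) (θ : Fin 3 → MvPolynomial (Fin 3) ℝ) (x : E3) :
    E.covariant (a • θ) x = a • E.covariant θ x := by
  unfold Cuboid.covariant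
  rw [← WithLp.toLp_smul, ← Matrix.mulVec_smul]
  congr 2
  ext i
  simp

/-- The lowest-order Nédélec space on `T`: the fields of `H(curl; Ω)` (with their curls) that on
every element are covariant images of fields of the reference space. -/
def Nedelec (Ω : Set E3) (T : Finset Cuboid) : Submodule ℝ (L2 Ω × L2 Ω) where
  carrier := {w | w ∈ Hcurl Ω ∧ ∀ E ∈ T, ∃ θ ∈ refNedelec,
    ∀ᵐ x ∂((volume : Measure E3).restrict Ω), x ∈ E.openBox → w.1 x = E.covariant θ x}
  zero_mem' := by
    refine ⟨Submodule.zero_mem _, fun E _ => ⟨0, Submodule.zero_mem _, ?_⟩⟩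
    filter_upwards [Lp.coeFn_zero E3 2 ((volume : Measure E3).restrict Ω)] with x hx _
    have h0 := E.covariant_smul 0 0 x
    rw [zero_smul, zero_smul] at h0
    rw [h0]
    exact hx
  add_mem' := by
    rintro w z ⟨hw, hw'⟩ ⟨hz, hz'⟩
    refine ⟨Submodule.add_mem _ hw hz, fun E hE => ?_⟩
    obtain ⟨θ, hθ, h1⟩ := hw' E hE
    obtain ⟨ζ, hζ, h2⟩ := hz' E hE
    refine ⟨θ + ζ, Submodule.add_mem _ hθ hζ, ?_⟩
    filter_upwards [h1, h2, Lp.coeFn_add w.1 z.1] with x h1 h2 hx hxE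
    rw [E.covariant_add, ← h1 hxE, ← h2 hxE]
    exact hx
  smul_mem' := by
    rintro a w ⟨hw, hw'⟩
    refine ⟨Submodule.smul_mem _ a hw, fun E hE => ?_⟩
    obtain ⟨θ, hθ, h1⟩ := hw' E hE
    refine ⟨a • θ, Submodule.smul_mem _ a hθ, ?_⟩
    filter_upwards [h1, Lp.coeFn_smul a w.1] with x h1 hx hxE
    rw [E.covariant_smul, ← h1 hxE]
    exact hx

end NedelecMacro

end

/-! On a macroelement the interpolant uses three functions per direction: the hat functions of the
two end points and the sum of all interior hats, which together add up to one. Component `a` is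
constant in direction `a` and a combination of the nine tensor products in the other two directions.
On a fine element it is therefore a lowest-order Nédélec field, and membership in H(curl) only asks
that component `a` be continuous across faces normal to the two other directions, which amounts to
three equal coefficients per face.

The integral of `∂_b` of component `a` over `M` depends only on the means of that component over the
two faces normal to `b`. Hence the moments of the curl are preserved as soon as all tangential face
means are those of `φ`. Each such face carries one coefficient of its own, whose shape function
vanishes on the edges of the face parallel to `a` and has mean at least 1/2
(`Knots.half_le_mean_zero`). This coefficient is solved for; its existence is what the interior grid
point of a macroelement is for. The edge coefficients are free. Fields in H¹ have no trace on edges,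
so, as in Clément interpolation, the value is the volume mean over one chosen cuboid at the edge.
Cuboids may meet in an edge without being linked by faces inside `Ω`, so the choice is made for each
connected component of a graph of face neighbours (`cornerGraph`) and not for each geometric edge.

Stability: constants are reproduced, so only the differences between the coefficients and the volume
mean of `M` matter. Face means are written as volume integrals of `φ` and `∂_b φ`, which replaces
traces and gives a scaled Poincaré bound (`vol_mul_sq_faceMean_sub_le`). The two expressions for a
common face agree (`faceMean_eq_of_adj`), so volume means can be compared from neighbour to
neighbour around an edge (`abs_volMean_sub_le_of_reachable`). A component has at most nine members,
all with the same length in direction `a`; summing squares with this length as weight yields the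
gradient norm (`sum_len_mul_sq_edgeDeviation_le`). -/

noncomputable section

namespace NedelecMacro

/-! ### Measure and integration on cuboids. -/

namespace Cuboid

theorem isOpen_openBox (E : Cuboid) : IsOpen E.openBox := by
  simp only [openBox, ofPred_forall, ofPred_and]
  refine isOpen_iInter_of_finite fun i => ?_
  exact (isOpen_lt continuous_const (by fun_prop)).inter (isOpen_lt (by fun_prop) continuous_const)

theorem isClosed_closedBox (E : Cuboid) : IsClosed E.closedBox := by
  simp only [closedBox, ofPred_forall, ofPred_and]
  refine isClosed_iInter fun i => ?_
  exact (isClosed_le continuous_const (by fun_prop)).inter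
    (isClosed_le (by fun_prop) continuous_const)

theorem measurableSet_openBox (E : Cuboid) : MeasurableSet E.openBox :=
  E.isOpen_openBox.measurableSet

theorem openBox_subset_closedBox (E : Cuboid) : E.openBox ⊆ E.closedBox :=
  fun _ hx i => ⟨(hx i).1.le, (hx i).2.le⟩

/-- The edge length in direction `i`. -/
def len (E : Cuboid) (i : Fin 3) : ℝ := E.hi i - E.lo i

theorem len_pos (E : Cuboid) (i : Fin 3) : 0 < E.len i := sub_pos.2 (E.lt i)

/-- The volume of a cuboid. -/
def vol (E : Cuboid) : ℝ := ∏ i, E.len i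

theorem vol_pos (E : Cuboid) : 0 < E.vol := Finset.prod_pos fun i _ => E.len_pos i

/-- The open box in coordinates. -/
def piBox (E : Cuboid) : Set (Fin 3 → ℝ) := Set.univ.pi fun i => Ioo (E.lo i) (E.hi i)

theorem toLp_mem_openBox {E : Cuboid} {y : Fin 3 → ℝ} :
    WithLp.toLp 2 y ∈ E.openBox ↔ y ∈ E.piBox := by
  simp [openBox, piBox, Set.mem_pi]

theorem integral_openBox_eq (E : Cuboid) (f : E3 → ℝ) :
    ∫ x in E.openBox, f x = ∫ y in E.piBox, f (WithLp.toLp 2 y) := by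
  have h := (PiLp.volume_preserving_toLp (Fin 3)).setIntegral_preimage_emb
    (MeasurableEquiv.toLp 2 (Fin 3 → ℝ)).measurableEmbedding f E.openBox
  rw [← h]
  have e : (WithLp.toLp 2) ⁻¹' E.openBox = E.piBox := by
    ext y
    exact toLp_mem_openBox
  rw [e]

theorem integrableOn_openBox_iff (E : Cuboid) (f : E3 → ℝ) :
    IntegrableOn f E.openBox ↔ IntegrableOn (fun y => f (WithLp.toLp 2 y)) E.piBox := by
  have h := (PiLp.volume_preserving_toLp (Fin 3)).integrableOn_comp_preimage
    (MeasurableEquiv.toLp 2 (Fin 3 → ℝ)).measurableEmbedding (f := f) (s := E.openBox)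
  rw [← h]
  have e : (WithLp.toLp 2) ⁻¹' E.openBox = E.piBox := by
    ext y
    exact toLp_mem_openBox
  rw [e]
  rfl

theorem integral_openBox_prod (E : Cuboid) (f : Fin 3 → ℝ → ℝ) :
    ∫ x in E.openBox, ∏ i, f i (x i) = ∏ i, ∫ t in Ioo (E.lo i) (E.hi i), f i t := by
  rw [integral_openBox_eq, piBox, volume_pi, Measure.restrict_pi_pi]
  exact integral_fintype_prod_eq_prod f

theorem volume_openBox (E : Cuboid) : volume E.openBox = ENNReal.ofReal E.vol := by
  have h := (PiLp.volume_preserving_toLp (Fin 3)).measure_preimage_emb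
    (MeasurableEquiv.toLp 2 (Fin 3 → ℝ)).measurableEmbedding E.openBox
  have e : (WithLp.toLp 2) ⁻¹' E.openBox = E.piBox := by
    ext y
    exact toLp_mem_openBox
  rw [← h, e, piBox, Real.volume_pi_Ioo, vol, ENNReal.ofReal_prod_of_nonneg]
  · rfl
  · exact fun i _ => (E.len_pos i).le

theorem volume_closedBox_diff (E : Cuboid) : volume (E.closedBox \ E.openBox) = 0 := by
  have h := (PiLp.volume_preserving_toLp (Fin 3)).measure_preimage_emb
    (MeasurableEquiv.toLp 2 (Fin 3 → ℝ)).measurableEmbedding (E.closedBox \ E.openBox)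
  rw [← h]
  have e : (WithLp.toLp 2) ⁻¹' (E.closedBox \ E.openBox) = Icc E.lo E.hi \ E.piBox := by
    ext y
    simp [closedBox, openBox, piBox, Pi.le_def, forall_and, Set.mem_pi]
  rw [e, piBox]
  have := (Measure.univ_pi_Ioo_ae_eq_Icc (μ := fun _ : Fin 3 => (volume : Measure ℝ))
    (f := E.lo) (g := E.hi))
  rw [← volume_pi] at this
  exact (ae_le_set.1 this.symm.le)

theorem isBounded_openBox (E : Cuboid) : volume E.openBox ≠ ⊤ := by
  rw [volume_openBox]; exact ENNReal.ofReal_ne_top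

/-- The range of the two remaining coordinates of a cuboid on its faces normal to direction `b`. -/
def sideBox (E : Cuboid) (b : Fin 3) : Set (Fin 2 → ℝ) :=
  Set.univ.pi fun j => Ioo (E.lo (b.succAbove j)) (E.hi (b.succAbove j))

/-- The point with coordinate `t` in direction `b` and remaining coordinates `y`. -/
def point (b : Fin 3) (t : ℝ) (y : Fin 2 → ℝ) : E3 :=
  WithLp.toLp 2 (b.insertNth (α := fun _ => ℝ) t y)

@[simp] theorem point_same (b : Fin 3) (t : ℝ) (y : Fin 2 → ℝ) : point b t y b = t := by
  simp [point]

@[simp] theorem point_succAbove (b : Fin 3) (t : ℝ) (y : Fin 2 → ℝ) (j : Fin 2) :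
    point b t y (b.succAbove j) = y j := by
  simp [point]

theorem integral_openBox_fubini (E : Cuboid) (b : Fin 3) (f : E3 → ℝ)
    (hf : IntegrableOn f E.openBox) :
    ∫ x in E.openBox, f x =
      ∫ y in E.sideBox b, ∫ t in Ioo (E.lo b) (E.hi b), f (point b t y) := by
  rw [integral_openBox_eq]
  rw [integrableOn_openBox_iff] at hf
  have hp := (volume_preserving_piFinSuccAbove (fun _ : Fin 3 => ℝ) b).symm
  have hemb := (MeasurableEquiv.piFinSuccAbove (fun _ : Fin 3 => ℝ) b).symm.measurableEmbedding
  have e : (MeasurableEquiv.piFinSuccAbove (fun _ : Fin 3 => ℝ) b).symm ⁻¹' E.piBox =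
      Ioo (E.lo b) (E.hi b) ×ˢ E.sideBox b := by
    ext ⟨t, y⟩
    simp [piBox, sideBox, Set.mem_pi, Fin.forall_iff_succAbove b]
  have h1 := hp.setIntegral_preimage_emb hemb (fun y => f (WithLp.toLp 2 y)) E.piBox
  have h2 := (hp.integrableOn_comp_preimage hemb (f := fun y => f (WithLp.toLp 2 y))
    (s := E.piBox)).2 hf
  rw [e] at h1 h2
  rw [← h1]
  rw [IntegrableOn, Measure.volume_eq_prod, ← Measure.prod_restrict] at h2
  rw [Measure.volume_eq_prod, ← Measure.prod_restrict, integral_prod_symm _ (by exact h2)]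
  rfl

theorem exists_mem_openBox_inter {E E' : Cuboid}
    (h : ∀ i, E.lo i < E'.hi i ∧ E'.lo i < E.hi i) : (E.openBox ∩ E'.openBox).Nonempty := by
  have h' : ∀ i, ∃ t, t ∈ Ioo (E.lo i) (E.hi i) ∧ t ∈ Ioo (E'.lo i) (E'.hi i) := by
    intro i
    obtain ⟨t, h1, h2⟩ := exists_between (show max (E.lo i) (E'.lo i) < min (E.hi i) (E'.hi i) from
      max_lt (lt_min (E.lt i) (h i).1) (lt_min (h i).2 (E'.lt i)))
    rw [max_lt_iff] at h1
    rw [lt_min_iff] at h2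
    exact ⟨t, ⟨h1.1, h2.1⟩, h1.2, h2.2⟩
  choose t h1 h2 using h'
  exact ⟨WithLp.toLp 2 t, fun i => h1 i, fun i => h2 i⟩

/-- `M'` is the neighbour of `M` across the full face of `M` on its upper side in direction `b`. -/
def Adj (b : Fin 3) (M M' : Cuboid) : Prop :=
  M.hi b = M'.lo b ∧ ∀ c ≠ b, M.lo c = M'.lo c ∧ M.hi c = M'.hi c

end Cuboid

open Cuboid

/-! ### Face neighbours in a conforming mesh. -/

namespace IsMesh

variable {Ω : Set E3} {T : Finset Cuboid}

theorem openBox_subset (h : IsMesh Ω T) {E : Cuboid} (hE : E ∈ T) : E.openBox ⊆ Ω := by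
  rw [← h.fills]
  exact interior_maximal (fun x hx => mem_biUnion hE (E.openBox_subset_closedBox hx))
    E.isOpen_openBox

theorem isOpen (h : IsMesh Ω T) : IsOpen Ω := h.fills ▸ isOpen_interior

theorem subset_iUnion (h : IsMesh Ω T) : Ω ⊆ ⋃ E ∈ T, E.closedBox :=
  h.fills ▸ interior_subset

theorem eq_of_overlap (h : IsMesh Ω T) {E E' : Cuboid} (hE : E ∈ T) (hE' : E' ∈ T)
    (ho : ∀ i, E.lo i < E'.hi i ∧ E'.lo i < E.hi i) : E = E' := by
  by_contra hne
  exact (exists_mem_openBox_inter ho).not_disjoint (h.nonoverlapping E hE E' hE' hne)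

theorem ae_eq_iUnion (h : IsMesh Ω T) : Ω =ᵐ[volume] ⋃ E ∈ T, E.openBox := by
  refine Filter.EventuallyLE.antisymm (ae_le_set.2 ?_)
    (Filter.Eventually.of_forall (iUnion₂_subset fun E hE => h.openBox_subset hE))
  refine measure_mono_null (t := ⋃ E ∈ T, (E.closedBox \ E.openBox)) ?_
    ((measure_biUnion_null_iff T.countable_toSet).2 fun E _ => E.volume_closedBox_diff)
  rintro x ⟨hx, hx'⟩
  obtain ⟨E, hE, hxE⟩ := mem_iUnion₂.1 (h.subset_iUnion hx)
  exact mem_biUnion hE ⟨hxE, fun hx'' => hx' (mem_biUnion hE hx'')⟩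

theorem integral_eq_sum (h : IsMesh Ω T) {f : E3 → ℝ} (hf : IntegrableOn f Ω) :
    ∫ x in Ω, f x = ∑ E ∈ T, ∫ x in E.openBox, f x := by
  rw [setIntegral_congr_set h.ae_eq_iUnion]
  refine integral_biUnion_finset T (fun E _ => E.measurableSet_openBox) ?_ fun E hE =>
    hf.mono_set (h.openBox_subset hE)
  exact fun E hE E' hE' hne => h.nonoverlapping E hE E' hE' hne

/-- The place where conformity enters. A point of the contact plane that is strictly inside both
ranges in the directions other than `b` forces the common face to be free in those directions.
Sliding the point along such a direction within one cuboid then never leaves the other, so the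
ranges coincide. -/
theorem adj_of_touch (h : IsMesh Ω T) {E E' : Cuboid} (hE : E ∈ T) (hE' : E' ∈ T) {b : Fin 3}
    (hb : E.hi b = E'.lo b) (ho : ∀ c ≠ b, E.lo c < E'.hi c ∧ E'.lo c < E.hi c) :
    Adj b E E' := by
  have hne : E ≠ E' := by
    rintro rfl
    exact (E.lt b).ne' hb
  have h' : ∀ c, ∃ t, (c = b → t = E.hi b) ∧ (c ≠ b → t ∈ Ioo (E.lo c) (E.hi c) ∧
      t ∈ Ioo (E'.lo c) (E'.hi c)) := by
    intro c
    by_cases hc : c = b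
    · exact ⟨E.hi b, fun _ => rfl, fun h => absurd hc h⟩
    obtain ⟨t, h1, h2⟩ := exists_between (show max (E.lo c) (E'.lo c) < min (E.hi c) (E'.hi c) from
      max_lt (lt_min (E.lt c) (ho c hc).1) (lt_min (ho c hc).2 (E'.lt c)))
    rw [max_lt_iff] at h1
    rw [lt_min_iff] at h2
    exact ⟨t, fun h => absurd h hc, fun _ => ⟨⟨h1.1, h2.1⟩, h1.2, h2.2⟩⟩
  choose t ht ht' using h'
  have mem : ∀ c ≠ b, ∀ s, (s ∈ Icc (E.lo c) (E.hi c) →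
      WithLp.toLp 2 (Function.update t c s) ∈ E.closedBox) ∧ (s ∈ Icc (E'.lo c) (E'.hi c) →
      WithLp.toLp 2 (Function.update t c s) ∈ E'.closedBox) := by
    intro c hc s
    constructor <;> intro hs i <;> by_cases hi : i = c
    · subst hi; simpa using hs
    · by_cases hib : i = b
      · subst hib; simp [hi, ht, (E.lt i).le]
      · simpa [hi] using Ioo_subset_Icc_self (ht' i hib).1
    · subst hi; simpa using hs
    · by_cases hib : i = b
      · subst hib; simp [hi, ht, hb, (E'.lt i).le]
      · simpa [hi] using Ioo_subset_Icc_self (ht' i hib).2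
  have mem0 : WithLp.toLp 2 t ∈ E.closedBox ∩ E'.closedBox := by
    obtain ⟨c, hc⟩ := exists_ne b
    have := mem c hc (t c)
    rw [Function.update_eq_self] at this
    exact ⟨this.1 (Ioo_subset_Icc_self (ht' c hc).1), this.2 (Ioo_subset_Icc_self (ht' c hc).2)⟩
  obtain ⟨σ, σ', h1, h2⟩ := h.conforming E hE E' hE' hne ⟨_, mem0⟩
  -- A coordinate fixed at an end value would contradict the strict inequalities for `t c`.
  have hσ : ∀ c ≠ b, σ c = 0 ∧ σ' c = 0 := by
    intro c hc
    have m1 := ((h1 ▸ mem0 : WithLp.toLp 2 t ∈ E.face σ)).2 c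
    have m2 := ((h2 ▸ mem0 : WithLp.toLp 2 t ∈ E'.face σ')).2 c
    obtain ⟨⟨k1, k2⟩, k3, k4⟩ := ht' c hc
    constructor
    · rcases hs : σ c with _ | _ | _
      · rfl
      · exact absurd (m1.1 hs) k1.ne'
      · exact absurd (m1.2 hs) k2.ne
    · rcases hs : σ' c with _ | _ | _
      · rfl
      · exact absurd (m2.1 hs) k3.ne'
      · exact absurd (m2.2 hs) k4.ne
  have key : ∀ c ≠ b, ∀ s, s ∈ Icc (E.lo c) (E.hi c) ↔ s ∈ Icc (E'.lo c) (E'.hi c) := by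
    intro c hc s
    constructor
    · intro hs
      have : WithLp.toLp 2 (Function.update t c s) ∈ E.face σ := by
        refine ⟨(mem c hc s).1 hs, fun i => ?_⟩
        by_cases hi : i = c
        · subst hi; simp [(hσ i hc).1]
        · simpa [hi] using ((h1 ▸ mem0 : WithLp.toLp 2 t ∈ E.face σ)).2 i
      rw [← h1] at this
      simpa using this.2 c
    · intro hs
      have : WithLp.toLp 2 (Function.update t c s) ∈ E'.face σ' := by
        refine ⟨(mem c hc s).2 hs, fun i => ?_⟩
        by_cases hi : i = c
        · subst hi; simp [(hσ i hc).2]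
        · simpa [hi] using ((h2 ▸ mem0 : WithLp.toLp 2 t ∈ E'.face σ')).2 i
      rw [← h2] at this
      simpa using this.1 c
  refine ⟨hb, fun c hc => ?_⟩
  have k1 := (key c hc (E.lo c)).1 ⟨le_rfl, (E.lt c).le⟩
  have k2 := (key c hc (E.hi c)).1 ⟨(E.lt c).le, le_rfl⟩
  have k3 := (key c hc (E'.lo c)).2 ⟨le_rfl, (E'.lt c).le⟩
  have k4 := (key c hc (E'.hi c)).2 ⟨(E'.lt c).le, le_rfl⟩
  exact ⟨le_antisymm k3.1 k1.1, le_antisymm k2.2 k4.2⟩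

/-- The finitely many cuboids that miss `x` form a closed set, which also misses a neighbourhood of
`x`. A cuboid that contains `x + ε • v` for small `ε` must therefore contain `x`. -/
theorem exists_mem_along (h : IsMesh Ω T) {x : E3} (hx : x ∈ Ω) (v : E3) :
    ∃ ε > 0, ∃ E ∈ T, x ∈ E.closedBox ∧ x + (ε : ℝ) • v ∈ E.closedBox := by
  classical
  have hc : IsClosed (⋃ E ∈ T.filter fun E => x ∉ E.closedBox, E.closedBox) :=
    isClosed_biUnion_finset fun E _ => E.isClosed_closedBox
  have hU : IsOpen (Ω \ ⋃ E ∈ T.filter fun E => x ∉ E.closedBox, E.closedBox) :=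
    h.isOpen.sdiff hc
  have hxU : x ∈ Ω \ ⋃ E ∈ T.filter fun E => x ∉ E.closedBox, E.closedBox := by
    refine ⟨hx, fun hx' => ?_⟩
    obtain ⟨E, hE, hxE⟩ := mem_iUnion₂.1 hx'
    exact (Finset.mem_filter.1 hE).2 hxE
  have hcont : Filter.Tendsto (fun ε : ℝ => x + ε • v) (nhdsWithin 0 (Ioi 0)) (nhds x) := by
    have : Continuous fun ε : ℝ => x + ε • v := by fun_prop
    simpa using (this.tendsto 0).mono_left nhdsWithin_le_nhds
  obtain ⟨ε, hε, hpos⟩ := ((hcont.eventually (hU.mem_nhds hxU)).and self_mem_nhdsWithin).exists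
  obtain ⟨E, hE, hxE⟩ := mem_iUnion₂.1 (h.subset_iUnion hε.1)
  refine ⟨ε, hpos, E, hE, ?_, hxE⟩
  by_contra hn
  exact hε.2 (mem_biUnion (show E ∈ (T.filter fun E => x ∉ E.closedBox) from
    Finset.mem_filter.2 ⟨hE, hn⟩) hxE)

/-- From a point of `Ω` on the open face one can move upwards and stay in the mesh. The cuboid
entered reaches beyond the face, so it is not `M`, and if it began below the face it would overlap
`M`. -/
theorem exists_adj_hi (h : IsMesh Ω T) {M : Cuboid} (hM : M ∈ T) {b : Fin 3} {x : E3}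
    (hx : x ∈ Ω) (hxb : x b = M.hi b) (hxc : ∀ c ≠ b, M.lo c < x c ∧ x c < M.hi c) :
    ∃ M' ∈ T, Adj b M M' := by
  obtain ⟨ε, hε, M', hM', h1, h2⟩ := h.exists_mem_along hx (EuclideanSpace.single b 1)
  have h3 := (h2 b).2
  simp only [PiLp.add_apply, PiLp.smul_apply, PiLp.single_apply, if_true, smul_eq_mul,
    mul_one, hxb] at h3
  have h4 : ∀ c ≠ b, M.lo c < M'.hi c ∧ M'.lo c < M.hi c := fun c hc =>
    ⟨(hxc c hc).1.trans_le (h1 c).2, (h1 c).1.trans_lt (hxc c hc).2⟩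
  have h5 := (h1 b).1
  rw [hxb] at h5
  refine ⟨M', hM', h.adj_of_touch hM hM' (le_antisymm ?_ h5) h4⟩
  by_contra hlt
  push Not at hlt
  have : M = M' := h.eq_of_overlap hM hM' fun i => by
    by_cases hi : i = b
    · subst hi; exact ⟨by linarith [M.lt i], hlt⟩
    · exact h4 i hi
  subst this
  linarith

theorem exists_adj_lo (h : IsMesh Ω T) {M : Cuboid} (hM : M ∈ T) {b : Fin 3} {x : E3}
    (hx : x ∈ Ω) (hxb : x b = M.lo b) (hxc : ∀ c ≠ b, M.lo c < x c ∧ x c < M.hi c) :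
    ∃ M' ∈ T, Adj b M' M := by
  obtain ⟨ε, hε, M', hM', h1, h2⟩ := h.exists_mem_along hx (-EuclideanSpace.single b 1)
  have h3 := (h2 b).1
  simp only [PiLp.add_apply, PiLp.smul_apply, PiLp.neg_apply, PiLp.single_apply, if_true,
    smul_eq_mul, mul_neg, mul_one, hxb] at h3
  have h4 : ∀ c ≠ b, M'.lo c < M.hi c ∧ M.lo c < M'.hi c := fun c hc =>
    ⟨(h1 c).1.trans_lt (hxc c hc).2, (hxc c hc).1.trans_le (h1 c).2⟩
  have h5 := (h1 b).2
  rw [hxb] at h5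
  refine ⟨M', hM', h.adj_of_touch hM' hM (le_antisymm ?_ h5) h4⟩
  by_contra hlt
  push Not at hlt
  have : M' = M := h.eq_of_overlap hM' hM fun i => by
    by_cases hi : i = b
    · subst hi; exact ⟨by linarith [M.lt i], hlt⟩
    · exact h4 i hi
  subst this
  linarith

theorem adj_right_unique (h : IsMesh Ω T) {b : Fin 3} {M M₁ M₂ : Cuboid} (h₁ : M₁ ∈ T)
    (h₂ : M₂ ∈ T) (a₁ : Adj b M M₁) (a₂ : Adj b M M₂) : M₁ = M₂ :=
  h.eq_of_overlap h₁ h₂ fun i => by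
    by_cases hi : i = b
    · subst hi
      have := M₁.lt i; have := M₂.lt i; have := a₁.1; have := a₂.1
      constructor <;> linarith
    · rw [← (a₁.2 i hi).1, ← (a₁.2 i hi).2, ← (a₂.2 i hi).1, ← (a₂.2 i hi).2]
      exact ⟨M.lt i, M.lt i⟩

theorem adj_left_unique (h : IsMesh Ω T) {b : Fin 3} {M M₁ M₂ : Cuboid} (h₁ : M₁ ∈ T)
    (h₂ : M₂ ∈ T) (a₁ : Adj b M₁ M) (a₂ : Adj b M₂ M) : M₁ = M₂ :=
  h.eq_of_overlap h₁ h₂ fun i => by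
    by_cases hi : i = b
    · subst hi
      have := M₁.lt i; have := M₂.lt i; have := a₁.1; have := a₂.1
      constructor <;> linarith
    · rw [(a₁.2 i hi).1, (a₁.2 i hi).2, (a₂.2 i hi).1, (a₂.2 i hi).2]
      exact ⟨M.lt i, M.lt i⟩

end IsMesh

namespace Cuboid

/-- The union of two cuboids that are adjacent in direction `b`. -/
def merge (b : Fin 3) (M M' : Cuboid) (h : Adj b M M') : Cuboid where
  lo := M.lo
  hi := Function.update M.hi b (M'.hi b)
  lt := fun i => by
    by_cases hi : i = b
    · subst hi; have := M.lt i; have := M'.lt i; have := h.1; simp; linarith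
    · simp [hi, M.lt i]

/-- `Ω` is the interior of the union of the closed cuboids, so it contains the open common face,
which belongs to neither open box. -/
theorem merge_openBox_subset {Ω : Set E3} {T : Finset Cuboid} (hT : IsMesh Ω T) {b : Fin 3}
    {M M' : Cuboid} (h : Adj b M M') (hM : M ∈ T) (hM' : M' ∈ T) :
    (merge b M M' h).openBox ⊆ Ω := by
  rw [← hT.fills]
  refine interior_maximal (fun x hx => ?_) (isOpen_openBox _)
  by_cases hxb : x b ≤ M.hi b
  · refine mem_biUnion hM fun i => ⟨(hx i).1.le, ?_⟩
    by_cases hi : i = b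
    · subst hi; exact hxb
    · have := (hx i).2.le
      simpa [merge, hi] using this
  · refine mem_biUnion hM' fun i => ?_
    by_cases hi : i = b
    · subst hi
      have := (hx i).2.le
      simp only [merge, Function.update_self] at this
      rw [← h.1]
      exact ⟨by linarith, this⟩
    · have h1 := (hx i).1.le
      have h2 := (hx i).2.le
      simp only [merge, ne_eq, hi, not_false_eq_true, Function.update_of_ne] at h1 h2
      rw [← (h.2 i hi).1, ← (h.2 i hi).2]
      exact ⟨h1, h2⟩

end Cuboid

/-! ### Shape functions of one variable. -/

theorem sum_signType {A : Type*} [AddCommMonoid A] (f : SignType → A) :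
    ∑ s, f s = f (-1) + (f 0 + f 1) := by
  have : (Finset.univ : Finset SignType) = {-1, 0, 1} := by decide
  rw [this, Finset.sum_insert (by decide), Finset.sum_insert (by decide), Finset.sum_singleton]

/-- The end points `lo < hi` of an interval with the first and the last interior grid point. -/
structure Knots where
  lo : ℝ
  a : ℝ
  b : ℝ
  hi : ℝ
  lo_lt : lo < a
  a_le : a ≤ b
  lt_hi : b < hi

namespace Knots

/-- The hat function of the lower end point (`-1`), of the upper end point (`1`), and the sum of
the hat functions of all interior grid points (`0`). -/
def shape (K : Knots) : SignType → ℝ → ℝ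
  | .neg => fun x => max 0 ((K.a - x) / (K.a - K.lo))
  | .zero => fun x => 1 - max 0 ((K.a - x) / (K.a - K.lo)) - max 0 ((x - K.b) / (K.hi - K.b))
  | .pos => fun x => max 0 ((x - K.b) / (K.hi - K.b))

/-- The derivative of `shape`, off the grid points. -/
def dshape (K : Knots) : SignType → ℝ → ℝ
  | .neg => fun x => if x < K.a then -(1 / (K.a - K.lo)) else 0
  | .zero => fun x => (if x < K.a then 1 / (K.a - K.lo) else 0) -
      if K.b < x then 1 / (K.hi - K.b) else 0
  | .pos => fun x => if K.b < x then 1 / (K.hi - K.b) else 0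

variable (K : Knots)

theorem lt : K.lo < K.hi := K.lo_lt.trans_le (K.a_le.trans K.lt_hi.le)

theorem shape_zero (x : ℝ) : K.shape 0 x = 1 - K.shape (-1) x - K.shape 1 x := rfl

theorem dshape_neg (x : ℝ) : K.dshape (-1) x = if x < K.a then -(1 / (K.a - K.lo)) else 0 := rfl

theorem dshape_pos (x : ℝ) : K.dshape 1 x = if K.b < x then 1 / (K.hi - K.b) else 0 := rfl

theorem dshape_zero (x : ℝ) : K.dshape 0 x = -K.dshape (-1) x - K.dshape 1 x := by
  have h : K.dshape 0 x = (if x < K.a then 1 / (K.a - K.lo) else 0) - K.dshape 1 x := rfl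
  rw [h, dshape_neg]
  split_ifs <;> simp

theorem sum_shape (x : ℝ) : ∑ s, K.shape s x = 1 := by
  rw [sum_signType, shape_zero]; ring

theorem sum_dshape (x : ℝ) : ∑ s, K.dshape s x = 0 := by
  rw [sum_signType, dshape_zero]; ring

theorem shape_neg_of_le {x : ℝ} (h : K.a ≤ x) : K.shape (-1) x = 0 :=
  max_eq_left (div_nonpos_of_nonpos_of_nonneg (by linarith) (sub_pos.2 K.lo_lt).le)

theorem shape_neg_of_ge {x : ℝ} (h : x ≤ K.a) : K.shape (-1) x = (K.a - x) / (K.a - K.lo) :=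
  max_eq_right (div_nonneg (by linarith) (sub_pos.2 K.lo_lt).le)

theorem shape_pos_of_le {x : ℝ} (h : x ≤ K.b) : K.shape 1 x = 0 :=
  max_eq_left (div_nonpos_of_nonpos_of_nonneg (by linarith) (sub_pos.2 K.lt_hi).le)

theorem shape_pos_of_ge {x : ℝ} (h : K.b ≤ x) : K.shape 1 x = (x - K.b) / (K.hi - K.b) :=
  max_eq_right (div_nonneg (by linarith) (sub_pos.2 K.lt_hi).le)

theorem shape_lo (s : SignType) : K.shape s K.lo = if s = -1 then 1 else 0 := by
  have h1 : K.shape (-1) K.lo = 1 := by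
    rw [K.shape_neg_of_ge K.lo_lt.le, div_self (sub_pos.2 K.lo_lt).ne']
  have h2 : K.shape 1 K.lo = 0 := K.shape_pos_of_le (K.lo_lt.le.trans K.a_le)
  rcases s with _ | _ | _
  · exact (by rw [shape_zero, h1, h2]; simp : K.shape 0 K.lo = 0)
  · exact h1
  · exact h2

theorem shape_hi (s : SignType) : K.shape s K.hi = if s = 1 then 1 else 0 := by
  have h1 : K.shape 1 K.hi = 1 := by
    rw [K.shape_pos_of_ge K.lt_hi.le, div_self (sub_pos.2 K.lt_hi).ne']
  have h2 : K.shape (-1) K.hi = 0 := K.shape_neg_of_le (K.a_le.trans K.lt_hi.le)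
  rcases s with _ | _ | _
  · exact (by rw [shape_zero, h1, h2]; simp : K.shape 0 K.hi = 0)
  · exact h2
  · exact h1

theorem continuous_shape (s : SignType) : Continuous (K.shape s) := by
  rcases s with _ | _ | _ <;> simp only [shape] <;> fun_prop

theorem measurable_dshape (s : SignType) : Measurable (K.dshape s) := by
  have h1 : Measurable (K.dshape (-1)) :=
    Measurable.ite measurableSet_Iio measurable_const measurable_const
  have h2 : Measurable (K.dshape 1) :=
    Measurable.ite measurableSet_Ioi measurable_const measurable_const
  rcases s with _ | _ | _
  · have : K.dshape 0 = fun x => -K.dshape (-1) x - K.dshape 1 x := funext K.dshape_zero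
    exact this ▸ h1.neg.sub h2
  · exact h1
  · exact h2

theorem hasDerivAt_shape (s : SignType) {x : ℝ} (ha : x ≠ K.a) (hb : x ≠ K.b) :
    HasDerivAt (K.shape s) (K.dshape s x) x := by
  have h1 : HasDerivAt (K.shape (-1)) (K.dshape (-1) x) x := by
    rw [dshape_neg]
    rcases lt_or_gt_of_ne ha with h | h
    · rw [if_pos h]
      have : HasDerivAt (fun y => (K.a - y) / (K.a - K.lo)) (-(1 / (K.a - K.lo))) x := by
        exact (((hasDerivAt_id x).const_sub K.a).div_const (K.a - K.lo)).congr_deriv (neg_div _ _)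
      exact this.congr_of_eventuallyEq
        (Filter.eventuallyEq_of_mem (Iio_mem_nhds h) fun y hy => K.shape_neg_of_ge (le_of_lt hy))
    · rw [if_neg h.not_gt]
      exact (hasDerivAt_const x (0 : ℝ)).congr_of_eventuallyEq
        (Filter.eventuallyEq_of_mem (Ioi_mem_nhds h) fun y hy => K.shape_neg_of_le (le_of_lt hy))
  have h2 : HasDerivAt (K.shape 1) (K.dshape 1 x) x := by
    rw [dshape_pos]
    rcases lt_or_gt_of_ne hb with h | h
    · rw [if_neg h.not_gt]
      exact (hasDerivAt_const x (0 : ℝ)).congr_of_eventuallyEq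
        (Filter.eventuallyEq_of_mem (Iio_mem_nhds h) fun y hy => K.shape_pos_of_le (le_of_lt hy))
    · rw [if_pos h]
      have : HasDerivAt (fun y => (y - K.b) / (K.hi - K.b)) (1 / (K.hi - K.b)) x :=
        ((hasDerivAt_id x).sub_const K.b).div_const (K.hi - K.b)
      exact this.congr_of_eventuallyEq
        (Filter.eventuallyEq_of_mem (Ioi_mem_nhds h) fun y hy => K.shape_pos_of_ge (le_of_lt hy))
  rcases s with _ | _ | _
  · have e : K.shape .zero = fun y => 1 - K.shape (-1) y - K.shape 1 y := rfl
    have e' : K.dshape .zero x = 0 - K.dshape (-1) x - K.dshape 1 x := by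
      rw [zero_sub]; exact K.dshape_zero x
    rw [e, e']
    exact ((hasDerivAt_const x (1 : ℝ)).sub h1).sub h2
  · exact h1
  · exact h2

theorem shape_nonneg (s : SignType) {x : ℝ} (hx : x ∈ Icc K.lo K.hi) : 0 ≤ K.shape s x := by
  rcases s with _ | _ | _
  · change 0 ≤ K.shape 0 x
    rw [shape_zero]
    rcases le_total x K.a with h | h
    · rw [K.shape_pos_of_le (h.trans K.a_le), K.shape_neg_of_ge h, sub_zero, sub_nonneg]
      exact div_le_one_of_le₀ (by linarith [hx.1]) (sub_pos.2 K.lo_lt).le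
    · rw [K.shape_neg_of_le h, sub_zero, sub_nonneg]
      exact max_le zero_le_one (div_le_one_of_le₀ (by linarith [hx.2]) (sub_pos.2 K.lt_hi).le)
  · exact le_max_left _ _
  · exact le_max_left _ _

theorem shape_le_one (s : SignType) {x : ℝ} (hx : x ∈ Icc K.lo K.hi) : K.shape s x ≤ 1 := by
  rw [← K.sum_shape x]
  exact Finset.single_le_sum (fun s _ => K.shape_nonneg s hx) (Finset.mem_univ s)

theorem abs_shape_le_one (s : SignType) {x : ℝ} (hx : x ∈ Icc K.lo K.hi) : |K.shape s x| ≤ 1 := by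
  rw [abs_of_nonneg (K.shape_nonneg s hx)]; exact K.shape_le_one s hx

/-- A bound for the slopes of the shape functions. -/
def slope : ℝ := 1 / (K.a - K.lo) + 1 / (K.hi - K.b)

theorem slope_pos : 0 < K.slope :=
  add_pos (one_div_pos.2 (sub_pos.2 K.lo_lt)) (one_div_pos.2 (sub_pos.2 K.lt_hi))

theorem abs_dshape_le (s : SignType) (x : ℝ) : |K.dshape s x| ≤ K.slope := by
  have h1 : 0 < 1 / (K.a - K.lo) := one_div_pos.2 (sub_pos.2 K.lo_lt)
  have h2 : 0 < 1 / (K.hi - K.b) := one_div_pos.2 (sub_pos.2 K.lt_hi)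
  rw [abs_le]
  rcases s with _ | _ | _ <;> simp only [dshape, slope] <;> split_ifs <;>
    constructor <;> linarith

theorem integral_dshape (s : SignType) :
    ∫ x in Ioo K.lo K.hi, K.dshape s x = K.shape s K.hi - K.shape s K.lo := by
  rw [← integral_Ioc_eq_integral_Ioo, ← intervalIntegral.integral_of_le K.lt.le]
  refine integral_eq_of_hasDerivAt_off_countable_of_le _ _ K.lt.le
    (s := {K.a, K.b}) (by simp) (K.continuous_shape s).continuousOn ?_ ?_
  · rintro x ⟨-, hx⟩
    simp only [mem_insert_iff, mem_singleton_iff, not_or] at hx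
    exact K.hasDerivAt_shape s hx.1 hx.2
  · rw [intervalIntegrable_iff_integrableOn_Ioc_of_le K.lt.le]
    exact Measure.integrableOn_of_bounded (M := K.slope) (by simp)
      (K.measurable_dshape s).aestronglyMeasurable
      (Filter.Eventually.of_forall fun x => K.abs_dshape_le s x)

theorem integrableOn_shape (s : SignType) : IntegrableOn (K.shape s) (Ioo K.lo K.hi) :=
  ((K.continuous_shape s).continuousOn.integrableOn_Icc).mono_set Ioo_subset_Icc_self

/-- The mean value of a shape function. -/
def mean (s : SignType) : ℝ := (∫ x in Ioo K.lo K.hi, K.shape s x) / (K.hi - K.lo)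

theorem integral_shape (s : SignType) :
    ∫ x in Ioo K.lo K.hi, K.shape s x = (K.hi - K.lo) * K.mean s := by
  rw [mean, mul_div_cancel₀ _ (sub_pos.2 K.lt).ne']

theorem sum_mean : ∑ s, K.mean s = 1 := by
  simp only [mean]
  rw [← Finset.sum_div, ← integral_finsetSum _ fun s _ => K.integrableOn_shape s]
  simp only [sum_shape]
  rw [setIntegral_const]
  simp [K.lt.le, (sub_pos.2 K.lt).ne']

theorem mean_nonneg (s : SignType) : 0 ≤ K.mean s :=
  div_nonneg (setIntegral_nonneg measurableSet_Ioo fun _ hx =>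
    K.shape_nonneg s (Ioo_subset_Icc_self hx)) (sub_pos.2 K.lt).le

/-- Where the hat is nonzero its slope is a constant, so a multiple of the squared hat is an
antiderivative on the whole interval and no splitting is needed. -/
theorem integral_shape_neg : ∫ x in Ioo K.lo K.hi, K.shape (-1) x = (K.a - K.lo) / 2 := by
  have h0 := sub_pos.2 K.lo_lt
  rw [← integral_Ioc_eq_integral_Ioo, ← intervalIntegral.integral_of_le K.lt.le,
    integral_eq_of_hasDerivAt_off_countable_of_le
      (fun x => -(K.a - K.lo) / 2 * K.shape (-1) x ^ 2) _ K.lt.le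
      (s := {K.a, K.b}) (by simp) (by have := K.continuous_shape (-1); fun_prop) ?_
      ((K.continuous_shape (-1)).intervalIntegrable _ _)]
  · rw [shape_lo, shape_hi]
    norm_num
    ring
  · rintro x ⟨-, hx⟩
    simp only [mem_insert_iff, mem_singleton_iff, not_or] at hx
    refine (((K.hasDerivAt_shape (-1) hx.1 hx.2).pow 2).const_mul (-(K.a - K.lo) / 2)).congr_deriv ?_
    rw [dshape_neg]
    rcases le_or_gt K.a x with h | h
    · rw [if_neg h.not_gt, K.shape_neg_of_le h]; simp
    · rw [if_pos h]; field_simp; norm_num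

theorem integral_shape_pos : ∫ x in Ioo K.lo K.hi, K.shape 1 x = (K.hi - K.b) / 2 := by
  have h0 := sub_pos.2 K.lt_hi
  rw [← integral_Ioc_eq_integral_Ioo, ← intervalIntegral.integral_of_le K.lt.le,
    integral_eq_of_hasDerivAt_off_countable_of_le
      (fun x => (K.hi - K.b) / 2 * K.shape 1 x ^ 2) _ K.lt.le
      (s := {K.a, K.b}) (by simp) (by have := K.continuous_shape 1; fun_prop) ?_
      ((K.continuous_shape 1).intervalIntegrable _ _)]
  · rw [shape_lo, shape_hi]
    norm_num
  · rintro x ⟨-, hx⟩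
    simp only [mem_insert_iff, mem_singleton_iff, not_or] at hx
    refine (((K.hasDerivAt_shape 1 hx.1 hx.2).pow 2).const_mul ((K.hi - K.b) / 2)).congr_deriv ?_
    rw [dshape_pos]
    rcases le_or_gt x K.b with h | h
    · rw [if_neg h.not_gt, K.shape_pos_of_le h]; simp
    · rw [if_pos h]; field_simp; norm_num

/-- The end hats have integrals `(a - lo) / 2` and `(hi - b) / 2`; as `a ≤ b`, these add up to at
most half the length. This keeps the division by `mean 0` in `coef` harmless. -/
theorem half_le_mean_zero : 1 / 2 ≤ K.mean 0 := by
  have h := K.sum_mean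
  rw [sum_signType] at h
  have h0 := sub_pos.2 K.lt
  have : K.mean (-1) + K.mean 1 ≤ 1 / 2 := by
    rw [mean, mean, integral_shape_neg, integral_shape_pos, ← add_div, div_le_iff₀ h0]
    linarith [K.a_le]
  linarith

end Knots

/-! ### Tensor products on a mesh and their weak derivatives. -/

/-- A choice of interior grid points for every cuboid and every direction. -/
structure Grid where
  knots : Cuboid → Fin 3 → Knots
  knots_lo : ∀ M i, (knots M i).lo = M.lo i
  knots_hi : ∀ M i, (knots M i).hi = M.hi i

/-- The grid points of face neighbours agree on the common face. -/
def Grid.Compatible (G : Grid) (𝓜 : Finset Cuboid) : Prop :=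
  ∀ b, ∀ M ∈ 𝓜, ∀ M' ∈ 𝓜, Adj b M M' → ∀ c ≠ b, G.knots M c = G.knots M' c

/-- The combination of the tensor products of shape functions in two variables. -/
def planar (K L : Knots) (C : SignType → SignType → ℝ) (x y : ℝ) : ℝ :=
  ∑ s, ∑ t, C s t * (K.shape s x * L.shape t y)

/-- The derivative of `planar` in the first variable. -/
def dplanar (K L : Knots) (C : SignType → SignType → ℝ) (x y : ℝ) : ℝ :=
  ∑ s, ∑ t, C s t * (K.dshape s x * L.shape t y)

theorem continuous_planar (K L : Knots) (C : SignType → SignType → ℝ) {b c : Fin 3} :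
    Continuous fun x : E3 => planar K L C (x b) (x c) := by
  unfold planar
  refine continuous_finsetSum _ fun s _ => continuous_finsetSum _ fun t _ => ?_
  have h1 := (K.continuous_shape s).comp (show Continuous fun x : E3 => x b by fun_prop)
  have h2 := (L.continuous_shape t).comp (show Continuous fun x : E3 => x c by fun_prop)
  exact continuous_const.mul (h1.mul h2)

theorem measurable_dplanar (K L : Knots) (C : SignType → SignType → ℝ) {b c : Fin 3} :
    Measurable fun x : E3 => dplanar K L C (x b) (x c) := by
  unfold dplanar
  refine Finset.measurable_sum _ fun s _ => Finset.measurable_sum _ fun t _ => ?_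
  have h1 := (K.measurable_dshape s).comp
    (show Continuous fun x : E3 => x b by fun_prop).measurable
  have h2 := (L.continuous_shape t).measurable.comp
    (show Continuous fun x : E3 => x c by fun_prop).measurable
  exact measurable_const.mul (h1.mul h2)

theorem hasDerivAt_planar (K L : Knots) (C : SignType → SignType → ℝ) {x : ℝ} (y : ℝ)
    (ha : x ≠ K.a) (hb : x ≠ K.b) :
    HasDerivAt (fun x => planar K L C x y) (dplanar K L C x y) x := by
  unfold planar dplanar
  refine HasDerivAt.fun_sum fun s _ => HasDerivAt.fun_sum fun t _ => ?_
  exact ((K.hasDerivAt_shape s ha hb).mul_const _).const_mul _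

theorem planar_lo (K L : Knots) (C : SignType → SignType → ℝ) (y : ℝ) :
    planar K L C K.lo y = ∑ t, C (-1) t * L.shape t y := by
  simp only [planar, Knots.shape_lo]
  rw [Finset.sum_eq_single (-1)] <;> simp +contextual

theorem planar_hi (K L : Knots) (C : SignType → SignType → ℝ) (y : ℝ) :
    planar K L C K.hi y = ∑ t, C 1 t * L.shape t y := by
  simp only [planar, Knots.shape_hi]
  rw [Finset.sum_eq_single 1] <;> simp +contextual

theorem planar_swap (K L : Knots) (C : SignType → SignType → ℝ) (x y : ℝ) :
    planar K L C x y = planar L K (fun s t => C t s) y x := by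
  unfold planar
  rw [Finset.sum_comm]
  simp only [mul_comm (K.shape _ _)]

theorem point_eq_add (b : Fin 3) (t : ℝ) (y : Fin 2 → ℝ) :
    point b t y = point b 0 y + t • EuclideanSpace.single b (1 : ℝ) := by
  ext i
  rcases Fin.eq_self_or_eq_succAbove b i with rfl | ⟨j, rfl⟩
  · simp
  · simp

theorem hasDerivAt_comp_point {η : E3 → ℝ} (hη : ContDiff ℝ ∞ η) (b : Fin 3) (t : ℝ)
    (y : Fin 2 → ℝ) :
    HasDerivAt (fun t => η (point b t y)) (pderiv b η (point b t y)) t := by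
  have h1 : HasDerivAt (fun t => point b t y) (EuclideanSpace.single b (1 : ℝ)) t := by
    rw [funext fun t => point_eq_add b t y]
    simpa using ((hasDerivAt_id t).smul_const (EuclideanSpace.single b (1 : ℝ))).const_add
      (point b 0 y)
  exact ((hη.differentiable (by simp)) _).hasFDerivAt.comp_hasDerivAt t h1

theorem continuous_point (b : Fin 3) (t : ℝ) : Continuous fun y : Fin 2 → ℝ => point b t y := by
  refine (PiLp.continuous_toLp 2 _).comp (continuous_pi fun i => ?_)
  rcases Fin.eq_self_or_eq_succAbove b i with rfl | ⟨j, rfl⟩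
  · simpa using continuous_const
  · simpa using continuous_apply j

theorem integrableOn_sideBox {f : (Fin 2 → ℝ) → ℝ} (hf : Continuous f) (M : Cuboid) (b : Fin 3) :
    IntegrableOn f (M.sideBox b) := by
  refine (hf.continuousOn.integrableOn_compact (isCompact_univ_pi fun j =>
    isCompact_Icc (a := M.lo (b.succAbove j)) (b := M.hi (b.succAbove j)))).mono_set ?_
  exact Set.pi_mono fun j _ => Ioo_subset_Icc_self

theorem integrable_planar_mul {η ψ : E3 → ℝ} (hη : Continuous η) (hη' : HasCompactSupport η)
    (hψ : Continuous ψ) (hψ' : HasCompactSupport ψ) (K L : Knots) (C : SignType → SignType → ℝ)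
    (b c : Fin 3) :
    Integrable fun x : E3 => planar K L C (x b) (x c) * ψ x + dplanar K L C (x b) (x c) * η x := by
  refine Integrable.add ?_ ?_
  · exact ((continuous_planar K L C).mul hψ).integrable_of_hasCompactSupport hψ'.mul_left
  · simp only [dplanar, Finset.sum_mul]
    refine integrable_finsetSum _ fun s _ => integrable_finsetSum _ fun t _ => ?_
    have h1 : Integrable fun x : E3 => C s t * (L.shape t (x c) * η x) := by
      refine Continuous.integrable_of_hasCompactSupport ?_ (hη'.mul_left.mul_left)
      have := (L.continuous_shape t).comp (show Continuous fun x : E3 => x c by fun_prop)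
      exact continuous_const.mul (this.mul hη)
    have h2 := h1.bdd_mul (c := K.slope) (f := fun x : E3 => K.dshape s (x b))
      ((K.measurable_dshape s).comp
        (show Continuous fun x : E3 => x b by fun_prop).measurable).aestronglyMeasurable
      (Filter.Eventually.of_forall fun x => K.abs_dshape_le s (x b))
    refine h2.congr (Filter.Eventually.of_forall fun x => ?_)
    simp only
    ring

/-- Integration by parts on one cuboid, for a combination of shape functions. -/
theorem integral_planar_by_parts {Ω : Set E3} {η : E3 → ℝ} (hη : IsTest Ω η) (G : Grid)
    (M : Cuboid) {b c : Fin 3} (hbc : c ≠ b) (C : SignType → SignType → ℝ) :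
    ∫ x in M.openBox, (planar (G.knots M b) (G.knots M c) C (x b) (x c) * pderiv b η x +
        dplanar (G.knots M b) (G.knots M c) C (x b) (x c) * η x) =
      (∫ y in M.sideBox b, (∑ t, C 1 t * (G.knots M c).shape t (point b (M.hi b) y c)) *
        η (point b (M.hi b) y)) -
      ∫ y in M.sideBox b, (∑ t, C (-1) t * (G.knots M c).shape t (point b (M.lo b) y c)) *
        η (point b (M.lo b) y) := by
  have hcont : ∀ s τ, Continuous fun y : Fin 2 → ℝ =>
      (∑ t, C s t * (G.knots M c).shape t (point b τ y c)) * η (point b τ y) := by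
    intro s τ
    refine Continuous.mul (continuous_finsetSum _ fun t _ => continuous_const.mul ?_)
      (hη.smooth.continuous.comp (continuous_point b τ))
    exact ((G.knots M c).continuous_shape t).comp
      ((show Continuous fun x : E3 => x c by fun_prop).comp (continuous_point b τ))
  rw [integral_openBox_fubini M b _ (integrable_planar_mul hη.smooth.continuous hη.compact
    (hη.continuous_pderiv b) (hη.hasCompactSupport_pderiv b) _ _ C b c).integrableOn,
    ← integral_sub (integrableOn_sideBox (hcont _ _) M b) (integrableOn_sideBox (hcont _ _) M b)]
  refine integral_congr_ae (Filter.Eventually.of_forall fun y => ?_)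
  simp only
  obtain ⟨j, rfl⟩ := Fin.exists_succAbove_eq hbc
  simp only [point_same, point_succAbove]
  set K := G.knots M b with hK
  set L := G.knots M (b.succAbove j)
  have hlo : M.lo b = K.lo := (G.knots_lo M b).symm
  have hhi : M.hi b = K.hi := (G.knots_hi M b).symm
  -- Along the line in direction `b` the product with `η` is continuous and differentiable off the
  -- two knots, which is enough for the fundamental theorem. At the ends only the coefficients with
  -- first sign `1` or `-1` survive.
  rw [hlo, hhi, ← integral_Ioc_eq_integral_Ioo, ← intervalIntegral.integral_of_le K.lt.le,
    integral_eq_of_hasDerivAt_off_countable_of_le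
      (fun t => planar K L C t (y j) * η (point b t y)) _ K.lt.le
      (s := {K.a, K.b}) (by simp) ?_ ?_ ?_, planar_lo, planar_hi]
  · refine Continuous.continuousOn ?_
    refine Continuous.mul ?_ (continuous_iff_continuousAt.2 fun t =>
      (hasDerivAt_comp_point hη.smooth b t y).continuousAt)
    unfold planar
    refine continuous_finsetSum _ fun s _ => continuous_finsetSum _ fun t _ => ?_
    exact continuous_const.mul ((K.continuous_shape s).mul continuous_const)
  · rintro x ⟨-, hx⟩
    simp only [mem_insert_iff, mem_singleton_iff, not_or] at hx
    exact ((hasDerivAt_planar K L C (y j) hx.1 hx.2).mul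
      (hasDerivAt_comp_point hη.smooth b x y)).congr_deriv (add_comm _ _)
  · have hp : Continuous fun t => point b t y := by
      rw [funext fun t => point_eq_add b t y]
      fun_prop
    refine IntervalIntegrable.add ?_ ?_
    · refine Continuous.intervalIntegrable ?_ _ _
      refine Continuous.mul ?_ ((hη.continuous_pderiv b).comp hp)
      unfold planar
      refine continuous_finsetSum _ fun s _ => continuous_finsetSum _ fun t _ => ?_
      exact continuous_const.mul ((K.continuous_shape s).mul continuous_const)
    · refine IntervalIntegrable.mul_continuousOn ?_ (hη.smooth.continuous.comp hp).continuousOn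
      rw [intervalIntegrable_iff_integrableOn_Ioc_of_le K.lt.le]
      unfold dplanar
      refine integrable_finsetSum _ fun s _ => integrable_finsetSum _ fun t _ => ?_
      refine Integrable.const_mul (Integrable.mul_const ?_ _) _
      exact Measure.integrableOn_of_bounded (M := K.slope) (by simp)
        (K.measurable_dshape s).aestronglyMeasurable
        (Filter.Eventually.of_forall fun x => K.abs_dshape_le s x)

theorem mem_side_of_mem_sideBox {M : Cuboid} {b : Fin 3} {y : Fin 2 → ℝ} (hy : y ∈ M.sideBox b)
    (t : ℝ) : ∀ c ≠ b, M.lo c < point b t y c ∧ point b t y c < M.hi c := by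
  intro c hc
  obtain ⟨j, rfl⟩ := Fin.exists_succAbove_eq hc
  simpa using hy j (mem_univ j)

theorem IsTest.mem_of_ne_zero {Ω : Set E3} {η : E3 → ℝ} (hη : IsTest Ω η) {x : E3}
    (hx : η x ≠ 0) : x ∈ Ω := hη.supp (subset_tsupport _ hx)

/-- Piecewise combinations of shape functions with matching coefficients across the faces normal to
direction `b` have a piecewise weak derivative in direction `b`. -/
theorem sum_integral_planar_eq_zero {Ω : Set E3} {𝓜 : Finset Cuboid} (h : IsMesh Ω 𝓜)
    {η : E3 → ℝ} (hη : IsTest Ω η) (G : Grid) (hG : G.Compatible 𝓜) {b c : Fin 3} (hbc : c ≠ b)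
    (C : Cuboid → SignType → SignType → ℝ)
    (hC : ∀ M ∈ 𝓜, ∀ M' ∈ 𝓜, Adj b M M' → ∀ t, C M 1 t = C M' (-1) t) :
    ∑ M ∈ 𝓜, ∫ x in M.openBox,
      (planar (G.knots M b) (G.knots M c) (C M) (x b) (x c) * pderiv b η x +
        dplanar (G.knots M b) (G.knots M c) (C M) (x b) (x c) * η x) = 0 := by
  simp only [integral_planar_by_parts hη G _ hbc]
  rw [Finset.sum_sub_distrib, sub_eq_zero]
  have key : ∀ M ∈ 𝓜, ∀ M' ∈ 𝓜, Adj b M M' →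
      ∫ y in M.sideBox b, (∑ t, C M 1 t * (G.knots M c).shape t (point b (M.hi b) y c)) *
        η (point b (M.hi b) y) =
      ∫ y in M'.sideBox b, (∑ t, C M' (-1) t * (G.knots M' c).shape t (point b (M'.lo b) y c)) *
        η (point b (M'.lo b) y) := by
    intro M hM M' hM' ha
    have e : M.sideBox b = M'.sideBox b := by
      unfold sideBox
      congr 1
      funext j
      rw [(ha.2 _ (Fin.succAbove_ne b j)).1, (ha.2 _ (Fin.succAbove_ne b j)).2]
    rw [e, hG b M hM M' hM' ha c hbc, ha.1]
    simp only [hC M hM M' hM' ha]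
  -- A nonzero face integral needs a point of the face where `η` is nonzero. Such a point lies in
  -- `Ω`, so the mesh continues beyond the face.
  have h1 : ∀ M ∈ 𝓜, (∫ y in M.sideBox b,
      (∑ t, C M 1 t * (G.knots M c).shape t (point b (M.hi b) y c)) *
        η (point b (M.hi b) y)) ≠ 0 → ∃ M' ∈ 𝓜, Adj b M M' := by
    intro M hM hne
    by_contra hno
    refine hne (setIntegral_eq_zero_of_forall_eq_zero fun y hy => ?_)
    have : η (point b (M.hi b) y) = 0 := by
      by_contra h0
      exact hno (h.exists_adj_hi hM (hη.mem_of_ne_zero h0) (point_same _ _ _)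
        (mem_side_of_mem_sideBox hy _))
    rw [this, mul_zero]
  have h2 : ∀ M ∈ 𝓜, (∫ y in M.sideBox b,
      (∑ t, C M (-1) t * (G.knots M c).shape t (point b (M.lo b) y c)) *
        η (point b (M.lo b) y)) ≠ 0 → ∃ M' ∈ 𝓜, Adj b M' M := by
    intro M hM hne
    by_contra hno
    refine hne (setIntegral_eq_zero_of_forall_eq_zero fun y hy => ?_)
    have : η (point b (M.lo b) y) = 0 := by
      by_contra h0
      exact hno (h.exists_adj_lo hM (hη.mem_of_ne_zero h0) (point_same _ _ _)
        (mem_side_of_mem_sideBox hy _))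
    rw [this, mul_zero]
  -- Upper faces are paired with the lower faces of the neighbours; faces on the boundary of `Ω`
  -- contribute zero and need no partner.
  refine Finset.sum_bij_ne_zero (fun M hM hne => (h1 M hM hne).choose)
    (fun M hM hne => (h1 M hM hne).choose_spec.1) ?_ ?_ ?_
  · intro M₁ hM₁ hne₁ M₂ hM₂ hne₂ he
    have a₁ := (h1 M₁ hM₁ hne₁).choose_spec.2
    have a₂ := (h1 M₂ hM₂ hne₂).choose_spec.2
    rw [← he] at a₂
    exact h.adj_left_unique hM₁ hM₂ a₁ a₂
  · intro M' hM' hne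
    obtain ⟨M, hM, ha⟩ := h2 M' hM' hne
    have hne' := hne
    rw [← key M hM M' hM' ha] at hne'
    exact ⟨M, hM, hne', h.adj_right_unique (h1 M hM hne').choose_spec.1 hM'
      (h1 M hM hne').choose_spec.2 ha⟩
  · intro M hM hne
    exact key M hM _ (h1 M hM hne).choose_spec.1 (h1 M hM hne).choose_spec.2

/-! ### Integration by parts on boxes for weakly differentiable fields. -/

theorem isCompact_closedBox (E : Cuboid) : IsCompact E.closedBox := by
  have : E.closedBox = WithLp.toLp 2 '' Icc E.lo E.hi := by
    ext x
    constructor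
    · exact fun hx => ⟨x.ofLp, ⟨fun i => (hx i).1, fun i => (hx i).2⟩, rfl⟩
    · rintro ⟨y, hy, rfl⟩
      exact fun i => ⟨hy.1 i, hy.2 i⟩
  rw [this]
  exact isCompact_Icc.image (PiLp.continuous_toLp 2 _)

theorem memLp_coord {Ω : Set E3} (u : L2 Ω) (i : Fin 3) :
    MemLp (fun x => u x i) 2 (volume.restrict Ω) :=
  (EuclideanSpace.proj i : E3 →L[ℝ] ℝ).comp_memLp' (Lp.memLp u)

theorem memLp_coord_openBox {Ω : Set E3} (u : L2 Ω) (i : Fin 3) {B : Cuboid}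
    (hB : B.openBox ⊆ Ω) : MemLp (fun x => u x i) 2 (volume.restrict B.openBox) :=
  (memLp_coord u i).mono_measure (Measure.restrict_mono hB le_rfl)

instance (B : Cuboid) : IsFiniteMeasure ((volume : Measure E3).restrict B.openBox) :=
  ⟨by simpa using B.isBounded_openBox.lt_top⟩

theorem integrableOn_coord {Ω : Set E3} (u : L2 Ω) (i : Fin 3) {B : Cuboid}
    (hB : B.openBox ⊆ Ω) : IntegrableOn (fun x => u x i) B.openBox :=
  (memLp_coord_openBox u i hB).integrable (by norm_num)

theorem integrableOn_coord_mul {Ω : Set E3} (u : L2 Ω) (i b : Fin 3) {B : Cuboid}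
    (hB : B.openBox ⊆ Ω) {r : ℝ → ℝ} (hr : Continuous r) :
    IntegrableOn (fun x => u x i * r (x b)) B.openBox := by
  obtain ⟨C, hC⟩ := (isCompact_Icc (a := B.lo b) (b := B.hi b)).exists_bound_of_continuousOn
    hr.continuousOn
  refine (integrableOn_coord u i hB).mul_bdd (c := C) ?_ ?_
  · exact (hr.comp (show Continuous fun x : E3 => x b by fun_prop)).aestronglyMeasurable
  · refine (ae_restrict_mem B.measurableSet_openBox).mono fun x hx => ?_
    exact hC _ (Ioo_subset_Icc_self (hx b))

/-- A smooth function of one variable that vanishes off `(lo, hi)`, near the end points, and equals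
one on most of that interval when `n` is large. -/
def cutoff (lo hi : ℝ) (n : ℕ) (t : ℝ) : ℝ :=
  Real.smoothTransition (n * (t - lo) - 1) * Real.smoothTransition (n * (hi - t) - 1)

theorem contDiff_cutoff (lo hi : ℝ) (n : ℕ) : ContDiff ℝ ∞ (cutoff lo hi n) := by
  unfold cutoff
  have h := Real.smoothTransition.contDiff (n := ⊤)
  exact (h.comp (f := fun t : ℝ => n * (t - lo) - 1) (by fun_prop)).mul
    (h.comp (f := fun t : ℝ => n * (hi - t) - 1) (by fun_prop))

theorem cutoff_nonneg (lo hi : ℝ) (n : ℕ) (t : ℝ) : 0 ≤ cutoff lo hi n t :=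
  mul_nonneg (Real.smoothTransition.nonneg _) (Real.smoothTransition.nonneg _)

theorem cutoff_le_one (lo hi : ℝ) (n : ℕ) (t : ℝ) : cutoff lo hi n t ≤ 1 :=
  mul_le_one₀ (Real.smoothTransition.le_one _) (Real.smoothTransition.nonneg _)
    (Real.smoothTransition.le_one _)

theorem abs_cutoff_le_one (lo hi : ℝ) (n : ℕ) (t : ℝ) : |cutoff lo hi n t| ≤ 1 := by
  rw [abs_of_nonneg (cutoff_nonneg lo hi n t)]; exact cutoff_le_one lo hi n t

theorem cutoff_ne_zero {lo hi : ℝ} {n : ℕ} {t : ℝ} (h : cutoff lo hi n t ≠ 0) :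
    1 ≤ n * (t - lo) ∧ 1 ≤ n * (hi - t) := by
  constructor
  · by_contra hn
    exact h (by rw [cutoff, Real.smoothTransition.zero_of_nonpos (by linarith), zero_mul])
  · by_contra hn
    exact h (by rw [cutoff, Real.smoothTransition.zero_of_nonpos (x := n * (hi - t) - 1)
      (by linarith), mul_zero])

theorem cutoff_eq_one {lo hi : ℝ} {n : ℕ} {t : ℝ} (h1 : 2 < n * (t - lo))
    (h2 : 2 < n * (hi - t)) : cutoff lo hi n t = 1 := by
  rw [cutoff, Real.smoothTransition.one_of_one_le (by linarith),
    Real.smoothTransition.one_of_one_le (by linarith), one_mul]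

theorem deriv_smoothTransition_eq_zero {z : ℝ} (hz : z < 0 ∨ 1 < z) :
    deriv Real.smoothTransition z = 0 := by
  rcases hz with hz | hz
  · have : Real.smoothTransition =ᶠ[nhds z] fun _ => 0 :=
      Filter.eventuallyEq_of_mem (Iio_mem_nhds hz) fun y hy =>
        Real.smoothTransition.zero_of_nonpos (le_of_lt hy)
    rw [this.deriv_eq, deriv_const]
  · have : Real.smoothTransition =ᶠ[nhds z] fun _ => 1 :=
      Filter.eventuallyEq_of_mem (Ioi_mem_nhds hz) fun y hy =>
        Real.smoothTransition.one_of_one_le (le_of_lt hy)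
    rw [this.deriv_eq, deriv_const]

theorem exists_bound_deriv_smoothTransition :
    ∃ C, 0 ≤ C ∧ ∀ z, |deriv Real.smoothTransition z| ≤ C := by
  obtain ⟨C, hC⟩ := (isCompact_Icc (a := (0 : ℝ)) (b := 1)).exists_bound_of_continuousOn
    ((Real.smoothTransition.contDiff (n := ⊤)).continuous_deriv (by simp)).continuousOn
  refine ⟨max C 0, le_max_right _ _, fun z => ?_⟩
  by_cases hz : z ∈ Icc (0 : ℝ) 1
  · exact (hC z hz).trans (le_max_left _ _)
  · rw [deriv_smoothTransition_eq_zero (by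
      by_contra h; push Not at h; exact hz ⟨h.1, h.2⟩)]
    simp

theorem hasDerivAt_cutoff (lo hi : ℝ) (n : ℕ) (t : ℝ) :
    HasDerivAt (cutoff lo hi n)
      (deriv Real.smoothTransition (n * (t - lo) - 1) * n *
          Real.smoothTransition (n * (hi - t) - 1) +
        Real.smoothTransition (n * (t - lo) - 1) *
          (deriv Real.smoothTransition (n * (hi - t) - 1) * -n)) t := by
  have hS : ∀ z, HasDerivAt Real.smoothTransition (deriv Real.smoothTransition z) z := fun z =>
    ((Real.smoothTransition.contDiff (n := ⊤)).differentiable (by simp) z).hasDerivAt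
  have h1 : HasDerivAt (fun t : ℝ => (n : ℝ) * (t - lo) - 1) n t := by
    simpa using (((hasDerivAt_id t).sub_const lo).const_mul (n : ℝ)).sub_const 1
  have h2 : HasDerivAt (fun t : ℝ => (n : ℝ) * (hi - t) - 1) (-n) t := by
    simpa using (((hasDerivAt_id t).const_sub hi).const_mul (n : ℝ)).sub_const 1
  exact ((hS _).comp t h1).mul ((hS _).comp t h2)

/-- The derivatives of the truncations of a smooth function that vanishes at both end points are
uniformly bounded. -/
theorem exists_bound_deriv_mul_cutoff {lo hi : ℝ} (hlt : lo < hi) {r : ℝ → ℝ}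
    (hr : ContDiff ℝ ∞ r) (h0 : r lo = 0) (h1 : r hi = 0) :
    ∃ C, ∀ n : ℕ, ∀ t ∈ Ioo lo hi, |deriv (fun t => r t * cutoff lo hi n t) t| ≤ C := by
  obtain ⟨R, hR⟩ := (isCompact_Icc (a := lo) (b := hi)).exists_bound_of_continuousOn
    (hr.continuous_deriv (by simp)).continuousOn
  obtain ⟨C, hC0, hC⟩ := exists_bound_deriv_smoothTransition
  have hR0 : 0 ≤ R := (norm_nonneg _).trans (hR lo ⟨le_rfl, hlt.le⟩)
  have hd : Differentiable ℝ r := hr.differentiable (by simp)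
  have hlip : ∀ x ∈ Icc lo hi, ∀ y ∈ Icc lo hi, |r y - r x| ≤ R * |y - x| := fun x hx y hy =>
    (convex_Icc lo hi).norm_image_sub_le_of_norm_deriv_le (fun z _ => hd z) hR hx hy
  refine ⟨R + (C * (2 * R) + C * (2 * R)), fun n t ht => ?_⟩
  have ht' := Ioo_subset_Icc_self ht
  have hn : (0 : ℝ) ≤ n := n.cast_nonneg
  -- The derivative of the cutoff has size `n`, but it vanishes once `n * (t - lo) > 2`. Before
  -- that, `|r t| ≤ R * (t - lo)` because `r` vanishes at `lo`, and the factors `n` cancel.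
  have hA : |r t * (deriv Real.smoothTransition (n * (t - lo) - 1) * n)| ≤ C * (2 * R) := by
    by_cases hz : 1 < n * (t - lo) - 1
    · rw [deriv_smoothTransition_eq_zero (Or.inr hz)]; simp; positivity
    · have h2 := hlip lo ⟨le_rfl, hlt.le⟩ t ht'
      rw [h0, sub_zero, abs_of_pos (sub_pos.2 ht.1)] at h2
      have h3 : |r t| * n ≤ 2 * R :=
        calc |r t| * n ≤ R * (t - lo) * n := by gcongr
          _ = R * (n * (t - lo)) := by ring
          _ ≤ R * 2 := by gcongr; linarith
          _ = 2 * R := by ring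
      calc |r t * (deriv Real.smoothTransition (n * (t - lo) - 1) * n)|
          = |deriv Real.smoothTransition (n * (t - lo) - 1)| * (|r t| * n) := by
            rw [abs_mul, abs_mul, abs_of_nonneg hn]; ring
        _ ≤ C * (2 * R) := by gcongr; exact hC _
  have hB : |r t * (deriv Real.smoothTransition (n * (hi - t) - 1) * -n)| ≤ C * (2 * R) := by
    by_cases hz : 1 < n * (hi - t) - 1
    · rw [deriv_smoothTransition_eq_zero (Or.inr hz)]; simp; positivity
    · have h2 := hlip t ht' hi ⟨hlt.le, le_rfl⟩
      rw [h1, zero_sub, abs_neg, abs_of_pos (sub_pos.2 ht.2)] at h2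
      have h3 : |r t| * n ≤ 2 * R :=
        calc |r t| * n ≤ R * (hi - t) * n := by gcongr
          _ = R * (n * (hi - t)) := by ring
          _ ≤ R * 2 := by gcongr; linarith
          _ = 2 * R := by ring
      calc |r t * (deriv Real.smoothTransition (n * (hi - t) - 1) * -n)|
          = |deriv Real.smoothTransition (n * (hi - t) - 1)| * (|r t| * n) := by
            rw [abs_mul, abs_mul, abs_neg, abs_of_nonneg hn]; ring
        _ ≤ C * (2 * R) := by gcongr; exact hC _
  have hle : ∀ z, |Real.smoothTransition z| ≤ 1 := fun z => by
    rw [abs_of_nonneg (Real.smoothTransition.nonneg z)]; exact Real.smoothTransition.le_one z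
  rw [((hd t).hasDerivAt.fun_mul (hasDerivAt_cutoff lo hi n t)).deriv, mul_add]
  refine (abs_add_le _ _).trans (add_le_add ?_ ((abs_add_le _ _).trans (add_le_add ?_ ?_)))
  · rw [abs_mul]
    exact (mul_le_mul (hR t ht') (abs_cutoff_le_one lo hi n t) (abs_nonneg _) hR0).trans_eq
      (mul_one R)
  · rw [← mul_assoc, abs_mul]
    exact (mul_le_mul hA (hle _) (abs_nonneg _) (by positivity)).trans_eq (mul_one _)
  · rw [mul_left_comm, abs_mul]
    exact (mul_le_mul (hle _) hB (abs_nonneg _) zero_le_one).trans_eq (one_mul _)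

theorem pderiv_eq_of_hasDerivAt {η : E3 → ℝ} (hη : ContDiff ℝ ∞ η) {b : Fin 3} {x : E3} {d : ℝ}
    (h : HasDerivAt (fun t : ℝ => η (x + t • EuclideanSpace.single b (1 : ℝ))) d 0) :
    pderiv b η x = d := by
  have h1 : HasDerivAt (fun t : ℝ => x + t • EuclideanSpace.single b (1 : ℝ))
      (EuclideanSpace.single b (1 : ℝ)) 0 := by
    simpa using ((hasDerivAt_id (0 : ℝ)).smul_const (EuclideanSpace.single b (1 : ℝ))).const_add x
  have h2 : HasFDerivAt η (fderiv ℝ η x) (x + (0 : ℝ) • EuclideanSpace.single b (1 : ℝ)) := by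
    simpa using (hη.differentiable (by simp) x).hasFDerivAt
  exact (h2.comp_hasDerivAt (0 : ℝ) h1).unique h

/-- The truncation of a function of `x b` to the inside of a box. -/
def truncation (B : Cuboid) (b : Fin 3) (r : ℝ → ℝ) (n : ℕ) (x : E3) : ℝ :=
  r (x b) * ∏ j, cutoff (B.lo j) (B.hi j) n (x j)

theorem contDiff_truncation (B : Cuboid) (b : Fin 3) {r : ℝ → ℝ} (hr : ContDiff ℝ ∞ r) (n : ℕ) :
    ContDiff ℝ ∞ (truncation B b r n) := by
  unfold truncation
  refine (hr.comp (by fun_prop)).mul (contDiff_prod fun j _ => ?_)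
  exact (contDiff_cutoff _ _ n).comp (by fun_prop)

/-- Only the cutoff in direction `b` is differentiated. The others remain factors between zero and
one, which is why `r` has to vanish only on the two faces normal to `b`. -/
theorem pderiv_truncation (B : Cuboid) (b : Fin 3) {r : ℝ → ℝ} (hr : ContDiff ℝ ∞ r) (n : ℕ)
    (x : E3) : pderiv b (truncation B b r n) x =
      deriv (fun t => r t * cutoff (B.lo b) (B.hi b) n t) (x b) *
        ∏ j : Fin 2, cutoff (B.lo (b.succAbove j)) (B.hi (b.succAbove j)) n (x (b.succAbove j)) := by
  refine pderiv_eq_of_hasDerivAt (contDiff_truncation B b hr n) ?_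
  have h1 : HasDerivAt (fun t => r t * cutoff (B.lo b) (B.hi b) n t)
      (deriv (fun t => r t * cutoff (B.lo b) (B.hi b) n t) (x b)) (x b + 0) := by
    rw [add_zero]
    exact ((hr.mul (contDiff_cutoff _ _ n)).differentiable (by simp) _).hasDerivAt
  have h2 := (h1.comp_const_add (x b) 0).mul_const
    (∏ j : Fin 2, cutoff (B.lo (b.succAbove j)) (B.hi (b.succAbove j)) n (x (b.succAbove j)))
  refine h2.congr_of_eventuallyEq (Filter.Eventually.of_forall fun t => ?_)
  simp only [truncation, Fin.prod_univ_succAbove _ b]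
  simp [mul_assoc]

theorem isTest_truncation {Ω : Set E3} {B : Cuboid} (hB : B.openBox ⊆ Ω) (b : Fin 3)
    {r : ℝ → ℝ} (hr : ContDiff ℝ ∞ r) (n : ℕ) :
    IsTest Ω (truncation B b r n) ∧ tsupport (truncation B b r n) ⊆ B.openBox := by
  set F : Set E3 := {x | ∀ j, 1 ≤ n * (x j - B.lo j) ∧ 1 ≤ n * (B.hi j - x j)} with hF
  have hFc : IsClosed F := by
    simp only [hF, ofPred_forall, ofPred_and]
    refine isClosed_iInter fun i => ?_
    exact (isClosed_le continuous_const (by fun_prop)).inter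
      (isClosed_le continuous_const (by fun_prop))
  have hFB : F ⊆ B.openBox := by
    intro x hx j
    have hn : (0 : ℝ) ≤ n := n.cast_nonneg
    constructor <;> by_contra hlt <;> push Not at hlt
    · have := mul_nonpos_of_nonneg_of_nonpos hn (sub_nonpos.2 hlt)
      linarith [(hx j).1]
    · have := mul_nonpos_of_nonneg_of_nonpos hn (sub_nonpos.2 hlt)
      linarith [(hx j).2]
  have hs : tsupport (truncation B b r n) ⊆ F := by
    refine closure_minimal (fun x hx j => cutoff_ne_zero ?_) hFc
    intro h0
    refine hx ?_
    rw [truncation, Finset.prod_eq_zero (Finset.mem_univ j) h0, mul_zero]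
  refine ⟨⟨contDiff_truncation B b hr n, ?_, hs.trans (hFB.trans hB)⟩, hs.trans hFB⟩
  exact HasCompactSupport.of_support_subset_isCompact (isCompact_closedBox B)
    ((subset_tsupport _).trans (hs.trans (hFB.trans B.openBox_subset_closedBox)))

/-- Equality in a neighbourhood, not only at the point, so that the derivatives converge as well. -/
theorem eventually_truncation_eq (B : Cuboid) (b : Fin 3) (r : ℝ → ℝ) {x : E3}
    (hx : x ∈ B.openBox) :
    ∀ᶠ n : ℕ in Filter.atTop, ∀ᶠ z in nhds x, truncation B b r n z = r (z b) := by
  have h : ∀ᶠ n : ℕ in Filter.atTop, ∀ j, 2 < n * (x j - B.lo j) ∧ 2 < n * (B.hi j - x j) := by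
    refine Filter.eventually_all.2 fun j => Filter.Eventually.and ?_ ?_
    · exact (tendsto_natCast_atTop_atTop.atTop_mul_const
        (sub_pos.2 (hx j).1)).eventually_gt_atTop 2
    · exact (tendsto_natCast_atTop_atTop.atTop_mul_const
        (sub_pos.2 (hx j).2)).eventually_gt_atTop 2
  filter_upwards [h] with n hn
  have : ∀ᶠ z : E3 in nhds x, ∀ j, 2 < n * (z j - B.lo j) ∧ 2 < n * (B.hi j - z j) := by
    refine Filter.eventually_all.2 fun j => ?_
    exact ((show Continuous fun z : E3 => (n : ℝ) * (z j - B.lo j) by fun_prop).continuousAt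
      |>.eventually_const_lt (hn j).1).and
      ((show Continuous fun z : E3 => (n : ℝ) * (B.hi j - z j) by fun_prop).continuousAt
      |>.eventually_const_lt (hn j).2)
  filter_upwards [this] with z hz
  rw [truncation, Finset.prod_eq_one fun j _ => cutoff_eq_one (hz j).1 (hz j).2, mul_one]

theorem tendsto_truncation (B : Cuboid) (b : Fin 3) (r : ℝ → ℝ) {x : E3} (hx : x ∈ B.openBox) :
    Filter.Tendsto (fun n => truncation B b r n x) Filter.atTop (nhds (r (x b))) := by
  refine tendsto_const_nhds.congr' ?_
  filter_upwards [eventually_truncation_eq B b r hx] with n hn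
  exact hn.self_of_nhds.symm

theorem tendsto_pderiv_truncation (B : Cuboid) (b : Fin 3) {r : ℝ → ℝ} (hr : ContDiff ℝ ∞ r)
    {x : E3} (hx : x ∈ B.openBox) :
    Filter.Tendsto (fun n => pderiv b (truncation B b r n) x) Filter.atTop
      (nhds (deriv r (x b))) := by
  refine tendsto_const_nhds.congr' ?_
  filter_upwards [eventually_truncation_eq B b r hx] with n hn
  have h1 : pderiv b (truncation B b r n) x = pderiv b (fun z => r (z b)) x := by
    unfold pderiv
    rw [Filter.EventuallyEq.fderiv_eq hn]
  rw [h1]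
  symm
  refine pderiv_eq_of_hasDerivAt (hr.comp (by fun_prop)) ?_
  have h2 : HasDerivAt r (deriv r (x b)) (x b + 0) := by
    rw [add_zero]; exact (hr.differentiable (by simp) _).hasDerivAt
  have h3 := h2.comp_const_add (x b) 0
  refine h3.congr_of_eventuallyEq (Filter.Eventually.of_forall fun t => ?_)
  simp

/-- Integration by parts on a box for a weakly differentiable field, against a smooth function of
`x b` that vanishes on the two faces normal to direction `b`. -/
theorem integral_weakGrad_eq_zero {Ω : Set E3} (hΩ : IsOpen Ω) {u : L2 Ω} {g : Fin 3 → L2 Ω}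
    (hw : IsWeakGrad Ω u g) {B : Cuboid} (hB : B.openBox ⊆ Ω) (b i : Fin 3) {r : ℝ → ℝ}
    (hr : ContDiff ℝ ∞ r) (h0 : r (B.lo b) = 0) (h1 : r (B.hi b) = 0) :
    ∫ x in B.openBox, (u x i * deriv r (x b) + g b x i * r (x b)) = 0 := by
  obtain ⟨C, hC⟩ := exists_bound_deriv_mul_cutoff (B.lt b) hr h0 h1
  obtain ⟨D, hD⟩ := (isCompact_Icc (a := B.lo b) (b := B.hi b)).exists_bound_of_continuousOn
    hr.continuous.continuousOn
  -- The truncation is an admissible test function on `Ω` supported in `B`, so both integrals of the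
  -- weak identity shrink to `B`.
  have hz : ∀ n : ℕ, ∫ x in B.openBox, (u x i * pderiv b (truncation B b r n) x +
      g b x i * truncation B b r n x) = 0 := by
    intro n
    obtain ⟨ht, hs⟩ := isTest_truncation hB b hr n
    have e := hw _ ht i b
    have hz1 : ∀ x ∈ Ω \ B.openBox, truncation B b r n x = 0 := fun x hx => by
      by_contra hne
      exact hx.2 (hs (subset_tsupport _ hne))
    have hz2 : ∀ x ∈ Ω \ B.openBox, pderiv b (truncation B b r n) x = 0 := fun x hx => by
      unfold pderiv
      rw [fderiv_of_notMem_tsupport ℝ fun h => hx.2 (hs h)]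
      rfl
    rw [integral_add ((integrable_coord_mul u (ht.continuous_pderiv b)
        (ht.hasCompactSupport_pderiv b) i).mono_measure (Measure.restrict_mono hB le_rfl))
      ((integrable_coord_mul (g b) ht.smooth.continuous ht.compact i).mono_measure
        (Measure.restrict_mono hB le_rfl)),
      ← setIntegral_eq_of_subset_of_forall_sdiff_eq_zero hΩ.measurableSet hB
        (fun x hx => by rw [hz2 x hx, mul_zero]),
      ← setIntegral_eq_of_subset_of_forall_sdiff_eq_zero hΩ.measurableSet hB
        (fun x hx => by rw [hz1 x hx, mul_zero]), e]
    ring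
  have hlim : Filter.Tendsto (fun n : ℕ => ∫ x in B.openBox,
      (u x i * pderiv b (truncation B b r n) x + g b x i * truncation B b r n x)) Filter.atTop
      (nhds (∫ x in B.openBox, (u x i * deriv r (x b) + g b x i * r (x b)))) := by
    -- `C` bounds the derivative of `r` times its cutoff uniformly in `n`, and `D` bounds `r`.
    refine tendsto_integral_of_dominated_convergence (fun x => ‖u x i‖ * C + ‖g b x i‖ * D)
      (fun n => ?_) ?_ (fun n => ?_) ?_
    · obtain ⟨ht, -⟩ := isTest_truncation hB b hr n
      exact (((memLp_coord_openBox u i hB).aestronglyMeasurable).mul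
        (ht.continuous_pderiv b).aestronglyMeasurable).add
        (((memLp_coord_openBox (g b) i hB).aestronglyMeasurable).mul
        ht.smooth.continuous.aestronglyMeasurable)
    · exact ((integrableOn_coord u i hB).norm.mul_const C).add
        ((integrableOn_coord (g b) i hB).norm.mul_const D)
    · refine (ae_restrict_mem B.measurableSet_openBox).mono fun x hx => ?_
      refine (norm_add_le _ _).trans (add_le_add ?_ ?_)
      · rw [norm_mul]
        gcongr
        rw [pderiv_truncation B b hr, norm_mul, Real.norm_eq_abs, Real.norm_eq_abs]
        refine (mul_le_mul (hC n _ (hx b)) ?_ (abs_nonneg _)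
          ((abs_nonneg _).trans (hC n _ (hx b)))).trans_eq (mul_one C)
        rw [Finset.abs_prod]
        exact Finset.prod_le_one (fun _ _ => abs_nonneg _) fun _ _ => abs_cutoff_le_one _ _ _ _
      · rw [norm_mul]
        gcongr
        rw [truncation, norm_mul, Real.norm_eq_abs (Finset.prod _ _)]
        have hDx := hD _ (Ioo_subset_Icc_self (hx b))
        refine (mul_le_mul hDx ?_ (abs_nonneg _)
          ((norm_nonneg _).trans hDx)).trans_eq (mul_one D)
        rw [Finset.abs_prod]
        exact Finset.prod_le_one (fun _ _ => abs_nonneg _) fun _ _ => abs_cutoff_le_one _ _ _ _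
    · refine (ae_restrict_mem B.measurableSet_openBox).mono fun x hx => ?_
      exact (tendsto_const_nhds.mul (tendsto_pderiv_truncation B b hr hx)).add
        (tendsto_const_nhds.mul (tendsto_truncation B b r hx))
  simp only [hz] at hlim
  exact tendsto_nhds_unique hlim tendsto_const_nhds

/-- The difference of the two profiles vanishes at both ends. This allows a smooth transition, which
can be glued across a face, to be exchanged for an affine profile, which produces the face mean. -/
theorem integral_weakGrad_congr {Ω : Set E3} (hΩ : IsOpen Ω) {u : L2 Ω} {g : Fin 3 → L2 Ω}
    (hw : IsWeakGrad Ω u g) {B : Cuboid} (hB : B.openBox ⊆ Ω) (b i : Fin 3) {r₁ r₂ : ℝ → ℝ}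
    (hr₁ : ContDiff ℝ ∞ r₁) (hr₂ : ContDiff ℝ ∞ r₂) (h0 : r₁ (B.lo b) = r₂ (B.lo b))
    (h1 : r₁ (B.hi b) = r₂ (B.hi b)) :
    ∫ x in B.openBox, (u x i * deriv r₁ (x b) + g b x i * r₁ (x b)) =
      ∫ x in B.openBox, (u x i * deriv r₂ (x b) + g b x i * r₂ (x b)) := by
  have hint : ∀ r : ℝ → ℝ, ContDiff ℝ ∞ r → IntegrableOn
      (fun x => u x i * deriv r (x b) + g b x i * r (x b)) B.openBox := fun r hr =>
    (integrableOn_coord_mul u i b hB (hr.continuous_deriv (by simp))).add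
      (integrableOn_coord_mul (g b) i b hB hr.continuous)
  rw [← sub_eq_zero, ← integral_sub (hint _ hr₁) (hint _ hr₂)]
  rw [← integral_weakGrad_eq_zero hΩ hw hB b i (r := fun t => r₁ t - r₂ t)
    (hr₁.sub hr₂) (by simp [h0]) (by simp [h1])]
  refine integral_congr_ae (Filter.Eventually.of_forall fun x => ?_)
  simp only
  rw [((hr₁.differentiable (by simp) _).hasDerivAt.fun_sub
    (hr₂.differentiable (by simp) _).hasDerivAt).deriv]
  ring

theorem merge_openBox_ae {b : Fin 3} {M M' : Cuboid} (h : Adj b M M') :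
    (merge b M M' h).openBox =ᵐ[volume] (M.openBox ∪ M'.openBox : Set E3) := by
  refine Filter.EventuallyLE.antisymm (ae_le_set.2 ?_) (Filter.Eventually.of_forall ?_)
  · refine measure_mono_null (t := (M.closedBox \ M.openBox) ∪ (M'.closedBox \ M'.openBox)) ?_
      (measure_union_null M.volume_closedBox_diff M'.volume_closedBox_diff)
    rintro x ⟨hx, hx'⟩
    by_cases hxb : x b ≤ M.hi b
    · refine Or.inl ⟨fun i => ⟨(hx i).1.le, ?_⟩, fun h => hx' (Or.inl h)⟩
      by_cases hi : i = b
      · subst hi; exact hxb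
      · have := (hx i).2.le
        simpa [merge, hi] using this
    · refine Or.inr ⟨fun i => ?_, fun h => hx' (Or.inr h)⟩
      by_cases hi : i = b
      · subst hi
        have := (hx i).2.le
        simp only [merge, Function.update_self] at this
        rw [← h.1]
        exact ⟨by linarith, this⟩
      · have h1 := (hx i).1.le
        have h2 := (hx i).2.le
        simp only [merge, ne_eq, hi, not_false_eq_true, Function.update_of_ne] at h1 h2
        rw [← (h.2 i hi).1, ← (h.2 i hi).2]
        exact ⟨h1, h2⟩
  · rintro x (hx | hx) i
    · refine ⟨(hx i).1, ?_⟩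
      by_cases hi : i = b
      · subst hi
        have := (hx i).2; have := M'.lt i; have := h.1
        simp only [merge, Function.update_self]; linarith
      · simpa [merge, hi] using (hx i).2
    · by_cases hi : i = b
      · subst hi
        have := (hx i).1; have := M.lt i; have := h.1
        simp only [merge, Function.update_self]
        exact ⟨by linarith, (hx i).2⟩
      · have h1 := hx i
        rw [← (h.2 i hi).1, ← (h.2 i hi).2] at h1
        simpa [merge, hi] using h1

theorem integral_merge {b : Fin 3} {M M' : Cuboid} (h : Adj b M M') {f : E3 → ℝ}
    (hf : IntegrableOn f (merge b M M' h).openBox) :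
    ∫ x in (merge b M M' h).openBox, f x =
      (∫ x in M.openBox, f x) + ∫ x in M'.openBox, f x := by
  rw [setIntegral_congr_set (merge_openBox_ae h)]
  have hf' := hf.congr_set_ae (merge_openBox_ae h).symm
  refine setIntegral_union ?_ M'.measurableSet_openBox (hf'.mono_set subset_union_left)
    (hf'.mono_set subset_union_right)
  refine Set.disjoint_left.2 fun x hx hx' => ?_
  have h1 := (hx b).2
  have h2 := (hx' b).1
  rw [h.1] at h1
  linarith

/-! ### Volume means and face means. -/

section Means

variable {Ω : Set E3}

/-- The mean value over `M` of component `i`. -/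
def volMean (φ : H1 Ω) (M : Cuboid) (i : Fin 3) : ℝ := (∫ x in M.openBox, φ.1.1 x i) / M.vol

/-- The coordinate of the face of `M` opposite to the face on side `s` in direction `b`. -/
def opposite (M : Cuboid) (b : Fin 3) (s : SignType) : ℝ := if s = 1 then M.lo b else M.hi b

/-- The mean value of component `i` over the face of `M` on side `s = ±1` in direction `b`,
expressed by integrals over `M`. -/
def faceMean (φ : H1 Ω) (M : Cuboid) (i b : Fin 3) (s : SignType) : ℝ :=
  volMean φ M i + (∫ x in M.openBox, φ.1.2 b x i * (x b - opposite M b s)) / M.vol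

/-- The weights of the two face means differ by the constant `M.len b` and the volume means cancel.
Since `vol / len` is the area of the face, this is the fundamental theorem in terms of face means.
-/
theorem integral_grad_eq (φ : H1 Ω) {M : Cuboid} (hM : M.openBox ⊆ Ω) (i b : Fin 3) :
    ∫ x in M.openBox, φ.1.2 b x i =
      M.vol / M.len b * (faceMean φ M i b 1 - faceMean φ M i b (-1)) := by
  have h1 : ∀ s : ℝ, IntegrableOn (fun x => φ.1.2 b x i * (x b - s)) M.openBox := fun s =>
    integrableOn_coord_mul (φ.1.2 b) i b hM (r := fun t => t - s) (by fun_prop)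
  have hv := M.vol_pos.ne'
  have hl := (M.len_pos b).ne'
  have h2 : (∫ x in M.openBox, φ.1.2 b x i * (x b - M.lo b)) -
      (∫ x in M.openBox, φ.1.2 b x i * (x b - M.hi b)) = M.len b * ∫ x in M.openBox, φ.1.2 b x i := by
    rw [← integral_sub (h1 _) (h1 _), ← integral_const_mul]
    refine integral_congr_ae (Filter.Eventually.of_forall fun x => ?_)
    simp only [len]
    ring
  simp only [faceMean, opposite, if_true, if_neg (show (-1 : SignType) ≠ 1 by decide)]
  rw [add_sub_add_left_eq_sub, ← sub_div, h2]
  field_simp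

theorem vol_div_len_eq {b : Fin 3} {M M' : Cuboid} (h : Adj b M M') :
    M.vol / M.len b = M'.vol / M'.len b := by
  have e : ∀ N : Cuboid, N.vol / N.len b = ∏ j : Fin 2, N.len (b.succAbove j) := by
    intro N
    rw [vol, Fin.prod_univ_succAbove _ b, mul_div_cancel_left₀ _ (N.len_pos b).ne']
  rw [e, e]
  refine Finset.prod_congr rfl fun j _ => ?_
  rw [len, len, (h.2 _ (Fin.succAbove_ne b j)).1, (h.2 _ (Fin.succAbove_ne b j)).2]

/-- The two means over a common face, computed from either side, agree. -/
theorem faceMean_eq_of_adj (hΩ : IsOpen Ω) (φ : H1 Ω) {b : Fin 3} {M M' : Cuboid}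
    (h : Adj b M M') (hmerge : (merge b M M' h).openBox ⊆ Ω) (hM : M.openBox ⊆ Ω)
    (hM' : M'.openBox ⊆ Ω) (i : Fin 3) : faceMean φ M i b 1 = faceMean φ M' i b (-1) := by
  have hS := Real.smoothTransition.contDiff (n := ⊤)
  have hl := M.len_pos b
  have hl' := M'.len_pos b
  -- `S₁` rises on `M` and equals one on `M'`; `S₂` equals one on `M` and falls on `M'`. Their
  -- product is a smooth bump on the union that vanishes at its ends. The affine `L₁` and `L₂` have
  -- the same end values on their own cuboids but would meet in a kink.
  set S₁ : ℝ → ℝ := fun t => Real.smoothTransition ((t - M.lo b) / M.len b) with hS₁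
  set S₂ : ℝ → ℝ := fun t => Real.smoothTransition ((M'.hi b - t) / M'.len b) with hS₂
  set L₁ : ℝ → ℝ := fun t => (t - M.lo b) / M.len b with hL₁
  set L₂ : ℝ → ℝ := fun t => (M'.hi b - t) / M'.len b with hL₂
  have cL₁ : ContDiff ℝ ∞ L₁ := by fun_prop
  have cL₂ : ContDiff ℝ ∞ L₂ := by fun_prop
  have cS₁ : ContDiff ℝ ∞ S₁ := hS.comp cL₁
  have cS₂ : ContDiff ℝ ∞ S₂ := hS.comp cL₂
  have e1 : L₁ (M.lo b) = 0 := by simp [hL₁]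
  have e2 : L₁ (M.hi b) = 1 := div_self hl.ne'
  have e3 : L₂ (M'.lo b) = 1 := div_self hl'.ne'
  have e4 : L₂ (M'.hi b) = 0 := by simp [hL₂]
  have s1 : S₁ (M.lo b) = 0 := by
    change Real.smoothTransition (L₁ _) = 0; rw [e1, Real.smoothTransition.zero]
  have s2 : S₁ (M.hi b) = 1 := by
    change Real.smoothTransition (L₁ _) = 1; rw [e2, Real.smoothTransition.one]
  have s3 : S₂ (M'.lo b) = 1 := by
    change Real.smoothTransition (L₂ _) = 1; rw [e3, Real.smoothTransition.one]
  have s4 : S₂ (M'.hi b) = 0 := by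
    change Real.smoothTransition (L₂ _) = 0; rw [e4, Real.smoothTransition.zero]
  have hd1 : ∀ t, deriv L₁ t = 1 / M.len b := fun t =>
    (((hasDerivAt_id t).sub_const (M.lo b)).div_const (M.len b)).deriv
  have hd2 : ∀ t, deriv L₂ t = -1 / M'.len b := fun t =>
    (((hasDerivAt_id t).const_sub (M'.hi b)).div_const (M'.len b)).deriv
  have hw : IsWeakGrad Ω φ.1.1 φ.1.2 := φ.2
  have hint1 := integrableOn_coord φ.1.1 i hM
  have hint1' := integrableOn_coord φ.1.1 i hM'
  have k1 := integral_weakGrad_congr hΩ hw hM b i cS₁ cL₁ (s1.trans e1.symm) (s2.trans e2.symm)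
  have k2 := integral_weakGrad_congr hΩ hw hM' b i cS₂ cL₂ (s3.trans e3.symm) (s4.trans e4.symm)
  have k3 := integral_weakGrad_eq_zero hΩ hw hmerge b i (r := S₁ * S₂) (cS₁.mul cS₂)
    (by change S₁ (M.lo b) * _ = 0; rw [s1, zero_mul])
    (by simp only [merge, Function.update_self, Pi.mul_apply]; rw [s4, mul_zero])
  have hb := h.1
  have c₁₂ : ContDiff ℝ ∞ (S₁ * S₂) := cS₁.mul cS₂
  have hint := (integrableOn_coord_mul φ.1.1 i b hmerge (c₁₂.continuous_deriv (by simp))).add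
    (integrableOn_coord_mul (φ.1.2 b) i b hmerge c₁₂.continuous)
  rw [integral_merge h (by exact hint)] at k3
  have k4 : ∫ x in M.openBox, (φ.1.1 x i * deriv (S₁ * S₂) (x b) + φ.1.2 b x i * (S₁ * S₂) (x b)) =
      ∫ x in M.openBox, (φ.1.1 x i * deriv S₁ (x b) + φ.1.2 b x i * S₁ (x b)) := by
    refine setIntegral_congr_fun M.measurableSet_openBox fun x hx => ?_
    have : S₁ * S₂ =ᶠ[nhds (x b)] S₁ := by
      filter_upwards [Iio_mem_nhds (hx b).2] with t ht
      have : S₂ t = 1 := Real.smoothTransition.one_of_one_le ((one_le_div hl').2 (by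
        have := mem_Iio.1 ht; simp only [len]; linarith))
      rw [Pi.mul_apply, this, mul_one]
    simp only [this.deriv_eq, this.eq_of_nhds]
  have k5 : ∫ x in M'.openBox, (φ.1.1 x i * deriv (S₁ * S₂) (x b) + φ.1.2 b x i * (S₁ * S₂) (x b)) =
      ∫ x in M'.openBox, (φ.1.1 x i * deriv S₂ (x b) + φ.1.2 b x i * S₂ (x b)) := by
    refine setIntegral_congr_fun M'.measurableSet_openBox fun x hx => ?_
    have : S₁ * S₂ =ᶠ[nhds (x b)] S₂ := by
      filter_upwards [Ioi_mem_nhds (hx b).1] with t ht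
      have : S₁ t = 1 := Real.smoothTransition.one_of_one_le ((one_le_div hl).2 (by
        have := mem_Ioi.1 ht; simp only [len]; linarith))
      rw [Pi.mul_apply, this, one_mul]
    simp only [this.deriv_eq, this.eq_of_nhds]
  -- With the affine profile the integrand is `(φ + ∂_b φ (x_b - lo)) / len`, which is the
  -- definition of `faceMean` up to the area `vol / len` of the face.
  have f1 : ∫ x in M.openBox, (φ.1.1 x i * deriv L₁ (x b) + φ.1.2 b x i * L₁ (x b)) =
      M.vol / M.len b * faceMean φ M i b 1 := by
    have hg := integrableOn_coord_mul (φ.1.2 b) i b hM (r := fun t => t - M.lo b) (by fun_prop)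
    simp only [hd1]
    rw [faceMean, volMean, opposite, if_pos rfl, ← add_div, ← integral_add hint1 hg,
      div_mul_div_comm, mul_comm M.vol, mul_div_mul_right _ _ M.vol_pos.ne', ← integral_div]
    refine integral_congr_ae (Filter.Eventually.of_forall fun x => ?_)
    simp only [hL₁]
    ring
  have f2 : ∫ x in M'.openBox, (φ.1.1 x i * deriv L₂ (x b) + φ.1.2 b x i * L₂ (x b)) =
      -(M'.vol / M'.len b * faceMean φ M' i b (-1)) := by
    have hg := integrableOn_coord_mul (φ.1.2 b) i b hM' (r := fun t => t - M'.hi b) (by fun_prop)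
    simp only [hd2]
    rw [faceMean, volMean, opposite, if_neg (by decide), ← add_div, ← integral_add hint1' hg,
      div_mul_div_comm, mul_comm M'.vol, mul_div_mul_right _ _ M'.vol_pos.ne', ← integral_div,
      ← integral_neg]
    refine integral_congr_ae (Filter.Eventually.of_forall fun x => ?_)
    simp only [hL₂]
    ring
  rw [k4, k5, k1, k2, f1, f2, ← vol_div_len_eq h, ← sub_eq_add_neg, ← mul_sub] at k3
  rcases mul_eq_zero.1 k3 with h0 | h0
  · exact absurd h0 (div_pos M.vol_pos hl).ne'
  · exact sub_eq_zero.1 h0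

/-- Cauchy–Schwarz, read off from the variance of `f` being nonnegative. -/
theorem sq_integral_le (M : Cuboid) {f : E3 → ℝ} (hf : MemLp f 2 (volume.restrict M.openBox)) :
    (∫ x in M.openBox, f x) ^ 2 ≤ M.vol * ∫ x in M.openBox, f x ^ 2 := by
  set I := ∫ x in M.openBox, f x with hI
  have hv := M.vol_pos
  have h1 : IntegrableOn f M.openBox := hf.integrable (by norm_num)
  have h2 : IntegrableOn (fun x => f x ^ 2) M.openBox := hf.integrable_sq
  have h3 : 0 ≤ ∫ x in M.openBox, (f x - I / M.vol) ^ 2 :=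
    integral_nonneg fun x => sq_nonneg _
  have h4 : ∫ x in M.openBox, (f x - I / M.vol) ^ 2 =
      (∫ x in M.openBox, f x ^ 2) - 2 * (I / M.vol) * I + M.vol * (I / M.vol) ^ 2 := by
    have hc : ∫ _ in M.openBox, (I / M.vol) ^ 2 = M.vol * (I / M.vol) ^ 2 := by
      rw [setIntegral_const, measureReal_def, M.volume_openBox, ENNReal.toReal_ofReal hv.le,
        smul_eq_mul]
    rw [← hc, hI, ← integral_const_mul, ← hI, ← integral_sub h2 (h1.const_mul _),
      ← integral_add (by exact h2.sub (h1.const_mul _)) (integrable_const _)]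
    refine integral_congr_ae (Filter.Eventually.of_forall fun x => ?_)
    simp only
    ring
  rw [h4] at h3
  have h5 : M.vol * (I / M.vol) ^ 2 = I ^ 2 / M.vol := by field_simp
  have h6 : 2 * (I / M.vol) * I = 2 * (I ^ 2 / M.vol) := by ring
  rw [h5, h6] at h3
  have h7 : I ^ 2 / M.vol ≤ ∫ x in M.openBox, f x ^ 2 := by linarith
  rw [div_le_iff₀ hv] at h7
  linarith

theorem vol_mul_sq_volMean_le (φ : H1 Ω) {M : Cuboid} (hM : M.openBox ⊆ Ω) (i : Fin 3) :
    M.vol * volMean φ M i ^ 2 ≤ ∫ x in M.openBox, φ.1.1 x i ^ 2 := by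
  have hv := M.vol_pos
  have := sq_integral_le M (memLp_coord_openBox φ.1.1 i hM)
  rw [volMean, div_pow, mul_div_assoc', div_le_iff₀ (by positivity)]
  calc M.vol * (∫ x in M.openBox, φ.1.1 x i) ^ 2
      ≤ M.vol * (M.vol * ∫ x in M.openBox, φ.1.1 x i ^ 2) := by gcongr
    _ = _ := by ring

/-- The weight `x b - opposite M b s` is bounded by `M.len b` on `M`, so Cauchy–Schwarz applies
directly. This does the work of a trace and a Poincaré inequality. -/
theorem vol_mul_sq_faceMean_sub_le (φ : H1 Ω) {M : Cuboid} (hM : M.openBox ⊆ Ω) (i b : Fin 3)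
    (s : SignType) :
    M.vol * (faceMean φ M i b s - volMean φ M i) ^ 2 ≤
      M.len b ^ 2 * ∫ x in M.openBox, φ.1.2 b x i ^ 2 := by
  have hv := M.vol_pos
  have hc : Continuous fun x : E3 => x b - opposite M b s := by fun_prop
  have hbd : ∀ x ∈ M.openBox, |x b - opposite M b s| ≤ M.len b := by
    intro x hx
    have := hx b
    rw [abs_le, opposite, len]
    split_ifs <;> constructor <;> linarith [this.1, this.2]
  have h2 : IntegrableOn (fun x => φ.1.2 b x i ^ 2) M.openBox :=
    (memLp_coord_openBox (φ.1.2 b) i hM).integrable_sq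
  have hm : MemLp (fun x => φ.1.2 b x i * (x b - opposite M b s)) 2 (volume.restrict M.openBox) := by
    refine (memLp_coord_openBox (φ.1.2 b) i hM).of_le_mul (c := M.len b)
      ((memLp_coord_openBox (φ.1.2 b) i hM).aestronglyMeasurable.mul hc.aestronglyMeasurable)
      ((ae_restrict_mem M.measurableSet_openBox).mono fun x hx => ?_)
    rw [norm_mul, mul_comm]
    exact mul_le_mul_of_nonneg_right (hbd x hx) (norm_nonneg _)
  have h3 := sq_integral_le M hm
  have h4 : ∫ x in M.openBox, (φ.1.2 b x i * (x b - opposite M b s)) ^ 2 ≤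
      ∫ x in M.openBox, M.len b ^ 2 * φ.1.2 b x i ^ 2 := by
    refine setIntegral_mono_on hm.integrable_sq (h2.const_mul _) M.measurableSet_openBox ?_
    intro x hx
    rw [mul_pow, mul_comm]
    exact mul_le_mul_of_nonneg_right (sq_le_sq' (abs_le.1 (hbd x hx)).1 (abs_le.1 (hbd x hx)).2)
      (sq_nonneg _)
  rw [integral_const_mul] at h4
  rw [faceMean, add_sub_cancel_left, div_pow, mul_div_assoc', div_le_iff₀ (by positivity)]
  calc M.vol * (∫ x in M.openBox, φ.1.2 b x i * (x b - opposite M b s)) ^ 2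
      ≤ M.vol * (M.vol * (M.len b ^ 2 * ∫ x in M.openBox, φ.1.2 b x i ^ 2)) := by
        gcongr; exact h3.trans (by gcongr)
    _ = _ := by ring

theorem integral_openBox_coord_add (u v : L2 Ω) {M : Cuboid} (hM : M.openBox ⊆ Ω) (i b : Fin 3)
    {r : ℝ → ℝ} (hr : Continuous r) :
    ∫ x in M.openBox, (u + v : L2 Ω) x i * r (x b) =
      (∫ x in M.openBox, u x i * r (x b)) + ∫ x in M.openBox, v x i * r (x b) := by
  rw [← integral_add (integrableOn_coord_mul u i b hM hr) (integrableOn_coord_mul v i b hM hr)]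
  refine integral_congr_ae ?_
  filter_upwards [ae_mono (Measure.restrict_mono hM le_rfl) (Lp.coeFn_add u v)] with x hx
  rw [hx]
  simp [add_mul]

theorem integral_openBox_coord_smul (a : ℝ) (u : L2 Ω) {M : Cuboid} (hM : M.openBox ⊆ Ω)
    (i b : Fin 3) (r : ℝ → ℝ) :
    ∫ x in M.openBox, (a • u : L2 Ω) x i * r (x b) =
      a * ∫ x in M.openBox, u x i * r (x b) := by
  rw [← integral_const_mul]
  refine integral_congr_ae ?_
  filter_upwards [ae_mono (Measure.restrict_mono hM le_rfl) (Lp.coeFn_smul a u)] with x hx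
  rw [hx]
  simp [mul_assoc]

theorem volMean_add (φ ψ : H1 Ω) {M : Cuboid} (hM : M.openBox ⊆ Ω) (i : Fin 3) :
    volMean (φ + ψ) M i = volMean φ M i + volMean ψ M i := by
  have := integral_openBox_coord_add φ.1.1 ψ.1.1 hM i 0 (r := fun _ => 1) continuous_const
  simp only [mul_one] at this
  rw [volMean, volMean, volMean, ← add_div, ← this]
  rfl

theorem volMean_smul (a : ℝ) (φ : H1 Ω) {M : Cuboid} (hM : M.openBox ⊆ Ω) (i : Fin 3) :
    volMean (a • φ) M i = a * volMean φ M i := by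
  have := integral_openBox_coord_smul a φ.1.1 hM i 0 (fun _ => 1)
  simp only [mul_one] at this
  rw [volMean, volMean, ← mul_div_assoc, ← this]
  rfl

theorem faceMean_add (φ ψ : H1 Ω) {M : Cuboid} (hM : M.openBox ⊆ Ω) (i b : Fin 3)
    (s : SignType) :
    faceMean (φ + ψ) M i b s = faceMean φ M i b s + faceMean ψ M i b s := by
  have := integral_openBox_coord_add (φ.1.2 b) (ψ.1.2 b) hM i b
    (r := fun t => t - opposite M b s) (by fun_prop)
  rw [faceMean, faceMean, faceMean, volMean_add φ ψ hM, add_add_add_comm, ← add_div, ← this]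
  rfl

theorem faceMean_smul (a : ℝ) (φ : H1 Ω) {M : Cuboid} (hM : M.openBox ⊆ Ω) (i b : Fin 3)
    (s : SignType) : faceMean (a • φ) M i b s = a * faceMean φ M i b s := by
  have := integral_openBox_coord_smul a (φ.1.2 b) hM i b (fun t => t - opposite M b s)
  rw [faceMean, faceMean, volMean_smul a φ hM, mul_add, ← mul_div_assoc, ← this]
  rfl

end Means

/-! ### Shape regularity and the grids of the macroelements. -/

theorem len_le_diam (E : Cuboid) (i : Fin 3) : E.len i ≤ Metric.diam E.closedBox := by
  have h1 : WithLp.toLp 2 E.lo ∈ E.closedBox := fun j => ⟨le_rfl, (E.lt j).le⟩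
  have h2 : WithLp.toLp 2 E.hi ∈ E.closedBox := fun j => ⟨(E.lt j).le, le_rfl⟩
  refine le_trans ?_ (Metric.dist_le_diam_of_mem (isCompact_closedBox E).isBounded h2 h1)
  rw [dist_eq_norm]
  have := PiLp.norm_apply_le (WithLp.toLp 2 E.hi - WithLp.toLp 2 E.lo : E3) i
  simp only [PiLp.sub_apply, Real.norm_eq_abs] at this
  exact (le_abs_self _).trans this

theorem IsShapeRegular.len_le {κ : ℝ} {T : Finset Cuboid} (h : IsShapeRegular κ T) {E : Cuboid}
    (hE : E ∈ T) (i j : Fin 3) : E.len i ≤ κ * E.len j :=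
  (len_le_diam E i).trans (h E hE j)

/-- The tensor-product grid by which the elements of `T` subdivide `M`. -/
structure Subdivides (T : Finset Cuboid) (M : Cuboid) (k : Fin 3 → ℕ) (g : Fin 3 → ℕ → ℝ) :
    Prop where
  two_or_three : ∀ i, k i = 2 ∨ k i = 3
  lt_succ : ∀ i, ∀ n < k i, g i n < g i (n + 1)
  lo_eq : ∀ i, g i 0 = M.lo i
  hi_eq : ∀ i, g i (k i) = M.hi i
  mem_iff : ∀ E : Cuboid, (E ∈ T ∧ E.closedBox ⊆ M.closedBox) ↔
    ∃ m : Fin 3 → ℕ, ∀ i, m i < k i ∧ E.lo i = g i (m i) ∧ E.hi i = g i (m i + 1)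

namespace Subdivides

variable {T : Finset Cuboid} {M : Cuboid} {k : Fin 3 → ℕ} {g : Fin 3 → ℕ → ℝ}

theorem mono (h : Subdivides T M k g) (i : Fin 3) {m n : ℕ} (hmn : m ≤ n) (hn : n ≤ k i) :
    g i m ≤ g i n := by
  induction n, hmn using Nat.le_induction with
  | base => exact le_rfl
  | succ n _ ih => exact (ih (by omega)).trans (h.lt_succ i n (by omega)).le

theorem two_le (h : Subdivides T M k g) (i : Fin 3) : 2 ≤ k i := by
  rcases h.two_or_three i with h | h <;> omega

theorem exists_cell (h : Subdivides T M k g) (m : Fin 3 → ℕ) (hm : ∀ i, m i < k i) :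
    ∃ E ∈ T, ∀ i, E.lo i = g i (m i) ∧ E.hi i = g i (m i + 1) := by
  let E : Cuboid := ⟨fun i => g i (m i), fun i => g i (m i + 1), fun i => h.lt_succ i _ (hm i)⟩
  exact ⟨E, ((h.mem_iff E).2 ⟨m, fun i => ⟨hm i, rfl, rfl⟩⟩).1, fun i => ⟨rfl, rfl⟩⟩

/-- Steps in different directions are edges of a common cell, so their ratio is at most `κ`. Steps
in the same direction are compared through a step in another one, which gives `κ ^ 2`. -/
theorem step_le (h : Subdivides T M k g) {κ : ℝ} (hκ : IsShapeRegular κ T) {i j : Fin 3}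
    {m n : ℕ} (hm : m < k i) (hn : n < k j) :
    g i (m + 1) - g i m ≤ κ ^ 2 * (g j (n + 1) - g j n) := by
  have key : ∀ i j : Fin 3, i ≠ j → ∀ m n, m < k i → n < k j →
      g i (m + 1) - g i m ≤ κ * (g j (n + 1) - g j n) := by
    intro i j hij m n hm hn
    obtain ⟨E, hE, he⟩ := h.exists_cell (Function.update (Function.update 0 i m) j n) (by
      intro l
      by_cases hl : l = j
      · subst hl; simpa using hn
      · by_cases hl' : l = i
        · subst hl'; simpa [hl] using hm
        · simpa [hl, hl'] using (h.two_le l).trans_lt' zero_lt_two)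
    have := hκ.len_le hE i j
    rw [len, len, (he i).1, (he i).2, (he j).1, (he j).2] at this
    simpa [hij] using this
  have pos : ∀ i m, m < k i → 0 < g i (m + 1) - g i m := fun i m hm =>
    sub_pos.2 (h.lt_succ i m hm)
  have hk : ∀ i, 0 < k i := fun i => (h.two_le i).trans_lt' zero_lt_two
  have hκ0 : 0 ≤ κ := by
    obtain ⟨l, hl⟩ := exists_ne i
    by_contra hneg
    have h1 := key i l hl.symm m 0 hm (hk l)
    have h2 := mul_neg_of_neg_of_pos (not_le.1 hneg) (pos l 0 (hk l))
    linarith [pos i m hm]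
  have same : ∀ i m n, m < k i → n < k i → g i (m + 1) - g i m ≤ κ ^ 2 * (g i (n + 1) - g i n) := by
    intro i m n hm hn
    obtain ⟨l, hl⟩ := exists_ne i
    calc g i (m + 1) - g i m ≤ κ * (g l (0 + 1) - g l 0) := key i l hl.symm m 0 hm (hk l)
      _ ≤ κ * (κ * (g i (n + 1) - g i n)) := by gcongr; exact key l i hl 0 n (hk l) hn
      _ = _ := by ring
  by_cases hij : i = j
  · subst hij
    exact same i m n hm hn
  -- Comparing an edge of a cell with itself gives `1 ≤ κ`, hence `κ ≤ κ ^ 2`.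
  · have hκ1 : 1 ≤ κ := by
      obtain ⟨E, hE, he⟩ := h.exists_cell (fun _ => 0) hk
      have := hκ.len_le hE i i
      by_contra hlt
      have h3 := mul_lt_mul_of_pos_right (not_le.1 hlt) (E.len_pos i)
      linarith
    refine (key i j hij m n hm hn).trans (mul_le_mul_of_nonneg_right ?_ (pos j n hn).le)
    nlinarith

/-- An edge of `M` consists of at most three steps, each at most `κ ^ 2` times the given one. -/
theorem len_le_step (h : Subdivides T M k g) {κ : ℝ} (hκ : IsShapeRegular κ T) (i : Fin 3)
    {j : Fin 3} {n : ℕ} (hn : n < k j) :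
    M.len i ≤ 3 * κ ^ 2 * (g j (n + 1) - g j n) := by
  rw [len, ← h.lo_eq, ← h.hi_eq]
  have hs : 0 < g j (n + 1) - g j n := sub_pos.2 (h.lt_succ j n hn)
  have hks : 0 ≤ κ ^ 2 * (g j (n + 1) - g j n) := by positivity
  rcases h.two_or_three i with hi | hi
  · have h0 := h.step_le hκ (i := i) (m := 0) (by omega) hn
    have h1 := h.step_le hκ (i := i) (m := 1) (by omega) hn
    rw [hi]
    norm_num at h0 h1 ⊢
    linarith
  · have h0 := h.step_le hκ (i := i) (m := 0) (by omega) hn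
    have h1 := h.step_le hκ (i := i) (m := 1) (by omega) hn
    have h2 := h.step_le hκ (i := i) (m := 2) (by omega) hn
    rw [hi]
    norm_num at h0 h1 h2 ⊢
    linarith

/-- The knots of the grid in direction `i`. -/
def knots (h : Subdivides T M k g) (i : Fin 3) : Knots where
  lo := M.lo i
  -- With two cells the first and the last interior point coincide; with three they differ.
  a := g i 1
  b := g i (k i - 1)
  hi := M.hi i
  lo_lt := by
    rw [← h.lo_eq]; exact h.lt_succ i 0 (by have := h.two_le i; omega)
  a_le := h.mono i (by have := h.two_le i; omega) (by omega)
  lt_hi := by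
    have h2 := h.two_le i
    have := h.lt_succ i (k i - 1) (by omega)
    rwa [Nat.sub_add_cancel (by omega), h.hi_eq] at this

/-- Two fine cells, one from each side, in the same corner of the common face touch there.
Conformity of the fine mesh makes them share a full face, whose far end is the first interior grid
point on both sides. The opposite corner gives the last interior grid point. -/
theorem compatible {Ω : Set E3} (hT : IsMesh Ω T) (h : Subdivides T M k g) {M' : Cuboid}
    {k' : Fin 3 → ℕ} {g' : Fin 3 → ℕ → ℝ} (h' : Subdivides T M' k' g') {b : Fin 3}
    (ha : Adj b M M') {c : Fin 3} (hc : c ≠ b) : h.knots c = h'.knots c := by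
  have e1 : g c 1 = g' c 1 := by
    obtain ⟨E, hE, he⟩ := h.exists_cell (fun i => if i = b then k b - 1 else 0) (by
      intro i
      have := h.two_le i
      split_ifs with hi
      · subst hi; omega
      · omega)
    obtain ⟨E', hE', he'⟩ := h'.exists_cell (fun _ => 0) (by
      intro i
      have := h'.two_le i
      omega)
    have hb : E.hi b = E'.lo b := by
      rw [(he b).2, (he' b).1, if_pos rfl, Nat.sub_add_cancel (by have := h.two_le b; omega),
        h.hi_eq, h'.lo_eq, ha.1]
    have hlo : ∀ i ≠ b, E.lo i = E'.lo i := fun i hi => by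
      rw [(he i).1, (he' i).1, if_neg hi, h.lo_eq, h'.lo_eq, (ha.2 i hi).1]
    have := hT.adj_of_touch hE hE' hb fun i hi =>
      ⟨(hlo i hi).trans_lt (E'.lt i), (hlo i hi).symm.trans_lt (E.lt i)⟩
    have := (this.2 c hc).2
    rwa [(he c).2, (he' c).2, if_neg hc] at this
  have e2 : g c (k c - 1) = g' c (k' c - 1) := by
    obtain ⟨E, hE, he⟩ := h.exists_cell (fun i => k i - 1) (by
      intro i
      have := h.two_le i
      omega)
    obtain ⟨E', hE', he'⟩ := h'.exists_cell (fun i => if i = b then 0 else k' i - 1) (by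
      intro i
      have := h'.two_le i
      split_ifs with hi
      · omega
      · omega)
    have hs : ∀ i, k i - 1 + 1 = k i := fun i => Nat.sub_add_cancel (by have := h.two_le i; omega)
    have hs' : ∀ i, k' i - 1 + 1 = k' i := fun i =>
      Nat.sub_add_cancel (by have := h'.two_le i; omega)
    have hb : E.hi b = E'.lo b := by
      rw [(he b).2, (he' b).1, if_pos rfl, hs, h.hi_eq, h'.lo_eq, ha.1]
    have hhi : ∀ i ≠ b, E.hi i = E'.hi i := fun i hi => by
      rw [(he i).2, (he' i).2, if_neg hi, hs, hs', h.hi_eq, h'.hi_eq, (ha.2 i hi).2]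
    have := hT.adj_of_touch hE hE' hb fun i hi =>
      ⟨(E.lt i).trans_eq (hhi i hi), (E'.lt i).trans_eq (hhi i hi).symm⟩
    have := (this.2 c hc).1
    rwa [(he c).1, (he' c).1, if_neg hc] at this
  simp only [knots, e1, e2, (ha.2 c hc).1, (ha.2 c hc).2]

end Subdivides

theorem exists_grid {Ω : Set E3} {T 𝓜 : Finset Cuboid} {κ : ℝ} (hT : IsMesh Ω T)
    (hκ : IsShapeRegular κ T) (h𝓜 : IsMacroMesh Ω T 𝓜) :
    ∃ G : Grid, G.Compatible 𝓜 ∧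
      (∀ M ∈ 𝓜, ∀ i j, M.len i ≤ 3 * κ ^ 2 * ((G.knots M j).a - (G.knots M j).lo) ∧
        M.len i ≤ 3 * κ ^ 2 * ((G.knots M j).hi - (G.knots M j).b)) ∧
      ∀ E ∈ T, ∃ M ∈ 𝓜, E.openBox ⊆ M.openBox ∧ ∀ j,
        (E.hi j ≤ (G.knots M j).a ∨ (G.knots M j).a ≤ E.lo j) ∧
        (E.hi j ≤ (G.knots M j).b ∨ (G.knots M j).b ≤ E.lo j) := by
  classical
  have hex : ∀ M : Cuboid, ∃ K : Fin 3 → Knots, (∀ i, (K i).lo = M.lo i ∧ (K i).hi = M.hi i) ∧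
      (M ∈ 𝓜 → ∃ k g, ∃ h : Subdivides T M k g, K = h.knots) := by
    intro M
    by_cases hM : M ∈ 𝓜
    · obtain ⟨k, g, h1, h2, h3, h4, h5⟩ := h𝓜.macroelement M hM
      have h : Subdivides T M k g := ⟨h1, h2, h3, h4, h5⟩
      exact ⟨h.knots, fun i => ⟨rfl, rfl⟩, fun _ => ⟨k, g, h, rfl⟩⟩
    -- Cuboids outside the macroelement mesh get the midpoint as a default.
    · refine ⟨fun i => ⟨M.lo i, (M.lo i + M.hi i) / 2, (M.lo i + M.hi i) / 2, M.hi i,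
        by linarith [M.lt i], le_rfl, by linarith [M.lt i]⟩, fun i => ⟨rfl, rfl⟩,
        fun h => absurd h hM⟩
  choose K hK hK' using hex
  refine ⟨⟨K, fun M i => (hK M i).1, fun M i => (hK M i).2⟩, ?_, ?_, ?_⟩
  · intro b M hM M' hM' ha c hc
    obtain ⟨k, g, h, e⟩ := hK' M hM
    obtain ⟨k', g', h', e'⟩ := hK' M' hM'
    change K M c = K M' c
    rw [e, e']
    exact h.compatible hT h' ha hc
  · intro M hM i j
    obtain ⟨k, g, h, e⟩ := hK' M hM
    simp only [e, Subdivides.knots]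
    have h2 := h.two_le j
    constructor
    · have := h.len_le_step hκ i (j := j) (n := 0) (by omega)
      rwa [h.lo_eq] at this
    · have := h.len_le_step hκ i (j := j) (n := k j - 1) (by omega)
      rwa [Nat.sub_add_cancel (by omega), h.hi_eq] at this
  · intro E hE
    obtain ⟨M, hM, hEM⟩ := h𝓜.agglomerates E hE
    obtain ⟨k, g, h, e⟩ := hK' M hM
    obtain ⟨m, hm⟩ := (h.mem_iff E).1 ⟨hE, hEM⟩
    refine ⟨M, hM, fun x hx i => ?_, fun j => ?_⟩
    · have h1 := h.mono i (Nat.zero_le (m i)) (hm i).1.le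
      have h2 := h.mono i (m := m i + 1) (n := k i) (hm i).1 le_rfl
      rw [h.lo_eq, ← (hm i).2.1] at h1
      rw [h.hi_eq, ← (hm i).2.2] at h2
      exact ⟨h1.trans_lt (hx i).1, (hx i).2.trans_le h2⟩
    · simp only [e, Subdivides.knots]
      rw [(hm j).2.1, (hm j).2.2]
      have h2 := h.two_le j
      have h3 := (hm j).1
      constructor
      · by_cases h0 : m j = 0
        · left; rw [h0]
        · right; exact h.mono j (by omega) (by omega)
      · by_cases h0 : m j + 1 ≤ k j - 1
        · left; exact h.mono j h0 (by omega)
        · right; exact h.mono j (by omega) (by omega)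

/-! ### Edges as connected components of face neighbours. -/

/-- A cuboid with one of its edges in a given direction `a`; the edge is described by its sides
in directions `a + 1` and `a + 2`. -/
abbrev Corner : Type := Cuboid × SignType × SignType

theorem fin3_ne (a : Fin 3) : a ≠ a + 1 ∧ a ≠ a + 2 ∧ a + 1 ≠ a + 2 := by
  decide +revert

theorem fin3_cases (a i : Fin 3) : i = a ∨ i = a + 1 ∨ i = a + 2 := by
  decide +revert

/-- The coordinate of the face of `M` on side `s` in direction `j`. -/
def sideCoord (M : Cuboid) (j : Fin 3) (s : SignType) : ℝ := if s = 1 then M.hi j else M.lo j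

/-- Passage to a face neighbour that contains the same edge in direction `a`. -/
def CornerStep (𝓜 : Finset Cuboid) (a : Fin 3) (v w : Corner) : Prop :=
  v.1 ∈ 𝓜 ∧ w.1 ∈ 𝓜 ∧
    ((Adj (a + 1) v.1 w.1 ∧ v.2.1 = 1 ∧ w.2.1 = -1 ∧ v.2.2 = w.2.2) ∨
      (Adj (a + 2) v.1 w.1 ∧ v.2.2 = 1 ∧ w.2.2 = -1 ∧ v.2.1 = w.2.1))

/-- The graph whose connected components are the edges in direction `a`, as seen from `Ω`. -/
def cornerGraph (𝓜 : Finset Cuboid) (a : Fin 3) : SimpleGraph Corner :=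
  SimpleGraph.fromRel (CornerStep 𝓜 a)

/-- The position of the edge. -/
def cornerKey (a : Fin 3) (v : Corner) : ℝ × ℝ × ℝ × ℝ :=
  (v.1.lo a, v.1.hi a, sideCoord v.1 (a + 1) v.2.1, sideCoord v.1 (a + 2) v.2.2)

theorem CornerStep.key_eq {𝓜 : Finset Cuboid} {a : Fin 3} {v w : Corner}
    (h : CornerStep 𝓜 a v w) : cornerKey a v = cornerKey a w := by
  obtain ⟨M, s, t⟩ := v
  obtain ⟨M', s', t'⟩ := w
  obtain ⟨n1, n2, n3⟩ := fin3_ne a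
  obtain ⟨-, -, ⟨ha, rfl, rfl, rfl⟩ | ⟨ha, rfl, rfl, rfl⟩⟩ := h
  · simp only at ha
    simp [cornerKey, sideCoord, ha.1, ha.2 a n1, ha.2 (a + 2) n3.symm]
  · simp only at ha
    simp [cornerKey, sideCoord, ha.1, ha.2 a n2, ha.2 (a + 1) n3]

theorem cornerGraph_adj {𝓜 : Finset Cuboid} {a : Fin 3} {v w : Corner}
    (h : (cornerGraph 𝓜 a).Adj v w) : CornerStep 𝓜 a v w ∨ CornerStep 𝓜 a w v :=
  ((SimpleGraph.fromRel_adj _ _ _).1 h).2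

theorem CornerStep.reachable {𝓜 : Finset Cuboid} {a : Fin 3} {v w : Corner}
    (h : CornerStep 𝓜 a v w) : (cornerGraph 𝓜 a).Reachable v w := by
  refine SimpleGraph.Adj.reachable ((SimpleGraph.fromRel_adj _ _ _).2 ⟨?_, Or.inl h⟩)
  rintro rfl
  obtain ⟨-, -, ⟨-, h1, h2, -⟩ | ⟨-, h1, h2, -⟩⟩ := h
  · rw [h1] at h2; exact absurd h2 (by decide)
  · rw [h1] at h2; exact absurd h2 (by decide)

theorem reachable_key_eq {𝓜 : Finset Cuboid} {a : Fin 3} {v w : Corner}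
    (h : (cornerGraph 𝓜 a).Reachable v w) : cornerKey a v = cornerKey a w := by
  obtain ⟨p⟩ := h
  induction p with
  | nil => rfl
  | cons h _ ih => exact ((cornerGraph_adj h).elim (·.key_eq) (·.key_eq.symm)).trans ih

theorem reachable_mem {𝓜 : Finset Cuboid} {a : Fin 3} {v w : Corner}
    (h : (cornerGraph 𝓜 a).Reachable v w) (hv : v.1 ∈ 𝓜) : w.1 ∈ 𝓜 := by
  obtain ⟨p⟩ := h
  induction p with
  | nil => exact hv
  | cons h _ ih => exact ih ((cornerGraph_adj h).elim (·.2.1) (·.1))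

/-- Two cuboids on the same sides of the same edge overlap next to it, so the mesh contains only one
of them. -/
theorem eq_of_key_eq {Ω : Set E3} {𝓜 : Finset Cuboid} (h : IsMesh Ω 𝓜) {a : Fin 3}
    {v w : Corner} (hv : v.1 ∈ 𝓜) (hw : w.1 ∈ 𝓜) (hk : cornerKey a v = cornerKey a w)
    (hs : v.2 = w.2) : v = w := by
  obtain ⟨M, s, t⟩ := v
  obtain ⟨M', s', t'⟩ := w
  obtain ⟨rfl, rfl⟩ : s = s' ∧ t = t' := by simpa using hs
  simp only [cornerKey, Prod.mk.injEq] at hk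
  obtain ⟨k1, k2, k3, k4⟩ := hk
  have side : ∀ j s, sideCoord M j s = sideCoord M' j s → M.lo j < M'.hi j ∧ M'.lo j < M.hi j := by
    intro j s hj
    have := M.lt j; have := M'.lt j
    unfold sideCoord at hj
    split_ifs at hj <;> constructor <;> linarith
  have : M = M' := h.eq_of_overlap hv hw fun i => by
    rcases fin3_cases a i with rfl | rfl | rfl
    · exact ⟨k1.trans_lt (M'.lt _), k1.symm.trans_lt (M.lt _)⟩
    · exact side _ _ k3
    · exact side _ _ k4
  rw [this]

open Classical in
/-- The members of the connected component of `v`. -/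
def cornerClass (𝓜 : Finset Cuboid) (a : Fin 3) (v : Corner) : Finset Corner :=
  (𝓜 ×ˢ (Finset.univ : Finset (SignType × SignType))).filter
    fun w => (cornerGraph 𝓜 a).Reachable v w

theorem mem_cornerClass {𝓜 : Finset Cuboid} {a : Fin 3} {v w : Corner} :
    w ∈ cornerClass 𝓜 a v ↔ w.1 ∈ 𝓜 ∧ (cornerGraph 𝓜 a).Reachable v w := by
  simp [cornerClass]

/-- All members of a class see the edge in the same position, so the pair of signs determines the
member. Nine counts all pairs of signs; only four of them describe edges. -/
theorem card_cornerClass_le {Ω : Set E3} {𝓜 : Finset Cuboid} (h : IsMesh Ω 𝓜) (a : Fin 3)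
    (v : Corner) : (cornerClass 𝓜 a v).card ≤ 9 := by
  have : (Finset.univ : Finset (SignType × SignType)).card = 9 := by decide
  rw [← this]
  refine Finset.card_le_card_of_injOn (fun w => w.2) (fun _ _ => Finset.mem_univ _) ?_
  intro w hw w' hw' he
  rw [Finset.mem_coe, mem_cornerClass] at hw hw'
  exact eq_of_key_eq h hw.1 hw'.1
    ((reachable_key_eq hw.2).symm.trans (reachable_key_eq hw'.2)) he

/-- A representative of the connected component. -/
def cornerRep (𝓜 : Finset Cuboid) (a : Fin 3) (v : Corner) : Corner :=
  Quot.out ((cornerGraph 𝓜 a).connectedComponentMk v)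

theorem cornerRep_eq {𝓜 : Finset Cuboid} {a : Fin 3} {v w : Corner}
    (h : (cornerGraph 𝓜 a).Reachable v w) : cornerRep 𝓜 a v = cornerRep 𝓜 a w := by
  rw [cornerRep, cornerRep, SimpleGraph.ConnectedComponent.sound h]

theorem reachable_cornerRep (𝓜 : Finset Cuboid) (a : Fin 3) (v : Corner) :
    (cornerGraph 𝓜 a).Reachable v (cornerRep 𝓜 a v) :=
  (SimpleGraph.ConnectedComponent.exact (Quot.out_eq _)).symm

/-! ### The coefficients of the interpolant and their distance from the volume mean. -/

section Coefficients

variable {Ω : Set E3}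

/-- The sum of the differences between the face means and the mean over the cuboid. -/
def deviation (φ : H1 Ω) (M : Cuboid) (a : Fin 3) : ℝ :=
  ∑ b, (|faceMean φ M a b 1 - volMean φ M a| + |faceMean φ M a b (-1) - volMean φ M a|)

theorem deviation_nonneg (φ : H1 Ω) (M : Cuboid) (a : Fin 3) : 0 ≤ deviation φ M a :=
  Finset.sum_nonneg fun _ _ => by positivity

theorem abs_faceMean_sub_le_deviation (φ : H1 Ω) (M : Cuboid) (a b : Fin 3) {s : SignType}
    (hs : s ≠ 0) : |faceMean φ M a b s - volMean φ M a| ≤ deviation φ M a := by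
  refine le_trans ?_ (Finset.single_le_sum
    (f := fun b => |faceMean φ M a b 1 - volMean φ M a| + |faceMean φ M a b (-1) - volMean φ M a|)
    (fun b _ => by positivity) (Finset.mem_univ b))
  rcases s with _ | _ | _
  · exact absurd rfl hs
  · exact le_add_of_nonneg_left (abs_nonneg _)
  · exact le_add_of_nonneg_right (abs_nonneg _)

theorem faceMean_adj {𝓜 : Finset Cuboid} (h : IsMesh Ω 𝓜) (φ : H1 Ω) {b : Fin 3}
    {M M' : Cuboid} (hM : M ∈ 𝓜) (hM' : M' ∈ 𝓜) (ha : Adj b M M') (i : Fin 3) :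
    faceMean φ M i b 1 = faceMean φ M' i b (-1) :=
  faceMean_eq_of_adj h.isOpen φ ha (merge_openBox_subset h ha hM hM') (h.openBox_subset hM)
    (h.openBox_subset hM') i

/-- Both volume means are compared with the mean over the common face. -/
theorem abs_volMean_sub_le_of_adj {𝓜 : Finset Cuboid} (h : IsMesh Ω 𝓜) (φ : H1 Ω) {b : Fin 3}
    {M M' : Cuboid} (hM : M ∈ 𝓜) (hM' : M' ∈ 𝓜) (ha : Adj b M M') (a : Fin 3) :
    |volMean φ M a - volMean φ M' a| ≤ deviation φ M a + deviation φ M' a := by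
  have h1 := abs_faceMean_sub_le_deviation φ M a b (s := 1) (by decide)
  have h2 := abs_faceMean_sub_le_deviation φ M' a b (s := -1) (by decide)
  rw [← faceMean_adj h φ hM hM' ha] at h2
  rw [abs_le] at h1 h2 ⊢
  constructor <;> linarith [h1.1, h1.2, h2.1, h2.2]

theorem CornerStep.abs_volMean_sub_le {𝓜 : Finset Cuboid} (h : IsMesh Ω 𝓜) (φ : H1 Ω)
    {a : Fin 3} {v w : Corner} (hs : CornerStep 𝓜 a v w) :
    |volMean φ v.1 a - volMean φ w.1 a| ≤ deviation φ v.1 a + deviation φ w.1 a := by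
  obtain ⟨hv, hw, ⟨ha, -⟩ | ⟨ha, -⟩⟩ := hs
  · exact abs_volMean_sub_le_of_adj h φ hv hw ha a
  · exact abs_volMean_sub_le_of_adj h φ hv hw ha a

/-- Each step costs the deviations at its two ends, so every vertex of the walk is charged at most
twice. The additional term on the left keeps account of the first vertex and lets the induction
close. -/
theorem abs_volMean_sub_le_of_walk {𝓜 : Finset Cuboid} (h : IsMesh Ω 𝓜) (φ : H1 Ω) {a : Fin 3}
    {v w : Corner} (p : (cornerGraph 𝓜 a).Walk v w) :
    |volMean φ v.1 a - volMean φ w.1 a| + deviation φ v.1 a ≤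
      2 * (p.support.map fun u => deviation φ u.1 a).sum := by
  induction p with
  | nil =>
    rename_i u
    have := deviation_nonneg φ u.1 a
    simp
    linarith
  | cons hadj p ih =>
    rename_i u v w
    have h1 : |volMean φ u.1 a - volMean φ v.1 a| ≤ deviation φ u.1 a + deviation φ v.1 a := by
      rcases cornerGraph_adj hadj with hs | hs
      · exact hs.abs_volMean_sub_le h φ
      · rw [abs_sub_comm, add_comm]; exact hs.abs_volMean_sub_le h φ
    have h2 := abs_sub_le (volMean φ u.1 a) (volMean φ v.1 a) (volMean φ w.1 a)
    rw [SimpleGraph.Walk.support_cons, List.map_cons, List.sum_cons]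
    linarith

/-- A walk can be shortened to a path, which visits each member of the class at most once. -/
theorem abs_volMean_sub_le_of_reachable {𝓜 : Finset Cuboid} (h : IsMesh Ω 𝓜) (φ : H1 Ω)
    {a : Fin 3} {v w : Corner} (hv : v.1 ∈ 𝓜) (hr : (cornerGraph 𝓜 a).Reachable v w) :
    |volMean φ v.1 a - volMean φ w.1 a| ≤ 2 * ∑ u ∈ cornerClass 𝓜 a v, deviation φ u.1 a := by
  classical
  obtain ⟨p⟩ := hr
  have h1 := abs_volMean_sub_le_of_walk h φ (p.toPath : (cornerGraph 𝓜 a).Walk v w)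
  have h2 := deviation_nonneg φ v.1 a
  rw [← List.sum_toFinset _ p.toPath.2.support_nodup] at h1
  have h3 : ∑ u ∈ (p.toPath : (cornerGraph 𝓜 a).Walk v w).support.toFinset, deviation φ u.1 a ≤
      ∑ u ∈ cornerClass 𝓜 a v, deviation φ u.1 a := by
    refine Finset.sum_le_sum_of_subset_of_nonneg (fun u hu => ?_)
      fun u _ _ => deviation_nonneg φ u.1 a
    have hr : (cornerGraph 𝓜 a).Reachable v u :=
      ⟨(p.toPath : (cornerGraph 𝓜 a).Walk v w).takeUntil u (List.mem_toFinset.1 hu)⟩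
    exact mem_cornerClass.2 ⟨reachable_mem hr hv, hr⟩
  linarith

/-- The value on the edge of `M` in direction `a` on sides `s`, `t`. -/
def edgeMean (𝓜 : Finset Cuboid) (φ : H1 Ω) (a : Fin 3) (M : Cuboid) (s t : SignType) : ℝ :=
  volMean φ (cornerRep 𝓜 a (M, s, t)).1 a

/-- The coefficients of component `a` of the interpolant on `M`. -/
def coef (𝓜 : Finset Cuboid) (G : Grid) (φ : H1 Ω) (a : Fin 3) (M : Cuboid)
    (s t : SignType) : ℝ :=
  if s = 0 then
    if t = 0 then volMean φ M a
    else (faceMean φ M a (a + 2) t -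
      (edgeMean 𝓜 φ a M (-1) t * (G.knots M (a + 1)).mean (-1) +
        edgeMean 𝓜 φ a M 1 t * (G.knots M (a + 1)).mean 1)) / (G.knots M (a + 1)).mean 0
  else
    if t = 0 then (faceMean φ M a (a + 1) s -
      (edgeMean 𝓜 φ a M s (-1) * (G.knots M (a + 2)).mean (-1) +
        edgeMean 𝓜 φ a M s 1 * (G.knots M (a + 2)).mean 1)) / (G.knots M (a + 2)).mean 0
    else edgeMean 𝓜 φ a M s t

theorem Knots.mean_zero_pos (K : Knots) : 0 < K.mean 0 := by
  linarith [K.half_le_mean_zero]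

variable (𝓜 : Finset Cuboid) (G : Grid)

/-- The coefficient with `t = 0` is the solution of exactly this equation: the interpolant and `φ`
have the same mean over the face. -/
theorem sum_coef_mul_mean (φ : H1 Ω) (a : Fin 3) (M : Cuboid) {s : SignType} (hs : s ≠ 0) :
    ∑ t, coef 𝓜 G φ a M s t * (G.knots M (a + 2)).mean t = faceMean φ M a (a + 1) s := by
  have h1 : (-1 : SignType) ≠ 0 := by decide
  have h2 : (1 : SignType) ≠ 0 := by decide
  have := (G.knots M (a + 2)).mean_zero_pos.ne'
  rw [sum_signType]
  simp only [coef, hs, h1, h2, if_true, if_false]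
  rw [div_mul_cancel₀ _ this]
  ring

theorem sum_coef_mul_mean' (φ : H1 Ω) (a : Fin 3) (M : Cuboid) {t : SignType} (ht : t ≠ 0) :
    ∑ s, coef 𝓜 G φ a M s t * (G.knots M (a + 1)).mean s = faceMean φ M a (a + 2) t := by
  have h1 : (-1 : SignType) ≠ 0 := by decide
  have h2 : (1 : SignType) ≠ 0 := by decide
  have := (G.knots M (a + 1)).mean_zero_pos.ne'
  rw [sum_signType]
  simp only [coef, ht, h1, h2, if_true, if_false]
  rw [div_mul_cancel₀ _ this]
  ring

variable {𝓜 G}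

/-- The two corners lie in one component, so the edge values agree. The central coefficient is
computed from these, the common face mean and the common knots, so it agrees too. -/
theorem coef_adj (h : IsMesh Ω 𝓜) (hG : G.Compatible 𝓜) (φ : H1 Ω) (a : Fin 3) {M M' : Cuboid}
    (hM : M ∈ 𝓜) (hM' : M' ∈ 𝓜) (ha : Adj (a + 1) M M') (t : SignType) :
    coef 𝓜 G φ a M 1 t = coef 𝓜 G φ a M' (-1) t := by
  have h1 : (-1 : SignType) ≠ 0 := by decide
  have h2 : (1 : SignType) ≠ 0 := by decide
  have he : ∀ t, edgeMean 𝓜 φ a M 1 t = edgeMean 𝓜 φ a M' (-1) t := fun t => by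
    have hs : CornerStep 𝓜 a (M, 1, t) (M', -1, t) := ⟨hM, hM', Or.inl ⟨ha, rfl, rfl, rfl⟩⟩
    rw [edgeMean, edgeMean, cornerRep_eq hs.reachable]
  simp only [coef, h1, h2, if_false]
  rw [hG _ M hM M' hM' ha (a + 2) (fin3_ne a).2.2.symm, faceMean_adj h φ hM hM' ha, he, he, he]

theorem coef_adj' (h : IsMesh Ω 𝓜) (hG : G.Compatible 𝓜) (φ : H1 Ω) (a : Fin 3) {M M' : Cuboid}
    (hM : M ∈ 𝓜) (hM' : M' ∈ 𝓜) (ha : Adj (a + 2) M M') (s : SignType) :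
    coef 𝓜 G φ a M s 1 = coef 𝓜 G φ a M' s (-1) := by
  have h1 : (-1 : SignType) ≠ 0 := by decide
  have h2 : (1 : SignType) ≠ 0 := by decide
  have he : ∀ s, edgeMean 𝓜 φ a M s 1 = edgeMean 𝓜 φ a M' s (-1) := fun s => by
    have hs : CornerStep 𝓜 a (M, s, 1) (M', s, -1) := ⟨hM, hM', Or.inr ⟨ha, rfl, rfl, rfl⟩⟩
    rw [edgeMean, edgeMean, cornerRep_eq hs.reachable]
  simp only [coef, h1, h2, if_false]
  rw [hG _ M hM M' hM' ha (a + 1) (fin3_ne a).2.2, faceMean_adj h φ hM hM' ha, he, he, he]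

theorem edgeMean_add (h : IsMesh Ω 𝓜) (φ ψ : H1 Ω) (a : Fin 3) {M : Cuboid} (hM : M ∈ 𝓜)
    (s t : SignType) :
    edgeMean 𝓜 (φ + ψ) a M s t = edgeMean 𝓜 φ a M s t + edgeMean 𝓜 ψ a M s t :=
  volMean_add φ ψ (h.openBox_subset (reachable_mem (reachable_cornerRep 𝓜 a (M, s, t)) hM)) a

theorem edgeMean_smul (h : IsMesh Ω 𝓜) (c : ℝ) (φ : H1 Ω) (a : Fin 3) {M : Cuboid} (hM : M ∈ 𝓜)
    (s t : SignType) : edgeMean 𝓜 (c • φ) a M s t = c * edgeMean 𝓜 φ a M s t :=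
  volMean_smul c φ (h.openBox_subset (reachable_mem (reachable_cornerRep 𝓜 a (M, s, t)) hM)) a

theorem coef_add (h : IsMesh Ω 𝓜) (φ ψ : H1 Ω) (a : Fin 3) {M : Cuboid} (hM : M ∈ 𝓜)
    (s t : SignType) :
    coef 𝓜 G (φ + ψ) a M s t = coef 𝓜 G φ a M s t + coef 𝓜 G ψ a M s t := by
  simp only [coef, edgeMean_add h φ ψ a hM, faceMean_add φ ψ (h.openBox_subset hM),
    volMean_add φ ψ (h.openBox_subset hM)]
  split_ifs <;> ring

theorem coef_smul (h : IsMesh Ω 𝓜) (c : ℝ) (φ : H1 Ω) (a : Fin 3) {M : Cuboid} (hM : M ∈ 𝓜)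
    (s t : SignType) : coef 𝓜 G (c • φ) a M s t = c * coef 𝓜 G φ a M s t := by
  simp only [coef, edgeMean_smul h c φ a hM, faceMean_smul c φ (h.openBox_subset hM),
    volMean_smul c φ (h.openBox_subset hM)]
  split_ifs <;> ring

variable (𝓜) in
/-- The sum of the deviations over all cuboids that share an edge in direction `a` with `M`. -/
def edgeDeviation (φ : H1 Ω) (a : Fin 3) (M : Cuboid) : ℝ :=
  ∑ s, ∑ t, ∑ u ∈ cornerClass 𝓜 a (M, s, t), deviation φ u.1 a

theorem cornerClass_sum_le (φ : H1 Ω) (a : Fin 3) (M : Cuboid) (s t : SignType) :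
    ∑ u ∈ cornerClass 𝓜 a (M, s, t), deviation φ u.1 a ≤ edgeDeviation 𝓜 φ a M := by
  have h0 : ∀ s t, 0 ≤ ∑ u ∈ cornerClass 𝓜 a (M, s, t), deviation φ u.1 a := fun s t =>
    Finset.sum_nonneg fun u _ => deviation_nonneg φ u.1 a
  refine (Finset.single_le_sum (f := fun t => ∑ u ∈ cornerClass 𝓜 a (M, s, t), deviation φ u.1 a)
    (fun t _ => h0 s t) (Finset.mem_univ t)).trans ?_
  exact Finset.single_le_sum
    (f := fun s => ∑ t, ∑ u ∈ cornerClass 𝓜 a (M, s, t), deviation φ u.1 a)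
    (fun s _ => Finset.sum_nonneg fun t _ => h0 s t) (Finset.mem_univ s)

theorem deviation_le_edgeDeviation (φ : H1 Ω) (a : Fin 3) {M : Cuboid} (hM : M ∈ 𝓜) :
    deviation φ M a ≤ edgeDeviation 𝓜 φ a M := by
  -- The label `(M, 0, 0)` describes no edge; it is a convenient one whose class contains `M`.
  have hm : ((M, 0, 0) : Corner) ∈ cornerClass 𝓜 a (M, 0, 0) :=
    mem_cornerClass.2 ⟨hM, SimpleGraph.Reachable.refl _⟩
  have := Finset.single_le_sum (f := fun u : Corner => deviation φ u.1 a)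
    (fun u _ => deviation_nonneg φ u.1 a) hm
  exact le_trans this (cornerClass_sum_le φ a M 0 0)

theorem abs_edgeMean_sub_le (h : IsMesh Ω 𝓜) (φ : H1 Ω) (a : Fin 3) {M : Cuboid} (hM : M ∈ 𝓜)
    (s t : SignType) :
    |edgeMean 𝓜 φ a M s t - volMean φ M a| ≤ 2 * edgeDeviation 𝓜 φ a M := by
  rw [abs_sub_comm]
  refine (abs_volMean_sub_le_of_reachable h φ (v := (M, s, t)) hM
    (reachable_cornerRep 𝓜 a (M, s, t))).trans ?_
  gcongr
  exact cornerClass_sum_le φ a M s t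

/-- The means add up to one, so `m` can be subtracted from all data. With `μ = K.mean 0` the
numerator is then at most `D + 2 * D * (1 - μ)`, and `μ ≥ 1 / 2` bounds the quotient by `4 * D`. -/
theorem abs_face_coef_sub_le (K : Knots) {A e₁ e₂ m D : ℝ} (hA : |A - m| ≤ D)
    (h₁ : |e₁ - m| ≤ 2 * D) (h₂ : |e₂ - m| ≤ 2 * D) :
    |(A - (e₁ * K.mean (-1) + e₂ * K.mean 1)) / K.mean 0 - m| ≤ 4 * D := by
  have hs := K.sum_mean
  rw [sum_signType] at hs
  have h0 := K.half_le_mean_zero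
  have hp := K.mean_zero_pos
  have hD : 0 ≤ D := (abs_nonneg _).trans hA
  have p1 := K.mean_nonneg (-1)
  have p2 := K.mean_nonneg 1
  have e : (A - (e₁ * K.mean (-1) + e₂ * K.mean 1)) / K.mean 0 - m =
      ((A - m) - ((e₁ - m) * K.mean (-1) + (e₂ - m) * K.mean 1)) / K.mean 0 := by
    rw [div_sub' hp.ne']
    congr 1
    linear_combination (-m) * hs
  rw [e, abs_div, abs_of_pos hp, div_le_iff₀ hp]
  have k1 : |(e₁ - m) * K.mean (-1)| ≤ 2 * D * K.mean (-1) := by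
    rw [abs_mul, abs_of_nonneg p1]; gcongr
  have k2 : |(e₂ - m) * K.mean 1| ≤ 2 * D * K.mean 1 := by
    rw [abs_mul, abs_of_nonneg p2]; gcongr
  have k3 : |(A - m) - ((e₁ - m) * K.mean (-1) + (e₂ - m) * K.mean 1)| ≤
      D + (2 * D * K.mean (-1) + 2 * D * K.mean 1) :=
    (abs_sub _ _).trans (add_le_add hA ((abs_add_le _ _).trans (add_le_add k1 k2)))
  have k4 : 2 * D * K.mean (-1) + 2 * D * K.mean 1 = 2 * D * (1 - K.mean 0) := by
    linear_combination (2 * D) * hs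
  rw [k4] at k3
  have k5 : D * (1 / 2) ≤ D * K.mean 0 := by gcongr
  linarith

theorem abs_coef_sub_le (h : IsMesh Ω 𝓜) (φ : H1 Ω) (a : Fin 3) {M : Cuboid} (hM : M ∈ 𝓜)
    (s t : SignType) :
    |coef 𝓜 G φ a M s t - volMean φ M a| ≤ 4 * edgeDeviation 𝓜 φ a M := by
  have hd := deviation_le_edgeDeviation φ a hM
  have h0 := (deviation_nonneg φ M a).trans hd
  have he := abs_edgeMean_sub_le h φ a hM
  unfold coef
  split_ifs with hs ht ht
  · simpa using h0
  · exact abs_face_coef_sub_le _ ((abs_faceMean_sub_le_deviation φ M a _ ht).trans hd)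
      (he _ _) (he _ _)
  · exact abs_face_coef_sub_le _ ((abs_faceMean_sub_le_deviation φ M a _ hs).trans hd)
      (he _ _) (he _ _)
  · linarith [he s t]

end Coefficients

/-! ### Piecewise fields as elements of L². -/

/-- The field with components `F M i` on each `M`. -/
def piecewiseField (𝓜 : Finset Cuboid) (F : Cuboid → Fin 3 → E3 → ℝ) (x : E3) : E3 :=
  ∑ M ∈ 𝓜, M.openBox.indicator (fun x => WithLp.toLp 2 fun i => F M i x) x

theorem piecewiseField_eq {Ω : Set E3} {𝓜 : Finset Cuboid} (h : IsMesh Ω 𝓜)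
    (F : Cuboid → Fin 3 → E3 → ℝ) {M : Cuboid} (hM : M ∈ 𝓜) {x : E3} (hx : x ∈ M.openBox) :
    piecewiseField 𝓜 F x = WithLp.toLp 2 fun i => F M i x := by
  rw [piecewiseField, Finset.sum_eq_single M, indicator_of_mem hx]
  · intro M' hM' hne
    exact indicator_of_notMem
      (fun hx' => Set.disjoint_left.1 (h.nonoverlapping M' hM' M hM hne) hx' hx) _
  · exact fun h => absurd hM h

/-- Measurability and boundedness on every cuboid. -/
def BoundedOn (𝓜 : Finset Cuboid) (F : Cuboid → Fin 3 → E3 → ℝ) : Prop :=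
  ∀ M ∈ 𝓜, ∀ i, Measurable (F M i) ∧ ∃ C, ∀ x ∈ M.openBox, |F M i x| ≤ C

theorem norm_toLp_le_sum (f : Fin 3 → ℝ) : ‖(WithLp.toLp 2 f : E3)‖ ≤ ∑ i, |f i| := by
  have : (WithLp.toLp 2 f : E3) = ∑ i, EuclideanSpace.single i (f i) := by
    ext j
    simp [Finset.sum_apply]
  rw [this]
  refine (norm_sum_le _ _).trans (Finset.sum_le_sum fun i _ => ?_)
  simp

theorem BoundedOn.memLp {𝓜 : Finset Cuboid} {F : Cuboid → Fin 3 → E3 → ℝ} (hF : BoundedOn 𝓜 F)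
    (Ω : Set E3) : MemLp (piecewiseField 𝓜 F) 2 (volume.restrict Ω) := by
  refine MemLp.restrict _ ?_
  unfold piecewiseField
  refine memLp_finsetSum _ fun M hM => ?_
  rw [memLp_indicator_iff_restrict M.measurableSet_openBox]
  choose h1 C hC using fun i => hF M hM i
  refine MemLp.of_bound (C := ∑ i, C i) ?_ ?_
  · exact ((PiLp.continuous_toLp 2 _).measurable.comp
      (measurable_pi_lambda _ h1)).aestronglyMeasurable
  · refine (ae_restrict_mem M.measurableSet_openBox).mono fun x hx => ?_
    exact (norm_toLp_le_sum _).trans (Finset.sum_le_sum fun i _ => hC i x hx)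

/-- The class in `L²` of a piecewise field. -/
def BoundedOn.toL2 {𝓜 : Finset Cuboid} {F : Cuboid → Fin 3 → E3 → ℝ} (hF : BoundedOn 𝓜 F)
    (Ω : Set E3) : L2 Ω := (hF.memLp Ω).toLp _

theorem BoundedOn.toL2_ae {Ω : Set E3} {𝓜 : Finset Cuboid} (h : IsMesh Ω 𝓜)
    {F : Cuboid → Fin 3 → E3 → ℝ} (hF : BoundedOn 𝓜 F) {M : Cuboid} (hM : M ∈ 𝓜) :
    ∀ᵐ x ∂volume.restrict M.openBox, hF.toL2 Ω x = WithLp.toLp 2 fun i => F M i x := by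
  filter_upwards [ae_mono (Measure.restrict_mono (h.openBox_subset hM) le_rfl)
    (hF.memLp Ω).coeFn_toLp, ae_restrict_mem M.measurableSet_openBox] with x hx hxM
  rw [BoundedOn.toL2, hx, piecewiseField_eq h F hM hxM]

theorem integrableOn_sq_coord {Ω : Set E3} (u : L2 Ω) (i : Fin 3) :
    IntegrableOn (fun x => u x i ^ 2) Ω := (memLp_coord u i).integrable_sq

theorem norm_sq_eq_integral {Ω : Set E3} (u : L2 Ω) : ‖u‖ ^ 2 = ∑ i, ∫ x in Ω, u x i ^ 2 := by
  rw [← real_inner_self_eq_norm_sq, L2.inner_def,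
    ← integral_finsetSum _ fun i _ => integrableOn_sq_coord u i]
  refine integral_congr_ae (Filter.Eventually.of_forall fun x => ?_)
  simp only
  rw [real_inner_self_eq_norm_sq, EuclideanSpace.real_norm_sq_eq]

theorem norm_sq_eq_sum {Ω : Set E3} {𝓜 : Finset Cuboid} (h : IsMesh Ω 𝓜) (u : L2 Ω) :
    ‖u‖ ^ 2 = ∑ M ∈ 𝓜, ∑ i, ∫ x in M.openBox, u x i ^ 2 := by
  rw [norm_sq_eq_integral, Finset.sum_comm]
  exact Finset.sum_congr rfl fun i _ => h.integral_eq_sum (integrableOn_sq_coord u i)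

theorem BoundedOn.norm_sq_toL2 {Ω : Set E3} {𝓜 : Finset Cuboid} (h : IsMesh Ω 𝓜)
    {F : Cuboid → Fin 3 → E3 → ℝ} (hF : BoundedOn 𝓜 F) :
    ‖hF.toL2 Ω‖ ^ 2 = ∑ M ∈ 𝓜, ∑ i, ∫ x in M.openBox, F M i x ^ 2 := by
  rw [norm_sq_eq_sum h]
  refine Finset.sum_congr rfl fun M hM => Finset.sum_congr rfl fun i _ => integral_congr_ae ?_
  filter_upwards [hF.toL2_ae h hM] with x hx
  rw [hx]

theorem BoundedOn.integral_toL2_mul {Ω : Set E3} {𝓜 : Finset Cuboid} (h : IsMesh Ω 𝓜)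
    {F : Cuboid → Fin 3 → E3 → ℝ} (hF : BoundedOn 𝓜 F) (i : Fin 3) {ψ : E3 → ℝ}
    (hψ : Continuous ψ) (hψ' : HasCompactSupport ψ) :
    ∫ x in Ω, hF.toL2 Ω x i * ψ x = ∑ M ∈ 𝓜, ∫ x in M.openBox, F M i x * ψ x := by
  rw [h.integral_eq_sum (integrable_coord_mul _ hψ hψ' i)]
  refine Finset.sum_congr rfl fun M hM => integral_congr_ae ?_
  filter_upwards [hF.toL2_ae h hM] with x hx
  rw [hx]

/-! ### The fields of the interpolation space -/

/-- Component `a` on `M` of the field with coefficients `C`. -/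
def fieldOn (G : Grid) (C : Fin 3 → Cuboid → SignType → SignType → ℝ) (M : Cuboid) (a : Fin 3)
    (x : E3) : ℝ :=
  planar (G.knots M (a + 1)) (G.knots M (a + 2)) (C a M) (x (a + 1)) (x (a + 2))

/-- The derivative of `fieldOn` in direction `a + 1`. -/
def dfieldOn₁ (G : Grid) (C : Fin 3 → Cuboid → SignType → SignType → ℝ) (M : Cuboid) (a : Fin 3)
    (x : E3) : ℝ :=
  dplanar (G.knots M (a + 1)) (G.knots M (a + 2)) (C a M) (x (a + 1)) (x (a + 2))

/-- The derivative of `fieldOn` in direction `a + 2`. -/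
def dfieldOn₂ (G : Grid) (C : Fin 3 → Cuboid → SignType → SignType → ℝ) (M : Cuboid) (a : Fin 3)
    (x : E3) : ℝ :=
  dplanar (G.knots M (a + 2)) (G.knots M (a + 1)) (fun s t => C a M t s) (x (a + 2)) (x (a + 1))

/-- Component `i` of the curl of the field with coefficients `C`. -/
def curlOn (G : Grid) (C : Fin 3 → Cuboid → SignType → SignType → ℝ) (M : Cuboid) (i : Fin 3)
    (x : E3) : ℝ :=
  dfieldOn₂ G C M (i + 2) x - dfieldOn₁ G C M (i + 1) x

theorem Grid.mem_Icc (G : Grid) {M : Cuboid} {x : E3} (hx : x ∈ M.openBox) (i : Fin 3) :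
    x i ∈ Icc (G.knots M i).lo (G.knots M i).hi := by
  rw [G.knots_lo, G.knots_hi]
  exact ⟨(hx i).1.le, (hx i).2.le⟩

theorem abs_planar_le (K L : Knots) (C : SignType → SignType → ℝ) {x y : ℝ}
    (hx : x ∈ Icc K.lo K.hi) (hy : y ∈ Icc L.lo L.hi) :
    |planar K L C x y| ≤ ∑ s, ∑ t, |C s t| := by
  refine (Finset.abs_sum_le_sum_abs _ _).trans (Finset.sum_le_sum fun s _ => ?_)
  refine (Finset.abs_sum_le_sum_abs _ _).trans (Finset.sum_le_sum fun t _ => ?_)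
  rw [abs_mul, abs_mul]
  exact mul_le_of_le_one_right (abs_nonneg _) (mul_le_one₀ (K.abs_shape_le_one s hx)
    (abs_nonneg _) (L.abs_shape_le_one t hy))

theorem abs_dplanar_le (K L : Knots) (C : SignType → SignType → ℝ) (x : ℝ) {y : ℝ}
    (hy : y ∈ Icc L.lo L.hi) : |dplanar K L C x y| ≤ K.slope * ∑ s, ∑ t, |C s t| := by
  rw [Finset.mul_sum]
  refine (Finset.abs_sum_le_sum_abs _ _).trans (Finset.sum_le_sum fun s _ => ?_)
  rw [Finset.mul_sum]
  refine (Finset.abs_sum_le_sum_abs _ _).trans (Finset.sum_le_sum fun t _ => ?_)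
  rw [abs_mul, abs_mul, mul_comm]
  refine mul_le_mul_of_nonneg_right ?_ (abs_nonneg _)
  exact (mul_le_mul (K.abs_dshape_le s x) (L.abs_shape_le_one t hy) (abs_nonneg _)
    K.slope_pos.le).trans_eq (mul_one _)

/-- The shape functions form a partition of unity, so constants are reproduced; estimates then
involve only differences of coefficients from a mean. -/
theorem planar_sub_const (K L : Knots) (C : SignType → SignType → ℝ) (m x y : ℝ) :
    planar K L (fun s t => C s t - m) x y = planar K L C x y - m := by
  have h1 : ∑ s, ∑ t, m * (K.shape s x * L.shape t y) = m := by
    simp only [← Finset.mul_sum, L.sum_shape, mul_one, K.sum_shape]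
  rw [planar]
  simp only [sub_mul, Finset.sum_sub_distrib]
  rw [h1]
  rfl

theorem dplanar_sub_const (K L : Knots) (C : SignType → SignType → ℝ) (m x y : ℝ) :
    dplanar K L (fun s t => C s t - m) x y = dplanar K L C x y := by
  have h1 : ∑ s, ∑ t, m * (K.dshape s x * L.shape t y) = 0 := by
    simp only [← Finset.mul_sum, L.sum_shape, mul_one, K.sum_dshape, mul_zero]
  rw [dplanar]
  simp only [sub_mul, Finset.sum_sub_distrib]
  rw [h1, sub_zero]
  rfl

theorem boundedOn_fieldOn (𝓜 : Finset Cuboid) (G : Grid)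
    (C : Fin 3 → Cuboid → SignType → SignType → ℝ) : BoundedOn 𝓜 (fieldOn G C) := fun _ _ _ =>
  ⟨(continuous_planar _ _ _).measurable, _, fun _ hx =>
    abs_planar_le _ _ _ (G.mem_Icc hx _) (G.mem_Icc hx _)⟩

theorem boundedOn_curlOn (𝓜 : Finset Cuboid) (G : Grid)
    (C : Fin 3 → Cuboid → SignType → SignType → ℝ) : BoundedOn 𝓜 (curlOn G C) := fun _ _ _ =>
  ⟨(measurable_dplanar _ _ _).sub (measurable_dplanar _ _ _), _, fun _ hx =>
    (abs_sub _ _).trans (add_le_add (abs_dplanar_le _ _ _ _ (G.mem_Icc hx _))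
      (abs_dplanar_le _ _ _ _ (G.mem_Icc hx _)))⟩

/-- Coefficients that agree on the common faces of neighbours. -/
def Conforming (𝓜 : Finset Cuboid) (C : Fin 3 → Cuboid → SignType → SignType → ℝ) : Prop :=
  ∀ a, ∀ M ∈ 𝓜, ∀ M' ∈ 𝓜, (Adj (a + 1) M M' → ∀ t, C a M 1 t = C a M' (-1) t) ∧
    (Adj (a + 2) M M' → ∀ s, C a M s 1 = C a M' s (-1))

theorem sum_integral_fieldOn₁ {Ω : Set E3} {𝓜 : Finset Cuboid} (h : IsMesh Ω 𝓜) {η : E3 → ℝ}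
    (hη : IsTest Ω η) {G : Grid} (hG : G.Compatible 𝓜)
    {C : Fin 3 → Cuboid → SignType → SignType → ℝ} (hC : Conforming 𝓜 C) (a : Fin 3) :
    ∑ M ∈ 𝓜, ∫ x in M.openBox,
      (fieldOn G C M a x * pderiv (a + 1) η x + dfieldOn₁ G C M a x * η x) = 0 :=
  sum_integral_planar_eq_zero h hη G hG (fin3_ne a).2.2.symm (C a)
    fun M hM M' hM' => (hC a M hM M' hM').1

theorem sum_integral_fieldOn₂ {Ω : Set E3} {𝓜 : Finset Cuboid} (h : IsMesh Ω 𝓜) {η : E3 → ℝ}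
    (hη : IsTest Ω η) {G : Grid} (hG : G.Compatible 𝓜)
    {C : Fin 3 → Cuboid → SignType → SignType → ℝ} (hC : Conforming 𝓜 C) (a : Fin 3) :
    ∑ M ∈ 𝓜, ∫ x in M.openBox,
      (fieldOn G C M a x * pderiv (a + 2) η x + dfieldOn₂ G C M a x * η x) = 0 := by
  simp only [fieldOn, planar_swap (G.knots _ (a + 1))]
  exact sum_integral_planar_eq_zero h hη G hG (fin3_ne a).2.2 (fun M s t => C a M t s)
    fun M hM M' hM' => (hC a M hM M' hM').2

/-- Component `i` of the curl takes the derivative in direction `a + 2` of component `a = i + 2` and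
in direction `a + 1` of component `a = i + 1`. Both have vanishing jump terms by conformity.
Component `a` is never differentiated in direction `a`, so its jumps in that direction do no harm.
-/
theorem isWeakCurl_field {Ω : Set E3} {𝓜 : Finset Cuboid} (h : IsMesh Ω 𝓜) {G : Grid}
    (hG : G.Compatible 𝓜) {C : Fin 3 → Cuboid → SignType → SignType → ℝ}
    (hC : Conforming 𝓜 C) :
    IsWeakCurl Ω ((boundedOn_fieldOn 𝓜 G C).toL2 Ω) ((boundedOn_curlOn 𝓜 G C).toL2 Ω) := by
  refine isWeakCurl_iff.2 fun η hη i => ?_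
  have e1 : i + 2 + 2 = i + 1 := by decide +revert
  have e2 : i + 1 + 1 = i + 2 := by decide +revert
  have h1 := sum_integral_fieldOn₂ h hη hG hC (i + 2)
  have h2 := sum_integral_fieldOn₁ h hη hG hC (i + 1)
  rw [e1] at h1
  rw [e2] at h2
  rw [(boundedOn_fieldOn 𝓜 G C).integral_toL2_mul h _ (hη.continuous_pderiv _)
      (hη.hasCompactSupport_pderiv _),
    (boundedOn_fieldOn 𝓜 G C).integral_toL2_mul h _ (hη.continuous_pderiv _)
      (hη.hasCompactSupport_pderiv _),
    (boundedOn_curlOn 𝓜 G C).integral_toL2_mul h _ hη.smooth.continuous hη.compact]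
  have hint : ∀ M : Cuboid, ∀ a b, IntegrableOn (fun x => fieldOn G C M a x * pderiv b η x)
      M.openBox := fun M a b =>
    (((continuous_planar _ _ _).mul (hη.continuous_pderiv b)).integrable_of_hasCompactSupport
      (hη.hasCompactSupport_pderiv b).mul_left).integrableOn
  have hd : ∀ (K L : Knots) (D : SignType → SignType → ℝ) (b c : Fin 3),
      Integrable fun x : E3 => dplanar K L D (x b) (x c) * η x := by
    intro K L D b c
    have := integrable_planar_mul hη.smooth.continuous hη.compact (ψ := fun _ => 0)
      continuous_const HasCompactSupport.zero K L D b c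
    simpa using this
  have hd₁ : ∀ M a, IntegrableOn (fun x => dfieldOn₁ G C M a x * η x) M.openBox := fun M a =>
    (hd _ _ _ _ _).integrableOn
  have hd₂ : ∀ M a, IntegrableOn (fun x => dfieldOn₂ G C M a x * η x) M.openBox := fun M a =>
    (hd _ _ _ _ _).integrableOn
  rw [← Finset.sum_sub_distrib, ← Finset.sum_neg_distrib, ← sub_eq_zero, ← Finset.sum_sub_distrib]
  rw [← sub_zero (0 : ℝ)]
  nth_rewrite 1 [← h1]
  rw [← h2, ← Finset.sum_sub_distrib]
  refine Finset.sum_congr rfl fun M _ => ?_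
  have e3 : ∫ x in M.openBox, curlOn G C M i x * η x =
      (∫ x in M.openBox, dfieldOn₂ G C M (i + 2) x * η x) -
        ∫ x in M.openBox, dfieldOn₁ G C M (i + 1) x * η x := by
    rw [← integral_sub (hd₂ _ _) (hd₁ _ _)]
    simp only [curlOn, sub_mul]
  rw [e3, integral_add (hint _ _ _) (hd₂ _ _), integral_add (hint _ _ _) (hd₁ _ _)]
  ring

/-! ### Polynomial representation on the elements -/

theorem Cuboid.DF_inv (E : Cuboid) : E.DF⁻¹ = Matrix.diagonal fun i => (E.len i)⁻¹ := by
  refine Matrix.inv_eq_right_inv ?_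
  rw [DF, Matrix.diagonal_mul_diagonal, ← Matrix.diagonal_one]
  congr 1
  funext i
  exact mul_inv_cancel₀ (E.len_pos i).ne'

theorem Cuboid.invF_apply (E : Cuboid) (x : E3) (i : Fin 3) :
    E.invF x i = (E.len i)⁻¹ * (x i - E.lo i) := by
  rw [invF, DF_inv, Matrix.mulVec_diagonal]

theorem Cuboid.covariant_apply (E : Cuboid) (θ : Fin 3 → MvPolynomial (Fin 3) ℝ) (x : E3)
    (i : Fin 3) : E.covariant θ x i = (E.len i)⁻¹ * MvPolynomial.eval (E.invF x) (θ i) := by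
  rw [covariant, DF_inv, Matrix.diagonal_transpose]
  exact Matrix.mulVec_diagonal (fun i => (E.len i)⁻¹)
    (fun i => MvPolynomial.eval (E.invF x) (θ i)) i

theorem Knots.exists_affine (K : Knots) {l u : ℝ} (ha : u ≤ K.a ∨ K.a ≤ l)
    (hb : u ≤ K.b ∨ K.b ≤ l) (s : SignType) :
    ∃ p q : ℝ, ∀ t ∈ Ioo l u, K.shape s t = p + q * t := by
  have h1 : ∃ p q : ℝ, ∀ t ∈ Ioo l u, K.shape (-1) t = p + q * t := by
    rcases ha with h | h
    · refine ⟨K.a / (K.a - K.lo), -(1 / (K.a - K.lo)), fun t ht => ?_⟩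
      rw [K.shape_neg_of_ge (ht.2.le.trans h)]
      ring
    · exact ⟨0, 0, fun t ht => by rw [K.shape_neg_of_le (h.trans ht.1.le)]; simp⟩
  have h2 : ∃ p q : ℝ, ∀ t ∈ Ioo l u, K.shape 1 t = p + q * t := by
    rcases hb with h | h
    · exact ⟨0, 0, fun t ht => by rw [K.shape_pos_of_le (ht.2.le.trans h)]; simp⟩
    · refine ⟨-(K.b / (K.hi - K.b)), 1 / (K.hi - K.b), fun t ht => ?_⟩
      rw [K.shape_pos_of_ge (h.trans ht.1.le)]
      ring
  rcases s with _ | _ | _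
  · obtain ⟨p, q, h⟩ := h1
    obtain ⟨p', q', h'⟩ := h2
    refine ⟨1 - p - p', -q - q', fun t ht => ?_⟩
    have := K.shape_zero t
    rw [h t ht, h' t ht] at this
    exact this.trans (by ring)
  · exact h1
  · exact h2

theorem degreeOf_affine_le (p q : ℝ) (i j : Fin 3) :
    (MvPolynomial.C p + MvPolynomial.C q * MvPolynomial.X i : MvPolynomial (Fin 3) ℝ).degreeOf j ≤
      if j = i then 1 else 0 := by
  refine (MvPolynomial.degreeOf_add_le _ _ _).trans (max_le ?_ ?_)
  · rw [MvPolynomial.degreeOf_C]; exact Nat.zero_le _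
  · refine (MvPolynomial.degreeOf_C_mul_le _ _ _).trans ?_
    rw [MvPolynomial.degreeOf_X]

theorem exists_refNedelec (G : Grid) (C : Fin 3 → Cuboid → SignType → SignType → ℝ)
    {M E : Cuboid} (hE : ∀ j, (E.hi j ≤ (G.knots M j).a ∨ (G.knots M j).a ≤ E.lo j) ∧
      (E.hi j ≤ (G.knots M j).b ∨ (G.knots M j).b ≤ E.lo j)) :
    ∃ θ ∈ refNedelec, ∀ x ∈ E.openBox,
      E.covariant θ x = WithLp.toLp 2 fun a => fieldOn G C M a x := by
  choose p q hpq using fun j => (G.knots M j).exists_affine (hE j).1 (hE j).2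
  -- The affine function `p + q t` in the reference coordinate, with `t = lo + len * x̂`.
  let lin : Fin 3 → SignType → MvPolynomial (Fin 3) ℝ := fun j s =>
    MvPolynomial.C (p j s + q j s * E.lo j) + MvPolynomial.C (q j s * E.len j) * MvPolynomial.X j
  have hlin : ∀ x ∈ E.openBox, ∀ j s,
      MvPolynomial.eval (E.invF x) (lin j s) = (G.knots M j).shape s (x j) := by
    intro x hx j s
    have hl := (E.len_pos j).ne'
    rw [hpq j s (x j) (hx j)]
    simp only [lin, map_add, map_mul, MvPolynomial.eval_C, MvPolynomial.eval_X, E.invF_apply]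
    field_simp
    ring
  -- The factor `E.len a` cancels the covariant factor `DF^{-T}`.
  refine ⟨fun a => ∑ s, ∑ t, MvPolynomial.C (E.len a * C a M s t) *
    (lin (a + 1) s * lin (a + 2) t), fun a j => ?_, fun x hx => ?_⟩
  · refine Finset.sum_induction _ (fun P : MvPolynomial (Fin 3) ℝ => P.degreeOf j ≤ _)
      (fun P Q hP hQ => (MvPolynomial.degreeOf_add_le _ _ _).trans (max_le hP hQ)) (by simp)
      fun s _ => Finset.sum_induction _ (fun P : MvPolynomial (Fin 3) ℝ => P.degreeOf j ≤ _)
      (fun P Q hP hQ => (MvPolynomial.degreeOf_add_le _ _ _).trans (max_le hP hQ)) (by simp)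
      fun t _ => ?_
    refine (MvPolynomial.degreeOf_C_mul_le _ _ _).trans ((MvPolynomial.degreeOf_mul_le _ _ _).trans
      ((add_le_add (degreeOf_affine_le _ _ _ _) (degreeOf_affine_le _ _ _ _)).trans ?_))
    decide +revert
  · ext a
    have hl := (E.len_pos a).ne'
    rw [E.covariant_apply]
    simp only [map_sum, map_mul, MvPolynomial.eval_C, hlin x hx]
    rw [fieldOn, planar, Finset.mul_sum]
    refine Finset.sum_congr rfl fun s _ => ?_
    rw [Finset.mul_sum]
    refine Finset.sum_congr rfl fun t _ => ?_
    field_simp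

/-! ### The mean values of the curl -/

theorem prod_fin3_shift (a : Fin 3) (h : Fin 3 → ℝ) :
    ∏ i, h i = h a * (h (a + 1) * h (a + 2)) := by
  have e : ∀ a : Fin 3, (Finset.univ : Finset (Fin 3)) = {a, a + 1, a + 2} := by decide
  obtain ⟨n1, n2, n3⟩ := fin3_ne a
  rw [e a, Finset.prod_insert (by simp [n1, n2]), Finset.prod_insert (by simp [n3]),
    Finset.prod_singleton]

theorem integral_openBox_two (E : Cuboid) (a : Fin 3) (f g : ℝ → ℝ) :
    ∫ x in E.openBox, f (x (a + 1)) * g (x (a + 2)) =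
      E.len a * ((∫ t in Ioo (E.lo (a + 1)) (E.hi (a + 1)), f t) *
        ∫ t in Ioo (E.lo (a + 2)) (E.hi (a + 2)), g t) := by
  obtain ⟨n1, n2, n3⟩ := fin3_ne a
  have h := integral_openBox_prod E
    (fun i t => if i = a + 1 then f t else if i = a + 2 then g t else 1)
  simp only [prod_fin3_shift a, n1, n2, n3.symm, if_true, if_false, one_mul] at h
  rw [h, setIntegral_const]
  simp [len, (E.lt a).le]

/-- Fubini separates the variables. The derivative integrates to a difference of end values, which
eliminates the coefficients with `s = 0` and leaves the two face means of the field. -/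
theorem integral_dfieldOn₁ (G : Grid) (C : Fin 3 → Cuboid → SignType → SignType → ℝ)
    (M : Cuboid) (a : Fin 3) :
    ∫ x in M.openBox, dfieldOn₁ G C M a x = M.vol / M.len (a + 1) *
      ((∑ t, C a M 1 t * (G.knots M (a + 2)).mean t) -
        ∑ t, C a M (-1) t * (G.knots M (a + 2)).mean t) := by
  set K := G.knots M (a + 1) with hK
  set L := G.knots M (a + 2) with hL
  have hint : ∀ s t, IntegrableOn (fun x : E3 => C a M s t *
      (K.dshape s (x (a + 1)) * L.shape t (x (a + 2)))) M.openBox := by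
    intro s t
    refine Integrable.const_mul ?_ _
    refine Integrable.of_bound (C := K.slope) ?_
      ((ae_restrict_mem M.measurableSet_openBox).mono fun x hx => ?_)
    · exact (((K.measurable_dshape s).comp
        (show Continuous fun x : E3 => x (a + 1) by fun_prop).measurable).mul
        ((L.continuous_shape t).measurable.comp
        (show Continuous fun x : E3 => x (a + 2) by fun_prop).measurable)).aestronglyMeasurable
    · rw [norm_mul]
      exact (mul_le_mul (K.abs_dshape_le s _) (L.abs_shape_le_one t (G.mem_Icc hx _))
        (abs_nonneg _) K.slope_pos.le).trans_eq (mul_one _)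
  have hI : ∀ s t, ∫ x in M.openBox, C a M s t *
      (K.dshape s (x (a + 1)) * L.shape t (x (a + 2))) =
      M.vol / M.len (a + 1) * (C a M s t * ((K.shape s K.hi - K.shape s K.lo) * L.mean t)) := by
    intro s t
    have hv : M.vol / M.len (a + 1) = M.len a * M.len (a + 2) := by
      rw [vol, prod_fin3_shift a]
      have := (M.len_pos (a + 1)).ne'
      field_simp
    have hlen : M.len (a + 2) = L.hi - L.lo := by rw [len, hL, G.knots_lo, G.knots_hi]
    rw [integral_const_mul, integral_openBox_two M a (K.dshape s) (L.shape t)]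
    rw [← G.knots_lo M (a + 1), ← G.knots_hi M (a + 1), ← G.knots_lo M (a + 2),
      ← G.knots_hi M (a + 2), K.integral_dshape, L.integral_shape, hv, hlen]
    ring
  unfold dfieldOn₁ dplanar
  rw [integral_finsetSum _ fun s _ => integrable_finsetSum _ fun t _ => hint s t]
  simp only [integral_finsetSum _ fun t _ => hint _ t, hI]
  rw [sum_signType]
  have h1 : (-1 : SignType) ≠ 1 := by decide
  have h2 : (1 : SignType) ≠ -1 := by decide
  have h3 : (0 : SignType) ≠ -1 := by decide
  have h4 : (0 : SignType) ≠ 1 := by decide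
  simp only [Knots.shape_lo, Knots.shape_hi, h1, h2, h3, h4, if_true, if_false, sub_self, zero_mul,
    mul_zero, Finset.sum_const_zero, zero_add, sub_zero, one_mul, zero_sub]
  rw [← Finset.mul_sum, ← Finset.mul_sum, ← mul_add]
  simp only [neg_mul, one_mul, mul_neg, Finset.sum_neg_distrib]
  ring

theorem integral_dfieldOn₂ (G : Grid) (C : Fin 3 → Cuboid → SignType → SignType → ℝ)
    (M : Cuboid) (a : Fin 3) :
    ∫ x in M.openBox, dfieldOn₂ G C M a x = M.vol / M.len (a + 2) *
      ((∑ s, C a M s 1 * (G.knots M (a + 1)).mean s) -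
        ∑ s, C a M s (-1) * (G.knots M (a + 1)).mean s) := by
  set K := G.knots M (a + 1) with hK
  set L := G.knots M (a + 2) with hL
  have hint : ∀ s t, IntegrableOn (fun x : E3 => C a M t s *
      (L.dshape s (x (a + 2)) * K.shape t (x (a + 1)))) M.openBox := by
    intro s t
    refine Integrable.const_mul ?_ _
    refine Integrable.of_bound (C := L.slope) ?_
      ((ae_restrict_mem M.measurableSet_openBox).mono fun x hx => ?_)
    · exact (((L.measurable_dshape s).comp
        (show Continuous fun x : E3 => x (a + 2) by fun_prop).measurable).mul
        ((K.continuous_shape t).measurable.comp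
        (show Continuous fun x : E3 => x (a + 1) by fun_prop).measurable)).aestronglyMeasurable
    · rw [norm_mul]
      exact (mul_le_mul (L.abs_dshape_le s _) (K.abs_shape_le_one t (G.mem_Icc hx _))
        (abs_nonneg _) L.slope_pos.le).trans_eq (mul_one _)
  have hI : ∀ s t, ∫ x in M.openBox, C a M t s *
      (L.dshape s (x (a + 2)) * K.shape t (x (a + 1))) =
      M.vol / M.len (a + 2) * (C a M t s * ((L.shape s L.hi - L.shape s L.lo) * K.mean t)) := by
    intro s t
    have hv : M.vol / M.len (a + 2) = M.len a * M.len (a + 1) := by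
      rw [vol, prod_fin3_shift a]
      have := (M.len_pos (a + 2)).ne'
      field_simp
    have hlen : M.len (a + 1) = K.hi - K.lo := by rw [len, hK, G.knots_lo, G.knots_hi]
    simp only [mul_comm (L.dshape s _)]
    rw [integral_const_mul, integral_openBox_two M a (K.shape t) (L.dshape s)]
    rw [← G.knots_lo M (a + 1), ← G.knots_hi M (a + 1), ← G.knots_lo M (a + 2),
      ← G.knots_hi M (a + 2), L.integral_dshape, K.integral_shape, hv, hlen]
    ring
  unfold dfieldOn₂ dplanar
  rw [integral_finsetSum _ fun s _ => integrable_finsetSum _ fun t _ => hint s t]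
  simp only [integral_finsetSum _ fun t _ => hint _ t, hI]
  rw [sum_signType]
  have h1 : (-1 : SignType) ≠ 1 := by decide
  have h2 : (1 : SignType) ≠ -1 := by decide
  have h3 : (0 : SignType) ≠ -1 := by decide
  have h4 : (0 : SignType) ≠ 1 := by decide
  simp only [Knots.shape_lo, Knots.shape_hi, h1, h2, h3, h4, if_true, if_false, sub_self, zero_mul,
    mul_zero, Finset.sum_const_zero, zero_add, sub_zero, one_mul, zero_sub]
  rw [← Finset.mul_sum, ← Finset.mul_sum, ← mul_add]
  simp only [neg_mul, one_mul, mul_neg, Finset.sum_neg_distrib]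
  ring

/-! ### Stability estimates. -/

/-- The lengths of all edges of `M` are bounded by `K` times the lengths of its first and last grid
intervals. -/
def Grid.Regular (G : Grid) (K : ℝ) (M : Cuboid) : Prop :=
  ∀ i j, M.len i ≤ K * ((G.knots M j).a - (G.knots M j).lo) ∧
    M.len i ≤ K * ((G.knots M j).hi - (G.knots M j).b)

namespace Grid.Regular

variable {G : Grid} {K : ℝ} {M : Cuboid}

theorem pos (h : G.Regular K M) : 0 < K := by
  by_contra hn
  have h1 := (h 0 0).1
  have h2 := mul_nonpos_of_nonpos_of_nonneg (not_lt.1 hn)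
    (sub_pos.2 (G.knots M 0).lo_lt).le
  linarith [M.len_pos 0]

theorem len_le (h : G.Regular K M) (i j : Fin 3) : M.len i ≤ K * M.len j := by
  refine (h i j).1.trans (mul_le_mul_of_nonneg_left ?_ h.pos.le)
  rw [len, ← G.knots_lo, ← G.knots_hi]
  linarith [(G.knots M j).a_le, (G.knots M j).lt_hi]

theorem slope_le (h : G.Regular K M) (i j : Fin 3) : (G.knots M j).slope ≤ 2 * K / M.len i := by
  have hl := M.len_pos i
  have h1 : 1 / ((G.knots M j).a - (G.knots M j).lo) ≤ K / M.len i := by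
    rw [div_le_div_iff₀ (sub_pos.2 (G.knots M j).lo_lt) hl, one_mul]
    exact (h i j).1
  have h2 : 1 / ((G.knots M j).hi - (G.knots M j).b) ≤ K / M.len i := by
    rw [div_le_div_iff₀ (sub_pos.2 (G.knots M j).lt_hi) hl, one_mul]
    exact (h i j).2
  rw [Knots.slope, mul_div_assoc]
  linarith

theorem vol_le (h : G.Regular K M) (a : Fin 3) : M.vol ≤ K ^ 2 * M.len a ^ 3 := by
  have hK := h.pos
  have h0 := M.len_pos a
  rw [vol, prod_fin3_shift a]
  calc M.len a * (M.len (a + 1) * M.len (a + 2))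
      ≤ M.len a * ((K * M.len a) * (K * M.len a)) := by
        gcongr
        · exact (M.len_pos _).le
        · exact h.len_le _ _
        · exact h.len_le _ _
    _ = _ := by ring

theorem le_vol (h : G.Regular K M) (a : Fin 3) : M.len a ^ 3 ≤ K ^ 2 * M.vol := by
  have hK := h.pos
  have h0 := M.len_pos a
  have h1 := M.len_pos (a + 1)
  rw [vol, prod_fin3_shift a]
  calc M.len a ^ 3 = M.len a * (M.len a * M.len a) := by ring
    _ ≤ M.len a * ((K * M.len (a + 1)) * (K * M.len (a + 2))) := by
        gcongr
        · exact h.len_le _ _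
        · exact h.len_le _ _
    _ = _ := by ring

end Grid.Regular

section Estimates

variable {Ω : Set E3} {𝓜 : Finset Cuboid} {G : Grid} {K : ℝ}

/-- The squared `L²(M)` norm of the gradient of component `a`. -/
def gradSq (φ : H1 Ω) (M : Cuboid) (a : Fin 3) : ℝ := ∑ b, ∫ x in M.openBox, φ.1.2 b x a ^ 2

theorem gradSq_nonneg (φ : H1 Ω) (M : Cuboid) (a : Fin 3) : 0 ≤ gradSq φ M a :=
  Finset.sum_nonneg fun _ _ => integral_nonneg fun _ => sq_nonneg _

/-- Shape regularity makes `vol` comparable to the cube of `len a`, which turns the bound for `vol *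
deviation ^ 2` by `len a ^ 2 * gradSq` into this one. The factor 12 comes from three directions, two
faces each, and the square of a sum of two terms. -/
theorem len_mul_sq_deviation_le (φ : H1 Ω) {M : Cuboid} (hM : M.openBox ⊆ Ω)
    (hG : G.Regular K M) (a : Fin 3) :
    M.len a * deviation φ M a ^ 2 ≤ 12 * K ^ 4 * gradSq φ M a := by
  have hK := hG.pos
  have hl := M.len_pos a
  have hv := M.vol_pos
  have h1 : deviation φ M a ^ 2 ≤ 6 * ∑ b, ((faceMean φ M a b 1 - volMean φ M a) ^ 2 +
      (faceMean φ M a b (-1) - volMean φ M a) ^ 2) := by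
    refine (sq_sum_le_card_mul_sum_sq (s := Finset.univ)).trans ?_
    rw [Finset.card_univ, Fintype.card_fin, show (6 : ℝ) = 3 * 2 by norm_num, mul_assoc,
      Finset.mul_sum Finset.univ _ (2 : ℝ)]
    push_cast
    gcongr with b
    refine (add_sq_le).trans_eq ?_
    rw [sq_abs, sq_abs]
  have h2 : ∀ b s, M.vol * (faceMean φ M a b s - volMean φ M a) ^ 2 ≤
      K ^ 2 * M.len a ^ 2 * ∫ x in M.openBox, φ.1.2 b x a ^ 2 := by
    intro b s
    refine (vol_mul_sq_faceMean_sub_le φ hM a b s).trans ?_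
    rw [← mul_pow]
    refine mul_le_mul_of_nonneg_right (pow_le_pow_left₀ (M.len_pos b).le (hG.len_le b a) 2)
      (integral_nonneg fun _ => sq_nonneg _)
  have h3 : M.vol * deviation φ M a ^ 2 ≤ 12 * K ^ 2 * M.len a ^ 2 * gradSq φ M a :=
    calc M.vol * deviation φ M a ^ 2
        ≤ M.vol * (6 * ∑ b, ((faceMean φ M a b 1 - volMean φ M a) ^ 2 +
            (faceMean φ M a b (-1) - volMean φ M a) ^ 2)) := by gcongr
      _ = 6 * ∑ b, (M.vol * (faceMean φ M a b 1 - volMean φ M a) ^ 2 +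
            M.vol * (faceMean φ M a b (-1) - volMean φ M a) ^ 2) := by
          simp only [← mul_add, ← Finset.mul_sum]; ring
      _ ≤ 6 * ∑ b, (K ^ 2 * M.len a ^ 2 * (∫ x in M.openBox, φ.1.2 b x a ^ 2) +
            K ^ 2 * M.len a ^ 2 * ∫ x in M.openBox, φ.1.2 b x a ^ 2) := by
          exact mul_le_mul_of_nonneg_left
            (Finset.sum_le_sum fun b _ => add_le_add (h2 b 1) (h2 b (-1))) (by norm_num)
      _ = _ := by
          simp only [← mul_add, ← Finset.mul_sum, gradSq, Finset.sum_add_distrib]; ring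
  have h4 := hG.le_vol a
  have h5 : M.len a ^ 2 * (M.len a * deviation φ M a ^ 2) ≤
      M.len a ^ 2 * (12 * K ^ 4 * gradSq φ M a) :=
    calc M.len a ^ 2 * (M.len a * deviation φ M a ^ 2)
        = M.len a ^ 3 * deviation φ M a ^ 2 := by ring
      _ ≤ K ^ 2 * M.vol * deviation φ M a ^ 2 := by gcongr
      _ = K ^ 2 * (M.vol * deviation φ M a ^ 2) := by ring
      _ ≤ K ^ 2 * (12 * K ^ 2 * M.len a ^ 2 * gradSq φ M a) := by gcongr
      _ = _ := by ring
  exact le_of_mul_le_mul_left h5 (by positivity)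

theorem sq_edgeDeviation_le (h : IsMesh Ω 𝓜) (φ : H1 Ω) (a : Fin 3) (M : Cuboid) :
    edgeDeviation 𝓜 φ a M ^ 2 ≤
      81 * ∑ s, ∑ t, ∑ u ∈ cornerClass 𝓜 a (M, s, t), deviation φ u.1 a ^ 2 := by
  have hc : (Finset.univ : Finset SignType).card = 3 := by decide
  have h1 : ∀ s t, (∑ u ∈ cornerClass 𝓜 a (M, s, t), deviation φ u.1 a) ^ 2 ≤
      9 * ∑ u ∈ cornerClass 𝓜 a (M, s, t), deviation φ u.1 a ^ 2 := by
    intro s t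
    refine sq_sum_le_card_mul_sum_sq.trans (mul_le_mul_of_nonneg_right ?_
      (Finset.sum_nonneg fun _ _ => sq_nonneg _))
    exact_mod_cast card_cornerClass_le h a (M, s, t)
  have h2 : ∀ s, (∑ t, ∑ u ∈ cornerClass 𝓜 a (M, s, t), deviation φ u.1 a) ^ 2 ≤
      27 * ∑ t, ∑ u ∈ cornerClass 𝓜 a (M, s, t), deviation φ u.1 a ^ 2 := by
    intro s
    refine sq_sum_le_card_mul_sum_sq.trans ?_
    rw [hc, show (27 : ℝ) = 3 * 9 by norm_num, mul_assoc, Finset.mul_sum Finset.univ _ (9 : ℝ)]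
    push_cast
    gcongr with t
    exact h1 s t
  refine sq_sum_le_card_mul_sum_sq.trans ?_
  rw [hc, show (81 : ℝ) = 3 * 27 by norm_num, mul_assoc, Finset.mul_sum Finset.univ _ (27 : ℝ)]
  push_cast
  gcongr with s
  exact h2 s

/-- The weight `M.len a` is the length of the edge itself, the same for every cuboid of the class.
So the sizes of different cuboids never have to be compared. -/
theorem len_mul_sq_edgeDeviation_le (h : IsMesh Ω 𝓜) (hG : ∀ M ∈ 𝓜, G.Regular K M) (φ : H1 Ω)
    (a : Fin 3) (M : Cuboid) :
    M.len a * edgeDeviation 𝓜 φ a M ^ 2 ≤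
      972 * K ^ 4 * ∑ s, ∑ t, ∑ u ∈ cornerClass 𝓜 a (M, s, t), gradSq φ u.1 a := by
  have hl := M.len_pos a
  refine (mul_le_mul_of_nonneg_left (sq_edgeDeviation_le h φ a M) hl.le).trans ?_
  rw [show (972 : ℝ) * K ^ 4 = 81 * (12 * K ^ 4) by ring, mul_left_comm, mul_assoc]
  simp only [Finset.mul_sum]
  refine Finset.sum_le_sum fun s _ => Finset.sum_le_sum fun t _ => Finset.sum_le_sum fun u hu =>
    mul_le_mul_of_nonneg_left ?_ (by norm_num)
  have hu' := mem_cornerClass.1 hu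
  have hk := reachable_key_eq hu'.2
  simp only [cornerKey, Prod.mk.injEq] at hk
  have : M.len a = u.1.len a := by rw [len, len, hk.1, hk.2.1]
  rw [this]
  exact len_mul_sq_deviation_le φ (h.openBox_subset hu'.1) (hG _ hu'.1) a

/-- Reachability is symmetric, so the order of summation can be exchanged: a cuboid is counted for
each of its nine labels and at most nine members of the class of that label. -/
theorem sum_cornerClass_le (h : IsMesh Ω 𝓜) (a : Fin 3) {N : Cuboid → ℝ} (hN : ∀ M, 0 ≤ N M) :
    ∑ M ∈ 𝓜, ∑ s, ∑ t, ∑ u ∈ cornerClass 𝓜 a (M, s, t), N u.1 ≤ 81 * ∑ M ∈ 𝓜, N M := by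
  have e1 : ∑ M ∈ 𝓜, ∑ s, ∑ t, ∑ u ∈ cornerClass 𝓜 a (M, s, t), N u.1 =
      ∑ v ∈ 𝓜 ×ˢ (Finset.univ : Finset (SignType × SignType)),
        ∑ u ∈ cornerClass 𝓜 a v, N u.1 := by
    rw [Finset.sum_product]
    refine Finset.sum_congr rfl fun M _ => ?_
    rw [Fintype.sum_prod_type]
  have e2 : ∑ v ∈ 𝓜 ×ˢ (Finset.univ : Finset (SignType × SignType)),
      ∑ u ∈ cornerClass 𝓜 a v, N u.1 =
      ∑ u ∈ 𝓜 ×ˢ (Finset.univ : Finset (SignType × SignType)),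
        ∑ v ∈ cornerClass 𝓜 a u, N u.1 := by
    refine Finset.sum_comm' fun v u => ?_
    simp only [Finset.mem_product, Finset.mem_univ, and_true, mem_cornerClass]
    constructor
    · rintro ⟨h1, h2, h3⟩; exact ⟨⟨h1, h3.symm⟩, h2⟩
    · rintro ⟨⟨h1, h3⟩, h2⟩; exact ⟨h1, h2, h3.symm⟩
  have hc : (Finset.univ : Finset (SignType × SignType)).card = 9 := by decide
  calc _ = _ := e1.trans e2
    _ ≤ ∑ u ∈ 𝓜 ×ˢ (Finset.univ : Finset (SignType × SignType)), 9 * N u.1 := by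
        refine Finset.sum_le_sum fun u _ => ?_
        rw [Finset.sum_const, nsmul_eq_mul]
        refine mul_le_mul_of_nonneg_right ?_ (hN _)
        exact_mod_cast card_cornerClass_le h a u
    _ = _ := by
        rw [Finset.sum_product]
        simp only [Finset.sum_const, hc, nsmul_eq_mul]
        rw [Finset.mul_sum]
        refine Finset.sum_congr rfl fun M _ => ?_
        push_cast
        ring

theorem sum_len_mul_sq_edgeDeviation_le (h : IsMesh Ω 𝓜) (hG : ∀ M ∈ 𝓜, G.Regular K M)
    (φ : H1 Ω) (a : Fin 3) :
    ∑ M ∈ 𝓜, M.len a * edgeDeviation 𝓜 φ a M ^ 2 ≤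
      78732 * K ^ 4 * ∑ M ∈ 𝓜, gradSq φ M a := by
  refine (Finset.sum_le_sum fun M _ => len_mul_sq_edgeDeviation_le h hG φ a M).trans ?_
  rw [← Finset.mul_sum]
  calc 972 * K ^ 4 * ∑ M ∈ 𝓜, ∑ s, ∑ t, ∑ u ∈ cornerClass 𝓜 a (M, s, t), gradSq φ u.1 a
      ≤ 972 * K ^ 4 * (81 * ∑ M ∈ 𝓜, gradSq φ M a) := by
        exact mul_le_mul_of_nonneg_left
          (sum_cornerClass_le h a (N := fun M => gradSq φ M a) fun M => gradSq_nonneg φ M a)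
          (by positivity)
    _ = _ := by ring

variable (𝓜 G) in
/-- The coefficients of the interpolant of `φ`. -/
def coefs (φ : H1 Ω) : Fin 3 → Cuboid → SignType → SignType → ℝ := fun a M => coef 𝓜 G φ a M

theorem sum_abs_coef_sub_le (h : IsMesh Ω 𝓜) (φ : H1 Ω) (a : Fin 3) {M : Cuboid} (hM : M ∈ 𝓜) :
    ∑ s, ∑ t, |coefs 𝓜 G φ a M s t - volMean φ M a| ≤ 36 * edgeDeviation 𝓜 φ a M := by
  refine (Finset.sum_le_sum fun s _ => Finset.sum_le_sum fun t _ =>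
    abs_coef_sub_le h φ a hM s t).trans_eq ?_
  have hc : (Finset.univ : Finset SignType).card = 3 := by decide
  simp only [Finset.sum_const, hc, nsmul_eq_mul]
  push_cast
  ring

theorem edgeDeviation_nonneg (φ : H1 Ω) (a : Fin 3) (M : Cuboid) :
    0 ≤ edgeDeviation 𝓜 φ a M :=
  Finset.sum_nonneg fun _ _ => Finset.sum_nonneg fun _ _ => Finset.sum_nonneg fun u _ =>
    deviation_nonneg φ u.1 a

theorem integral_sq_le_of_abs_le (M : Cuboid) {f : E3 → ℝ} {c : ℝ}
    (hf : ∀ x ∈ M.openBox, |f x| ≤ c) : ∫ x in M.openBox, f x ^ 2 ≤ M.vol * c ^ 2 := by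
  have := norm_setIntegral_le_of_norm_le_const (f := fun x => f x ^ 2) (C := c ^ 2)
    M.isBounded_openBox.lt_top fun x hx => by
      rw [norm_pow]
      exact pow_le_pow_left₀ (norm_nonneg _) (hf x hx) 2
  rw [measureReal_def, M.volume_openBox, ENNReal.toReal_ofReal M.vol_pos.le] at this
  rw [mul_comm]
  exact (le_abs_self _).trans this

theorem integral_sq_fieldOn_le (h : IsMesh Ω 𝓜) (φ : H1 Ω) {M : Cuboid} (hM : M ∈ 𝓜)
    (hG : G.Regular K M) {D : ℝ} (hD : ∀ i, M.len i ≤ D) (a : Fin 3) :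
    ∫ x in M.openBox, fieldOn G (coefs 𝓜 G φ) M a x ^ 2 ≤
      2 * (∫ x in M.openBox, φ.1.1 x a ^ 2) +
        2592 * K ^ 2 * D ^ 2 * (M.len a * edgeDeviation 𝓜 φ a M ^ 2) := by
  have h0 := edgeDeviation_nonneg (𝓜 := 𝓜) φ a M
  have hl := M.len_pos a
  have hv := M.vol_pos
  set e := edgeDeviation 𝓜 φ a M
  set m := volMean φ M a with hm
  have h1 : ∀ x ∈ M.openBox, |fieldOn G (coefs 𝓜 G φ) M a x| ≤ |m| + 36 * e := by
    intro x hx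
    have h2 := (abs_planar_le _ _ (fun s t => coefs 𝓜 G φ a M s t - m) (G.mem_Icc hx (a + 1))
      (G.mem_Icc hx (a + 2))).trans (sum_abs_coef_sub_le h φ a hM)
    rw [planar_sub_const] at h2
    have h3 := abs_sub_abs_le_abs_sub (fieldOn G (coefs 𝓜 G φ) M a x) m
    unfold fieldOn at h3 ⊢
    linarith
  -- Two of the three lengths are absorbed into `D`. Only here does the size of the domain enter the
  -- estimate.
  have h4 : M.vol ≤ K ^ 2 * D ^ 2 * M.len a :=
    calc M.vol ≤ K ^ 2 * M.len a ^ 3 := hG.vol_le a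
      _ = K ^ 2 * M.len a ^ 2 * M.len a := by ring
      _ ≤ K ^ 2 * D ^ 2 * M.len a := by gcongr; exact hD a
  have h5 := vol_mul_sq_volMean_le φ (h.openBox_subset hM) a
  calc _ ≤ M.vol * (|m| + 36 * e) ^ 2 := integral_sq_le_of_abs_le M h1
    _ ≤ M.vol * (2 * (|m| ^ 2 + (36 * e) ^ 2)) := by gcongr; exact add_sq_le
    _ = 2 * (M.vol * m ^ 2) + 2592 * M.vol * e ^ 2 := by rw [sq_abs]; ring
    _ ≤ 2 * (∫ x in M.openBox, φ.1.1 x a ^ 2) + 2592 * (K ^ 2 * D ^ 2 * M.len a) * e ^ 2 := by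
        gcongr
    _ = _ := by ring

theorem vol_mul_sq_le (φ : H1 Ω) {M : Cuboid} (hG : G.Regular K M) (a : Fin 3) :
    M.vol * (72 * K / M.len a * edgeDeviation 𝓜 φ a M) ^ 2 ≤
      5184 * K ^ 4 * (M.len a * edgeDeviation 𝓜 φ a M ^ 2) := by
  have hl := M.len_pos a
  calc M.vol * (72 * K / M.len a * edgeDeviation 𝓜 φ a M) ^ 2
      ≤ K ^ 2 * M.len a ^ 3 * (72 * K / M.len a * edgeDeviation 𝓜 φ a M) ^ 2 := by
        gcongr; exact hG.vol_le a
    _ = _ := by field_simp; ring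

/-- Derivatives do not see the mean of `φ`, so it is subtracted first; the slopes then contribute `2
* K / M.len a` and the nine coefficients a factor 36. -/
theorem abs_dplanar_coef_le (h : IsMesh Ω 𝓜) (φ : H1 Ω) {M : Cuboid} (hM : M ∈ 𝓜)
    (hG : G.Regular K M) (a : Fin 3) {x : E3} (hx : x ∈ M.openBox) :
    |dfieldOn₁ G (coefs 𝓜 G φ) M a x| ≤ 72 * K / M.len a * edgeDeviation 𝓜 φ a M ∧
      |dfieldOn₂ G (coefs 𝓜 G φ) M a x| ≤ 72 * K / M.len a * edgeDeviation 𝓜 φ a M := by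
  have h0 := edgeDeviation_nonneg (𝓜 := 𝓜) φ a M
  have hs := sum_abs_coef_sub_le (G := G) h φ a hM
  have key : ∀ j, (G.knots M j).slope * (36 * edgeDeviation 𝓜 φ a M) ≤
      72 * K / M.len a * edgeDeviation 𝓜 φ a M := fun j =>
    calc _ ≤ 2 * K / M.len a * (36 * edgeDeviation 𝓜 φ a M) := by
          gcongr; exact hG.slope_le a j
      _ = _ := by ring
  constructor
  · rw [dfieldOn₁, ← dplanar_sub_const _ _ _ (volMean φ M a)]
    refine (abs_dplanar_le _ _ _ _ (G.mem_Icc hx _)).trans (le_trans ?_ (key (a + 1)))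
    exact mul_le_mul_of_nonneg_left hs (Knots.slope_pos _).le
  · rw [dfieldOn₂, ← dplanar_sub_const _ _ _ (volMean φ M a)]
    refine (abs_dplanar_le _ _ _ _ (G.mem_Icc hx _)).trans (le_trans ?_ (key (a + 2)))
    rw [Finset.sum_comm]
    exact mul_le_mul_of_nonneg_left hs (Knots.slope_pos _).le

theorem integral_sq_curlOn_le (h : IsMesh Ω 𝓜) (φ : H1 Ω) {M : Cuboid} (hM : M ∈ 𝓜)
    (hG : G.Regular K M) (i : Fin 3) :
    ∫ x in M.openBox, curlOn G (coefs 𝓜 G φ) M i x ^ 2 ≤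
      10368 * K ^ 4 * (M.len (i + 2) * edgeDeviation 𝓜 φ (i + 2) M ^ 2 +
        M.len (i + 1) * edgeDeviation 𝓜 φ (i + 1) M ^ 2) := by
  have hv := M.vol_pos
  have h2 := vol_mul_sq_le (𝓜 := 𝓜) φ hG (i + 2)
  have h1 := vol_mul_sq_le (𝓜 := 𝓜) φ hG (i + 1)
  set p := 72 * K / M.len (i + 2) * edgeDeviation 𝓜 φ (i + 2) M
  set q := 72 * K / M.len (i + 1) * edgeDeviation 𝓜 φ (i + 1) M
  have h3 : ∀ x ∈ M.openBox, |curlOn G (coefs 𝓜 G φ) M i x| ≤ p + q := fun x hx =>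
    (abs_sub _ _).trans (add_le_add (abs_dplanar_coef_le h φ hM hG (i + 2) hx).2
      (abs_dplanar_coef_le h φ hM hG (i + 1) hx).1)
  calc _ ≤ M.vol * (p + q) ^ 2 := integral_sq_le_of_abs_le M h3
    _ ≤ M.vol * (2 * (p ^ 2 + q ^ 2)) := by gcongr; exact add_sq_le
    _ = 2 * (M.vol * p ^ 2 + M.vol * q ^ 2) := by ring
    _ ≤ 2 * (5184 * K ^ 4 * (M.len (i + 2) * edgeDeviation 𝓜 φ (i + 2) M ^ 2) +
          5184 * K ^ 4 * (M.len (i + 1) * edgeDeviation 𝓜 φ (i + 1) M ^ 2)) := by gcongr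
    _ = _ := by ring

theorem sum_sum_gradSq (h : IsMesh Ω 𝓜) (φ : H1 Ω) :
    ∑ a, ∑ M ∈ 𝓜, gradSq φ M a = ∑ b, ‖φ.1.2 b‖ ^ 2 := by
  simp only [gradSq, norm_sq_eq_sum h]
  rw [Finset.sum_comm]
  rw [Finset.sum_comm (s := Finset.univ) (t := 𝓜)]
  refine Finset.sum_congr rfl fun M _ => Finset.sum_comm

theorem sum_fin3_shift (q : Fin 3 → ℝ) : ∑ i, (q (i + 2) + q (i + 1)) = 2 * ∑ i, q i := by
  simp only [Fin.sum_univ_three]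
  have e1 : (0 : Fin 3) + 2 = 2 := rfl
  have e2 : (1 : Fin 3) + 2 = 0 := rfl
  have e3 : (2 : Fin 3) + 2 = 1 := rfl
  have e4 : (0 : Fin 3) + 1 = 1 := rfl
  have e5 : (1 : Fin 3) + 1 = 2 := rfl
  have e6 : (2 : Fin 3) + 1 = 0 := rfl
  rw [e1, e2, e3, e4, e5, e6]
  ring

/-- Stability of the interpolant. -/
theorem norm_sq_interpolant_le (h : IsMesh Ω 𝓜) (hG : ∀ M ∈ 𝓜, G.Regular K M) {D : ℝ}
    (hD : ∀ M ∈ 𝓜, ∀ i, M.len i ≤ D) (φ : H1 Ω) :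
    ‖(boundedOn_fieldOn 𝓜 G (coefs 𝓜 G φ)).toL2 Ω‖ ^ 2 +
        ‖(boundedOn_curlOn 𝓜 G (coefs 𝓜 G φ)).toL2 Ω‖ ^ 2 ≤
      (2 + (2592 * K ^ 2 * D ^ 2 + 20736 * K ^ 4) * (78732 * K ^ 4)) *
        (‖φ.1.1‖ ^ 2 + ∑ j, ‖φ.1.2 j‖ ^ 2) := by
  set Q : ℝ := ∑ a, ∑ M ∈ 𝓜, M.len a * edgeDeviation 𝓜 φ a M ^ 2 with hQ
  have h1 : ‖(boundedOn_fieldOn 𝓜 G (coefs 𝓜 G φ)).toL2 Ω‖ ^ 2 ≤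
      2 * ‖φ.1.1‖ ^ 2 + 2592 * K ^ 2 * D ^ 2 * Q := by
    rw [BoundedOn.norm_sq_toL2 h, norm_sq_eq_sum h φ.1.1, hQ, Finset.sum_comm (t := 𝓜),
      Finset.mul_sum, Finset.mul_sum, ← Finset.sum_add_distrib]
    refine Finset.sum_le_sum fun M hM => ?_
    rw [Finset.mul_sum, Finset.mul_sum, ← Finset.sum_add_distrib]
    exact Finset.sum_le_sum fun a _ => integral_sq_fieldOn_le h φ hM (hG M hM) (hD M hM) a
  have h2 : ‖(boundedOn_curlOn 𝓜 G (coefs 𝓜 G φ)).toL2 Ω‖ ^ 2 ≤ 20736 * K ^ 4 * Q := by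
    rw [BoundedOn.norm_sq_toL2 h, hQ, Finset.sum_comm (t := 𝓜), Finset.mul_sum]
    refine Finset.sum_le_sum fun M hM => ?_
    refine (Finset.sum_le_sum fun i _ => integral_sq_curlOn_le h φ hM (hG M hM) i).trans_eq ?_
    -- Each component of the field occurs in two components of the curl.
    rw [← Finset.mul_sum, sum_fin3_shift fun a => M.len a * edgeDeviation 𝓜 φ a M ^ 2]
    ring
  have h3 : Q ≤ 78732 * K ^ 4 * ∑ j, ‖φ.1.2 j‖ ^ 2 := by
    rw [← sum_sum_gradSq h, Finset.mul_sum]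
    exact Finset.sum_le_sum fun a _ => sum_len_mul_sq_edgeDeviation_le h hG φ a
  have h4 : 0 ≤ ∑ j, ‖φ.1.2 j‖ ^ 2 := Finset.sum_nonneg fun _ _ => sq_nonneg _
  have h5 : 0 ≤ 2592 * K ^ 2 * D ^ 2 + 20736 * K ^ 4 := by positivity
  have h6 := mul_le_mul_of_nonneg_left h3 h5
  have h7 : 0 ≤ (2592 * K ^ 2 * D ^ 2 + 20736 * K ^ 4) * (78732 * K ^ 4) * ‖φ.1.1‖ ^ 2 := by
    positivity
  linarith

end Estimates

/-! ### The interpolation operator and the moments of its curl. -/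

theorem planar_add (K L : Knots) (C D : SignType → SignType → ℝ) (x y : ℝ) :
    planar K L (fun s t => C s t + D s t) x y = planar K L C x y + planar K L D x y := by
  simp only [planar, add_mul, Finset.sum_add_distrib]

theorem planar_smul (K L : Knots) (c : ℝ) (C : SignType → SignType → ℝ) (x y : ℝ) :
    planar K L (fun s t => c * C s t) x y = c * planar K L C x y := by
  simp only [planar, mul_assoc, Finset.mul_sum]

theorem dplanar_add (K L : Knots) (C D : SignType → SignType → ℝ) (x y : ℝ) :
    dplanar K L (fun s t => C s t + D s t) x y = dplanar K L C x y + dplanar K L D x y := by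
  simp only [dplanar, add_mul, Finset.sum_add_distrib]

theorem dplanar_smul (K L : Knots) (c : ℝ) (C : SignType → SignType → ℝ) (x y : ℝ) :
    dplanar K L (fun s t => c * C s t) x y = c * dplanar K L C x y := by
  simp only [dplanar, mul_assoc, Finset.mul_sum]

theorem BoundedOn.toL2_add (Ω : Set E3) {𝓜 : Finset Cuboid}
    {F₁ F₂ F : Cuboid → Fin 3 → E3 → ℝ} (h₁ : BoundedOn 𝓜 F₁) (h₂ : BoundedOn 𝓜 F₂)
    (h : BoundedOn 𝓜 F) (e : ∀ M ∈ 𝓜, ∀ i x, F M i x = F₁ M i x + F₂ M i x) :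
    h.toL2 Ω = h₁.toL2 Ω + h₂.toL2 Ω := by
  have : piecewiseField 𝓜 F = piecewiseField 𝓜 F₁ + piecewiseField 𝓜 F₂ := by
    funext x
    simp only [piecewiseField, Pi.add_apply]
    rw [← Finset.sum_add_distrib]
    refine Finset.sum_congr rfl fun M hM => ?_
    by_cases hx : x ∈ M.openBox
    · simp only [indicator_of_mem hx, e M hM]
      rfl
    · simp only [indicator_of_notMem hx, add_zero]
  rw [toL2, toL2, toL2, ← MemLp.toLp_add]
  congr

theorem BoundedOn.toL2_smul (Ω : Set E3) {𝓜 : Finset Cuboid} {F₁ F : Cuboid → Fin 3 → E3 → ℝ}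
    (c : ℝ) (h₁ : BoundedOn 𝓜 F₁) (h : BoundedOn 𝓜 F)
    (e : ∀ M ∈ 𝓜, ∀ i x, F M i x = c * F₁ M i x) : h.toL2 Ω = c • h₁.toL2 Ω := by
  have : piecewiseField 𝓜 F = c • piecewiseField 𝓜 F₁ := by
    funext x
    simp only [piecewiseField, Pi.smul_apply]
    rw [Finset.smul_sum]
    refine Finset.sum_congr rfl fun M hM => ?_
    by_cases hx : x ∈ M.openBox
    · simp only [indicator_of_mem hx, e M hM]
      rfl
    · simp only [indicator_of_notMem hx, smul_zero]
  rw [toL2, toL2, ← MemLp.toLp_const_smul]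
  congr

section Interpolant

variable {Ω : Set E3} {T 𝓜 : Finset Cuboid} {G : Grid}

theorem conforming_coefs (h : IsMesh Ω 𝓜) (hG : G.Compatible 𝓜) (φ : H1 Ω) :
    Conforming 𝓜 (coefs 𝓜 G φ) := fun a _ hM _ hM' =>
  ⟨fun ha t => coef_adj h hG φ a hM hM' ha t, fun ha s => coef_adj' h hG φ a hM hM' ha s⟩

/-- Every element of `T` lies in some `M`, on one side of each grid plane of `M`. -/
def Grid.Refines (G : Grid) (T 𝓜 : Finset Cuboid) : Prop :=
  ∀ E ∈ T, ∃ M ∈ 𝓜, E.openBox ⊆ M.openBox ∧ ∀ j,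
    (E.hi j ≤ (G.knots M j).a ∨ (G.knots M j).a ≤ E.lo j) ∧
    (E.hi j ≤ (G.knots M j).b ∨ (G.knots M j).b ≤ E.lo j)

theorem field_mem_nedelec (h : IsMesh Ω 𝓜) (hG : G.Compatible 𝓜) (hT : G.Refines T 𝓜)
    {C : Fin 3 → Cuboid → SignType → SignType → ℝ} (hC : Conforming 𝓜 C) :
    ((boundedOn_fieldOn 𝓜 G C).toL2 Ω, (boundedOn_curlOn 𝓜 G C).toL2 Ω) ∈ Nedelec Ω T := by
  refine ⟨isWeakCurl_field h hG hC, fun E hE => ?_⟩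
  obtain ⟨M, hM, hEM, hE'⟩ := hT E hE
  obtain ⟨θ, hθ, hθ'⟩ := exists_refNedelec G C hE'
  refine ⟨θ, hθ, ?_⟩
  filter_upwards [((boundedOn_fieldOn 𝓜 G C).memLp Ω).coeFn_toLp] with x hx hxE
  rw [hθ' x hxE, ← piecewiseField_eq h (fieldOn G C) hM (hEM hxE), ← hx]
  rfl

/-- The interpolation operator. -/
def interpolant (h : IsMesh Ω 𝓜) (hG : G.Compatible 𝓜) (hT : G.Refines T 𝓜) :
    H1 Ω →ₗ[ℝ] Nedelec Ω T where
  toFun φ := ⟨_, field_mem_nedelec h hG hT (conforming_coefs h hG φ)⟩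
  map_add' φ ψ := by
    refine Subtype.ext (Prod.ext ?_ ?_)
    · refine BoundedOn.toL2_add Ω (boundedOn_fieldOn 𝓜 G (coefs 𝓜 G φ))
        (boundedOn_fieldOn 𝓜 G (coefs 𝓜 G ψ)) (boundedOn_fieldOn 𝓜 G (coefs 𝓜 G (φ + ψ)))
        fun M hM a x => ?_
      simp only [fieldOn, ← planar_add, coefs]
      simp only [← coef_add h φ ψ _ hM]
    · refine BoundedOn.toL2_add Ω (boundedOn_curlOn 𝓜 G (coefs 𝓜 G φ))
        (boundedOn_curlOn 𝓜 G (coefs 𝓜 G ψ)) (boundedOn_curlOn 𝓜 G (coefs 𝓜 G (φ + ψ)))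
        fun M hM a x => ?_
      simp only [curlOn, dfieldOn₁, dfieldOn₂, coefs]
      rw [sub_add_sub_comm, ← dplanar_add, ← dplanar_add]
      simp only [← coef_add h φ ψ _ hM]
  map_smul' c φ := by
    refine Subtype.ext (Prod.ext ?_ ?_)
    · refine BoundedOn.toL2_smul Ω c (boundedOn_fieldOn 𝓜 G (coefs 𝓜 G φ))
        (boundedOn_fieldOn 𝓜 G (coefs 𝓜 G (c • φ))) fun M hM a x => ?_
      simp only [fieldOn, ← planar_smul, coefs]
      simp only [← coef_smul h c φ _ hM]
    · refine BoundedOn.toL2_smul Ω c (boundedOn_curlOn 𝓜 G (coefs 𝓜 G φ))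
        (boundedOn_curlOn 𝓜 G (coefs 𝓜 G (c • φ))) fun M hM a x => ?_
      simp only [curlOn, dfieldOn₁, dfieldOn₂, coefs]
      rw [mul_sub, ← dplanar_smul, ← dplanar_smul]
      simp only [← coef_smul h c φ _ hM]

theorem integrableOn_dplanar (G : Grid) (M : Cuboid) (C : SignType → SignType → ℝ) (b c : Fin 3) :
    IntegrableOn (fun x => dplanar (G.knots M b) (G.knots M c) C (x b) (x c)) M.openBox :=
  Integrable.of_bound (measurable_dplanar _ _ _).aestronglyMeasurable _
    ((ae_restrict_mem M.measurableSet_openBox).mono fun _ hx =>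
      abs_dplanar_le _ _ _ _ (G.mem_Icc hx c))

/-- Both derivatives in the curl integrate to differences of face means. These are the face means of
`φ`, and `integral_grad_eq` turns them back into integrals of weak derivatives. -/
theorem integral_curlOn (h : IsMesh Ω 𝓜) (φ : H1 Ω) {M : Cuboid} (hM : M ∈ 𝓜) (i : Fin 3) :
    ∫ x in M.openBox, curlOn G (coefs 𝓜 G φ) M i x = ∫ x in M.openBox, h1Curl φ x i := by
  have hs := h.openBox_subset hM
  have n1 : (1 : SignType) ≠ 0 := by decide
  have n2 : (-1 : SignType) ≠ 0 := by decide
  have e1 : i + 2 + 2 = i + 1 := by decide +revert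
  have e2 : i + 1 + 1 = i + 2 := by decide +revert
  have h2 : ∫ x in M.openBox, dfieldOn₂ G (coefs 𝓜 G φ) M (i + 2) x =
      ∫ x in M.openBox, φ.1.2 (i + 1) x (i + 2) := by
    rw [integral_dfieldOn₂, coefs, sum_coef_mul_mean' 𝓜 G φ (i + 2) M n1,
      sum_coef_mul_mean' 𝓜 G φ (i + 2) M n2, e1, integral_grad_eq φ hs]
  have h1 : ∫ x in M.openBox, dfieldOn₁ G (coefs 𝓜 G φ) M (i + 1) x =
      ∫ x in M.openBox, φ.1.2 (i + 2) x (i + 1) := by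
    rw [integral_dfieldOn₁, coefs, sum_coef_mul_mean 𝓜 G φ (i + 1) M n1,
      sum_coef_mul_mean 𝓜 G φ (i + 1) M n2, e2, integral_grad_eq φ hs]
  have hc : ∫ x in M.openBox, curlOn G (coefs 𝓜 G φ) M i x =
      (∫ x in M.openBox, dfieldOn₂ G (coefs 𝓜 G φ) M (i + 2) x) -
        ∫ x in M.openBox, dfieldOn₁ G (coefs 𝓜 G φ) M (i + 1) x :=
    integral_sub (integrableOn_dplanar G M _ _ _) (integrableOn_dplanar G M _ _ _)
  rw [hc, h2, h1, ← integral_sub (integrableOn_coord _ _ hs) (integrableOn_coord _ _ hs)]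
  rfl

theorem integral_inner_eq_sum {M : Cuboid} {f : E3 → E3}
    (hf : ∀ i, IntegrableOn (fun x => f x i) M.openBox) (p : E3) :
    ∫ x in M.openBox, inner ℝ (f x) p = ∑ i, (∫ x in M.openBox, f x i) * p i := by
  simp only [← integral_mul_const]
  rw [← integral_finsetSum _ fun i _ => (hf i).mul_const (p i)]
  refine integral_congr_ae (Filter.Eventually.of_forall fun x => ?_)
  simp only [PiLp.inner_apply, RCLike.inner_apply, conj_trivial, mul_comm]

theorem integral_inner_interpolant (h : IsMesh Ω 𝓜) (hG : G.Compatible 𝓜) (hT : G.Refines T 𝓜)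
    (φ : H1 Ω) {M : Cuboid} (hM : M ∈ 𝓜) (p : E3) :
    ∫ x in M.openBox, inner ℝ ((interpolant h hG hT φ).1.2 x) p =
      ∫ x in M.openBox, inner ℝ (h1Curl φ x) p := by
  have hs := h.openBox_subset hM
  rw [integral_inner_eq_sum (fun i => integrableOn_coord _ i hs), integral_inner_eq_sum fun i =>
    (integrableOn_coord (φ.1.2 (i + 1)) (i + 2) hs).sub
      (integrableOn_coord (φ.1.2 (i + 2)) (i + 1) hs)]
  refine Finset.sum_congr rfl fun i _ => ?_
  rw [← integral_curlOn (G := G) h φ hM i]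
  congr 1
  refine integral_congr_ae ?_
  filter_upwards [(boundedOn_curlOn 𝓜 G (coefs 𝓜 G φ)).toL2_ae h hM] with x hx
  exact congrArg (fun v : E3 => v i) hx

end Interpolant

theorem len_le_of_subset_ball {Ω : Set E3} {R : ℝ} (hR : Ω ⊆ Metric.ball 0 R) {M : Cuboid}
    (hM : M.openBox ⊆ Ω) (i : Fin 3) : M.len i ≤ 4 * R := by
  have key : ∀ x ∈ M.openBox, |x i| ≤ R := fun x hx => by
    have h1 := hR (hM hx)
    rw [mem_ball_zero_iff] at h1
    exact (PiLp.norm_apply_le x i).trans h1.le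
  -- The points at a quarter and at three quarters of each edge are strictly inside the box, so half
  -- a length is at most `2 * R`.
  have h1 := key (WithLp.toLp 2 fun j => M.lo j + M.len j / 4) fun j => by
    have := M.len_pos j
    simp only [len] at *
    constructor <;> linarith
  have h2 := key (WithLp.toLp 2 fun j => M.hi j - M.len j / 4) fun j => by
    have := M.len_pos j
    simp only [len] at *
    constructor <;> linarith
  rw [abs_le] at h1 h2
  have h3 := h1.1
  have h4 := h2.2
  simp only [len] at *
  linarith

end NedelecMacro

end

theorem mainTheorem8 (Ω : Set NedelecMacro.E3) (hΩ : IsOpen Ω) (hb : Bornology.IsBounded Ω)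
    (κ : ℝ) :
    ∃ C : ℝ, 0 < C ∧ ∀ T 𝓜 : Finset NedelecMacro.Cuboid,
      NedelecMacro.IsMesh Ω T → NedelecMacro.IsShapeRegular κ T →
      NedelecMacro.IsMacroMesh Ω T 𝓜 →
      ∃ P : NedelecMacro.H1 Ω →ₗ[ℝ] NedelecMacro.Nedelec Ω T,
        ∀ φ : NedelecMacro.H1 Ω,
          (∀ M ∈ 𝓜, ∀ p : NedelecMacro.E3,
            ∫ x in M.openBox, inner ℝ ((P φ).1.2 x) p =
              ∫ x in M.openBox, inner ℝ (NedelecMacro.h1Curl φ x) p) ∧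
          NedelecMacro.curlNorm (P φ).1 ≤ C * NedelecMacro.h1Norm φ := by
  obtain ⟨R, hR⟩ := hb.subset_ball 0
  -- The stability constant with regularity `K = 3 * κ ^ 2` from the grids and `D = 4 * R` as a
  -- bound for all lengths; the summand 2 makes it positive for every real `κ`.
  set A : ℝ := 2 + (2592 * (3 * κ ^ 2) ^ 2 * (4 * R) ^ 2 + 20736 * (3 * κ ^ 2) ^ 4) *
    (78732 * (3 * κ ^ 2) ^ 4) with hA
  have hA0 : 0 < A := by positivity
  refine ⟨Real.sqrt A, Real.sqrt_pos.2 hA0, fun T 𝓜 hT hκ h𝓜 => ?_⟩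
  obtain ⟨G, hG, hreg, href⟩ := NedelecMacro.exists_grid hT hκ h𝓜
  refine ⟨NedelecMacro.interpolant h𝓜.mesh hG href, fun φ => ⟨fun M hM p =>
    NedelecMacro.integral_inner_interpolant h𝓜.mesh hG href φ hM p, ?_⟩⟩
  rw [NedelecMacro.h1Norm, ← Real.sqrt_mul hA0.le]
  exact Real.sqrt_le_sqrt (NedelecMacro.norm_sq_interpolant_le h𝓜.mesh hreg
    (fun M hM i => NedelecMacro.len_le_of_subset_ball hR (h𝓜.mesh.openBox_subset hM) i) φ)
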